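/- Fix an inverse temperature $\beta>0$. For $N\ge 1$ let $\varepsilon>0$ be given by $\varepsilon^2N=1$, and consider $N$ identical hard spheres of diameter $\varepsilon$ on the torus $\mathbb{T}^3=[0,2\pi)^3$, with configurations $Z_N=(x_i,v_i)_{i\le N}$ in the phase space $\mathcal{M}_N=\{Z_N\in(\mathbb{T}^3\times\mathbb{R}^3)^N : |x_i-x_j|>\varepsilon \text{ for } i\ne j\}$. The spheres move freely between collisions; when $x_i-x_j=\varepsilon\omega$ with $|\omega|=1$ and $(v_i-v_j)\cdot\omega<0$, the velocities of $i$ and $j$ become $v_i-\omega[\omega\cdot(v_i-v_j)]$ and $v_j+\omega[\omega\cdot(v_i-v_j)]$. This dynamics is well defined for almost every initial configuration. Let the initial configuration (time $0$) be distributed according to the canonical Gibbs probability measure $\mathbb{P}^N_{eq}$ on $\mathcal{M}_N$, with density $\mathcal{Z}_N^{-1}\prod_{i=1}^N e^{-\frac{\beta}{2}|v_i|^2}$. The backward cluster $BC(1)=\{i_1,\dots,i_n\}$ of particle $1$ at time $t$ is constructed by going back in time along the trajectory from time $t$ to time $0$: $i_1$ is the first particle colliding with $1$; and, given $i_1,\dots,i_r$,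 the particle $i_{r+1}$ is the first particle outside $\{1,i_1,\dots,i_r\}$ that collides with a particle of $\{1,i_1,\dots,i_r\}$ at an earlier time; the procedure stops when there is no such collision down to time $0$. Let $S^N_{eq}(t)=\sum_{k=0}^{N-1}k\,\mathbb{P}^N_{eq}(|BC(1)|=k)$ be its average cardinality. Theorem. For every $t>0$ there exist an integer $k_0$ and a constant $C>0$ (which may depend on $t$ and $\beta$, but not on $N$) such that, for all $N\ge1$ and all $k>k_0$, $$\mathbb{P}^N_{eq}\big(|BC(1)|=k\big)\le C\,t\,e^{-\frac14 k^{1/(Ct)}} .$$ Moreover, $S^N_{eq}(t)$ is bounded uniformly in $N$ on bounded time intervals: for every $T>0$ there is a constant $M$ such that $S^N_{eq}(t)\le M$ for all $N\ge 1$ and all $t\in[0,T]$. -/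

import Mathlib

open scoped BigOperators ENNReal

noncomputable section

namespace HardSpheres

/-- Ordinary three-dimensional Euclidean space (velocities, unit vectors, displacements). -/
abbrev E3 : Type := EuclideanSpace ℝ (Fin 3)

instance two_pi_pos_fact : Fact ((0 : ℝ) < 2 * Real.pi) := ⟨Real.two_pi_pos⟩

/-- The three-dimensional torus `[0, 2π)³` with opposite faces identified. -/
abbrev Torus3 : Type := Fin 3 → AddCircle (2 * Real.pi)

/-- The covering projection of Euclidean space onto the torus. -/
def proj (w : E3) : Torus3 := fun a => (w a : AddCircle (2 * Real.pi))

/-- The Euclidean (flat) distance on the torus. The norm of a point of the circle is its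
distance to `0`, so this is the minimum of `‖w‖` over all lifts `w` of `x - y`. -/
def torusDist (x y : Torus3) : ℝ := Real.sqrt (∑ a, ‖x a - y a‖ ^ 2)

/-- Position and velocity of one particle. -/
abbrev State : Type := Torus3 × E3

/-- Positions and velocities of `N` particles. Its `volume` is the product measure
(Lebesgue measure, the torus having volume `(2π)³`). -/
abbrev Config (N : ℕ) : Type := Fin N → State

/-- The phase space of `N` hard spheres of diameter `ε`: no two of them touch or overlap. -/
def phaseSpace (N : ℕ) (ε : ℝ) : Set (Config N) :=
  {Z | ∀ i j, i ≠ j → ε < torusDist (Z i).1 (Z j).1}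

/-- Free motion of all the particles during a time `s`. -/
def freeFlow {N : ℕ} (s : ℝ) (Z : Config N) : Config N :=
  fun i => ((Z i).1 + proj (s • (Z i).2), (Z i).2)

/-- `Y'` results from `Y` by the elastic collision of exactly one pair `i, j` of spheres in
contact: `ω` is the unit vector from the centre of `j` to that of `i`, the velocities in `Y`
are incoming and not grazing, and no other pair is in contact. -/
def IsElasticCollision {N : ℕ} (ε : ℝ) (Y Y' : Config N) : Prop :=
  ∃ i j : Fin N, i ≠ j ∧ ∃ ω : E3, ‖ω‖ = 1 ∧
    (Y i).1 - (Y j).1 = proj (ε • ω) ∧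
    inner ℝ ω ((Y i).2 - (Y j).2) < 0 ∧
    (∀ k l, k ≠ l → torusDist (Y k).1 (Y l).1 ≤ ε → (k = i ∧ l = j) ∨ (k = j ∧ l = i)) ∧
    Y' i = ((Y i).1, (Y i).2 - inner ℝ ω ((Y i).2 - (Y j).2) • ω) ∧
    Y' j = ((Y j).1, (Y j).2 + inner ℝ ω ((Y i).2 - (Y j).2) • ω) ∧
    ∀ l, l ≠ i → l ≠ j → Y' l = Y l

/-- In the motion `γ`, particles `i` and `j` collide (are in contact) at time `s`. -/
def Collide {N : ℕ} (ε : ℝ) (γ : ℝ → Config N) (s : ℝ) (i j : Fin N) : Prop :=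
  i ≠ j ∧ torusDist (γ s i).1 (γ s j).1 = ε

/-- The collision times of the motion `γ` in `[0, t]`. -/
def collisionTimes {N : ℕ} (ε t : ℝ) (γ : ℝ → Config N) : Set ℝ :=
  {s | s ∈ Set.Icc 0 t ∧ ∃ i j, Collide ε γ s i j}

/-- `γ`, restricted to `[0, t]`, is the hard-sphere trajectory with initial configuration `Z`.
There are finitely many collisions, each an isolated, non-grazing collision of one pair; the
motion is free between them; velocities are taken right-continuous in time (at a collision
time `γ` is the outgoing configuration). The initial and the final configuration lie in the
open phase space. The restriction of such a `γ` to `[0, t]` is determined by `Z`. -/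
structure IsTrajectory {N : ℕ} (ε t : ℝ) (Z : Config N) (γ : ℝ → Config N) : Prop where
  initial : γ 0 = Z
  apart : ∀ s ∈ Set.Icc 0 t, ∀ i j, i ≠ j → ε ≤ torusDist (γ s i).1 (γ s j).1
  finite : (collisionTimes ε t γ).Finite
  interior : collisionTimes ε t γ ⊆ Set.Ioo 0 t
  free : ∀ a b, 0 ≤ a → a ≤ b → b ≤ t →
    (∀ s ∈ Set.Ioc a b, s ∉ collisionTimes ε t γ) → γ b = freeFlow (b - a) (γ a)
  collision : ∀ a b, 0 ≤ a → a < b → b ∈ collisionTimes ε t γ →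
    (∀ s ∈ Set.Ioo a b, s ∉ collisionTimes ε t γ) →
      IsElasticCollision ε (freeFlow (b - a) (γ a)) (γ b)

/-- The backward cluster of particle `p` at time `t` along `γ` is the ordered set
`c 1, …, c k` (with `c 0 = p`), created at the times `t = τ 0 > τ 1 > ⋯ > τ k > 0`.
Going back in time from `τ r`, the time `τ (r + 1)` is that of the first collision of one of
the particles `c 0, …, c r` with a new particle, and this new particle is `c (r + 1)`;
between `τ k` and time `0` there is no further collision with a new particle. -/
structure IsBackwardCluster {N : ℕ} (ε t : ℝ) (γ : ℝ → Config N) (p : Fin N) (k : ℕ)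
    (c : Fin (k + 1) → Fin N) (τ : Fin (k + 1) → ℝ) : Prop where
  root : c 0 = p
  start : τ 0 = t
  distinct : Function.Injective c
  decreasing : StrictAnti τ
  pos : ∀ r : Fin k, 0 < τ r.succ
  creation : ∀ r : Fin k, ∃ q, q ≤ r.castSucc ∧ Collide ε γ (τ r.succ) (c q) (c r.succ)
  first : ∀ r : Fin k, ∀ s ∈ Set.Ioo (τ r.succ) (τ r.castSucc), ∀ q, q ≤ r.castSucc →
    ∀ j, Collide ε γ s (c q) j → ∃ q', q' ≤ r.castSucc ∧ j = c q'
  last : ∀ s ∈ Set.Ioo 0 (τ (Fin.last k)), ∀ q, ∀ j, Collide ε γ s (c q) j → ∃ q', j = c q'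

/-- The event `|BC(1)| = k`: the set of the initial configurations whose trajectory up to time
`t` exists and is such that the backward cluster of the first particle (index `0`) has
cardinality `k`. -/
def clusterEvent (N : ℕ) [NeZero N] (ε t : ℝ) (k : ℕ) : Set (Config N) :=
  {Z | ∃ γ, IsTrajectory ε t Z γ ∧ ∃ c τ, IsBackwardCluster ε t γ 0 k c τ}

/-- The measure with density `∏ exp (-β vᵢ² / 2)` on the phase space. -/
def gibbsWeight (N : ℕ) (ε β : ℝ) : MeasureTheory.Measure (Config N) :=
  (MeasureTheory.volume.restrict (phaseSpace N ε)).withDensity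
    (fun Z => ENNReal.ofReal (∏ i, Real.exp (-(β / 2) * ‖(Z i).2‖ ^ 2)))

/-- The canonical Gibbs measure at inverse temperature `β`. -/
def gibbs (N : ℕ) (ε β : ℝ) : MeasureTheory.Measure (Config N) :=
  (gibbsWeight N ε β Set.univ)⁻¹ • gibbsWeight N ε β

/-- The average cardinality of the backward cluster of the first particle at time `t`. -/
def averageClusterSize (N : ℕ) [NeZero N] (ε β t : ℝ) : ℝ≥0∞ :=
  ∑ k ∈ Finset.range N, (k : ℝ≥0∞) * gibbs N ε β (clusterEvent N ε t k)

end HardSpheres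

end

/-! The cluster is followed backward in small time steps δ, and to each group I of particles is
attached the event, read off the configuration at the current time, that the group reached so far is
I. In one step either the group evolves by itself or exactly one particle joins it. In the first
case the Gaussian measure of the event does not increase: the motion of an isolated group,
recollisions included, preserves volume and energy (`reduced_stay_le`). In the second case the new
particle must end the step in a tube of volume O(ε²δ|w|) attached to some member q, w being the
relative velocity. Summing over q produces ∑(1+|v_q|); giving up a fraction β/(4K) of the inverse
temperature turns this into O(K), where K bounds the group size (`sum_reduced_join_le`). Summing
over the new particle produces N, which cancels ε². So the total measure of the groups of n+1
particles gains at most GδK times that of the groups of n particles (`total_evolve_le`), and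
Pascal's rule gives binom(J,i)(GδK)^i after J steps and i creations (`total_iterate_le`).

The other particles are put back by two facts. The Gibbs measure does not charge the past of an
event more than the event, and its marginal on n particles is at most g⁻ⁿ times the Gaussian weight,
g being the Gaussian integral, since the torus always has room for one more sphere
(`gibbs_pastEvent_le`). As δ tends to 0, growth from m+1 to L+1 particles in one of n equal windows
of [0,t] has probability at most C^(L+1) t^m (t/n)^(L-m): the factor (L+1)^L coming from K = L+1 is
compensated by m!(L-m)! up to an exponential (`exists_gibbs_growthEvent_le`). No almost everywhere
existence of the dynamics is needed, because the events only contain configurations having a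
trajectory. The admissible δ depends on the trajectory, which is handled by a lower limit of sets
(`measure_le_of_eventually`).

With a single window the bound (Ct)^k is useless for large t. With n windows, a final size above ρⁿ
forces some window to multiply the size by at least ρ = k^(1/n). There L+1 ≥ ρ(m+1), so that all but
a small proportion of the creations happen in a window of length t/n. For n of order CT e³ the
factors t/n win over the loss n^m, and summing over m, L and the windows leaves exp(-ρ/2)
(`growth_bound`). This stretched exponential is summable against k, uniformly for t ≤ T, which
bounds the mean. -/

noncomputable section

namespace HardSpheres

open MeasureTheory

/-! ### Reflection by a ball as a symplectic map -/

section OneBody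

/-- A linear map preserving a nondegenerate bilinear form has determinant `±1`. -/
lemma abs_det_eq_one_of_comp_eq {V : Type*} [AddCommGroup V] [Module ℝ V] [FiniteDimensional ℝ V]
    (B : LinearMap.BilinForm ℝ V) (hB : B.Nondegenerate) (D : V →ₗ[ℝ] V)
    (h : ∀ x y, B (D x) (D y) = B x y) : |LinearMap.det D| = 1 := by
  classical
  let b := Module.finBasis ℝ V
  have h1 : B.comp D D = B := by
    ext x y
    exact h x y
  have h2 := LinearMap.BilinForm.toMatrix_comp b b B D D
  rw [h1] at h2
  have h3 := congrArg Matrix.det h2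
  rw [Matrix.det_mul, Matrix.det_mul, Matrix.det_transpose, LinearMap.det_toMatrix] at h3
  have h4 := (LinearMap.BilinForm.nondegenerate_iff_det_ne_zero b).1 hB
  have h5 : (LinearMap.det D) ^ 2 = 1 := by
    apply mul_right_cancel₀ h4
    linear_combination -h3
  rw [← sq_eq_sq₀ (abs_nonneg _) zero_le_one, sq_abs, h5, one_pow]

/-- The canonical symplectic form on the phase space of one particle. -/
def symplecticForm : LinearMap.BilinForm ℝ (E3 × E3) :=
  LinearMap.mk₂ ℝ (fun a b => inner ℝ a.1 b.2 - inner ℝ b.1 a.2)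
    (fun a b c => by simp [inner_add_left, inner_add_right]; ring)
    (fun r a b => by simp [inner_smul_left, inner_smul_right]; ring)
    (fun a b c => by simp [inner_add_left, inner_add_right]; ring)
    (fun r a b => by simp [inner_smul_left, inner_smul_right]; ring)

lemma symplecticForm_apply (a b : E3 × E3) :
    symplecticForm a b = inner ℝ a.1 b.2 - inner ℝ b.1 a.2 := rfl

lemma symplecticForm_nondegenerate : symplecticForm.Nondegenerate := by
  constructor
  · intro a ha
    have h1 := ha (0, a.1)
    have h2 := ha (a.2, 0)
    simp [symplecticForm_apply] at h1 h2
    exact Prod.ext h1 h2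
  · intro a ha
    have h1 := ha (0, a.1)
    have h2 := ha (a.2, 0)
    simp [symplecticForm_apply] at h1 h2
    exact Prod.ext h1 h2

/-- The (reduced) discriminant of the equation `‖u + s w‖ = ε` for `s`. -/
def discr (ε : ℝ) (u w : E3) : ℝ := inner ℝ u w ^ 2 - ‖w‖ ^ 2 * (‖u‖ ^ 2 - ε ^ 2)

/-- The time at which the straight motion `u + s w` enters the ball of radius `ε`. -/
def entryTime (ε : ℝ) (u w : E3) : ℝ := (-inner ℝ u w - √(discr ε u w)) / ‖w‖ ^ 2

/-- The point at which the straight motion `u + s w` enters the ball of radius `ε`. -/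
def entryPoint (ε : ℝ) (u w : E3) : E3 := u + entryTime ε u w • w

/-- Half of the jump of the relative velocity `-w` in the specular reflection. -/
def impulse (ε : ℝ) (u w : E3) : E3 :=
  (inner ℝ (entryPoint ε u w) w / ε ^ 2) • entryPoint ε u w

/-- Specular reflection by the ball of radius `ε`; the outgoing straight motion is described by
its (virtual) position at the time at which `u` is the position of the incoming one. -/
def scatter (ε : ℝ) (z : E3 × E3) : E3 × E3 :=
  (z.1 + (2 * entryTime ε z.1 z.2) • impulse ε z.1 z.2, z.2 - (2 : ℝ) • impulse ε z.1 z.2)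

variable {ε : ℝ} {u w : E3}

lemma discr_neg_right : discr ε u (-w) = discr ε u w := by simp [discr]

/-- The discriminant is a function of the straight line alone: it is ε²‖w‖² minus the squared norm
of the wedge of u and w. -/
lemma discr_add_smul (s : ℝ) : discr ε (u + s • w) w = discr ε u w := by
  have h : ‖u + s • w‖ ^ 2 = ‖u‖ ^ 2 + 2 * s * inner ℝ u w + s ^ 2 * ‖w‖ ^ 2 := by
    rw [norm_add_sq_real, inner_smul_right, norm_smul, mul_pow, Real.norm_eq_abs, sq_abs]; ring
  simp only [discr, h, inner_add_left, real_inner_smul_left, real_inner_self_eq_norm_sq]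
  ring

lemma ne_zero_of_discr_pos (h : 0 < discr ε u w) : w ≠ 0 := by
  rintro rfl
  simp [discr] at h

lemma norm_sq_pos_of_discr_pos (h : 0 < discr ε u w) : 0 < ‖w‖ ^ 2 := by
  have := norm_pos_iff.2 (ne_zero_of_discr_pos h)
  positivity

lemma inner_entryPoint (h : 0 < discr ε u w) :
    inner ℝ (entryPoint ε u w) w = -√(discr ε u w) := by
  have hw := (norm_sq_pos_of_discr_pos h).ne'
  simp only [entryPoint, entryTime, inner_add_left, real_inner_smul_left,
    real_inner_self_eq_norm_sq]
  rw [div_mul_cancel₀ _ hw]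
  ring

lemma norm_sq_entryPoint (h : 0 < discr ε u w) : ‖entryPoint ε u w‖ ^ 2 = ε ^ 2 := by
  have hw := norm_sq_pos_of_discr_pos h
  have h1 : discr ε (entryPoint ε u w) w = discr ε u w := discr_add_smul _
  have h2 : discr ε (entryPoint ε u w) w =
    inner ℝ (entryPoint ε u w) w ^ 2 - ‖w‖ ^ 2 * (‖entryPoint ε u w‖ ^ 2 - ε ^ 2) := rfl
  rw [inner_entryPoint h, h1, neg_sq, Real.sq_sqrt h.le] at h2
  have h3 : ‖w‖ ^ 2 * (‖entryPoint ε u w‖ ^ 2 - ε ^ 2) = 0 := by linarith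
  rcases mul_eq_zero.1 h3 with h4 | h4
  · exact absurd h4 hw.ne'
  · linarith

lemma discr_of_norm_eq (hu : ‖u‖ = ε) : discr ε u w = inner ℝ u w ^ 2 := by
  simp [discr, hu]

/-- The entry time of a motion given through its entry point. -/
lemma entryTime_sub_smul (hu : ‖u‖ = ε) (hn : inner ℝ u w < 0) (s : ℝ) :
    entryTime ε (u - s • w) w = s := by
  have h1 : discr ε (u - s • w) w = inner ℝ u w ^ 2 := by
    rw [sub_eq_add_neg, ← neg_smul, discr_add_smul, discr_of_norm_eq hu]
  have hw : w ≠ 0 := by rintro rfl; simp at hn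
  have hw2 : ‖w‖ ^ 2 ≠ 0 := by simpa using hw
  rw [entryTime, h1, Real.sqrt_sq_eq_abs, abs_of_neg hn, inner_sub_left, real_inner_smul_left,
    real_inner_self_eq_norm_sq]
  field_simp
  ring

lemma entryTime_add_smul (h : 0 < discr ε u w) (s : ℝ) :
    entryTime ε (u + s • w) w = entryTime ε u w - s := by
  have hw := (norm_sq_pos_of_discr_pos h).ne'
  rw [entryTime, entryTime, discr_add_smul, inner_add_left, real_inner_smul_left,
    real_inner_self_eq_norm_sq, div_eq_iff hw, sub_mul, div_mul_cancel₀ _ hw]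
  ring

/-- The tangent map of the reflection preserves the symplectic form. -/
lemma symplectic_identity {c p s q q' r r' ds ds' : ℝ} {y w dy dy' η η' : E3}
    (hp : p = inner ℝ y w) (hc : c * ‖y‖ ^ 2 = 2)
    (hq : q = inner ℝ dy w) (hr : r = inner ℝ y η) (hq' : q' = inner ℝ dy' w)
    (hr' : r' = inner ℝ y η') (hy : inner ℝ y dy = 0) (hy' : inner ℝ y dy' = 0) :
    (inner ℝ (dy - ds • (w - (c * p) • y) - s • (η - (c * (q + r)) • y - (c * p) • dy))
        (η' - (c * (q' + r')) • y - (c * p) • dy') : ℝ) -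
      inner ℝ (dy' - ds' • (w - (c * p) • y) - s • (η' - (c * (q' + r')) • y - (c * p) • dy'))
        (η - (c * (q + r)) • y - (c * p) • dy) =
    inner ℝ (dy - ds • w - s • η) η' - inner ℝ (dy' - ds' • w - s • η') η := by
  have e1 : (inner ℝ dy y : ℝ) = 0 := by rw [real_inner_comm]; exact hy
  have e2 : (inner ℝ dy' y : ℝ) = 0 := by rw [real_inner_comm]; exact hy'
  have e3 : (inner ℝ w y : ℝ) = p := by rw [real_inner_comm, hp]
  have e4 : (inner ℝ w dy : ℝ) = q := by rw [real_inner_comm, hq]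
  have e5 : (inner ℝ w dy' : ℝ) = q' := by rw [real_inner_comm, hq']
  have e6 : (inner ℝ η y : ℝ) = r := by rw [real_inner_comm, hr]
  have e7 : (inner ℝ η' y : ℝ) = r' := by rw [real_inner_comm, hr']
  have e8 : (inner ℝ dy' dy : ℝ) = inner ℝ dy dy' := real_inner_comm _ _
  have e9 : (inner ℝ η dy : ℝ) = inner ℝ dy η := real_inner_comm _ _
  have e10 : (inner ℝ η dy' : ℝ) = inner ℝ dy' η := real_inner_comm _ _
  have e11 : (inner ℝ η' dy : ℝ) = inner ℝ dy η' := real_inner_comm _ _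
  have e12 : (inner ℝ η' dy' : ℝ) = inner ℝ dy' η' := real_inner_comm _ _
  have e13 : (inner ℝ η' η : ℝ) = inner ℝ η η' := real_inner_comm _ _
  simp only [inner_sub_left, inner_sub_right, real_inner_smul_left, real_inner_smul_right,
    ← hr, ← hr', hy, hy', e1, e2, e3, e4, e5, e6, e7, e8, e10, e11, e13, real_inner_self_eq_norm_sq]
  linear_combination (-ds * p * c * (q' + r') + ds' * p * c * (q + r)) * hc

lemma continuous_discr (ε : ℝ) : Continuous fun z : E3 × E3 => discr ε z.1 z.2 := by
  unfold discr; fun_prop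

lemma measurable_entryTime (ε : ℝ) : Measurable fun z : E3 × E3 => entryTime ε z.1 z.2 := by
  unfold entryTime
  have := (continuous_discr ε).measurable
  fun_prop

lemma measurable_entryPoint (ε : ℝ) : Measurable fun z : E3 × E3 => entryPoint ε z.1 z.2 := by
  unfold entryPoint
  have := measurable_entryTime ε
  fun_prop

lemma measurable_impulse (ε : ℝ) : Measurable fun z : E3 × E3 => impulse ε z.1 z.2 := by
  unfold impulse
  have := measurable_entryPoint ε
  fun_prop

/-- Positivity of the discriminant excludes grazing, where the square root is singular, and also w =
0. -/
lemma differentiableAt_entryTime {z : E3 × E3} (h : 0 < discr ε z.1 z.2) :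
    DifferentiableAt ℝ (fun z : E3 × E3 => entryTime ε z.1 z.2) z := by
  have hw := (norm_sq_pos_of_discr_pos h).ne'
  have h1 : DifferentiableAt ℝ (fun z : E3 × E3 => inner ℝ z.1 z.2) z :=
    DifferentiableAt.inner ℝ differentiableAt_fst differentiableAt_snd
  have h2 : DifferentiableAt ℝ (fun z : E3 × E3 => ‖z.2‖ ^ 2) z :=
    differentiableAt_snd.norm_sq ℝ
  have h3 : DifferentiableAt ℝ (fun z : E3 × E3 => ‖z.1‖ ^ 2) z :=
    differentiableAt_fst.norm_sq ℝ
  have h4 : DifferentiableAt ℝ (fun z : E3 × E3 => discr ε z.1 z.2) z := by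
    unfold discr
    exact (h1.pow 2).sub (h2.mul (h3.sub_const _))
  have h5 := (h1.neg.sub (h4.sqrt h.ne')).mul (h2.inv hw)
  simp only [entryTime, div_eq_mul_inv]
  exact h5

/-- Incoming and outgoing lines pass through the same entry point at the entry time; this form is
the one that is differentiated and inverted. -/
lemma scatter_eq (ε : ℝ) (z : E3 × E3) : scatter ε z =
    (entryPoint ε z.1 z.2 - entryTime ε z.1 z.2 • (z.2 - (2 : ℝ) • impulse ε z.1 z.2),
      z.2 - (2 : ℝ) • impulse ε z.1 z.2) := by
  refine Prod.ext ?_ rfl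
  simp only [scatter, entryPoint]
  module

/-- Specular reflection is a canonical transformation, so its tangent map preserves the symplectic
form and has determinant ±1. This avoids computing a 6×6 Jacobian. -/
lemma scatter_hasFDerivAt (hε : 0 < ε) {z : E3 × E3} (h : 0 < discr ε z.1 z.2) :
    ∃ D : E3 × E3 →L[ℝ] E3 × E3, HasFDerivAt (scatter ε) D z ∧ |D.det| = 1 := by
  set y := entryPoint ε z.1 z.2 with hy
  obtain ⟨dS, hS⟩ := differentiableAt_entryTime h
  set s := entryTime ε z.1 z.2 with hs
  have hY : HasFDerivAt (fun z : E3 × E3 => entryPoint ε z.1 z.2)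
      (ContinuousLinearMap.fst ℝ E3 E3 +
        (s • ContinuousLinearMap.snd ℝ E3 E3 + dS.smulRight z.2)) z :=
    hasFDerivAt_fst.add (hS.smul hasFDerivAt_snd)
  set dY := (ContinuousLinearMap.fst ℝ E3 E3 +
        (s • ContinuousLinearMap.snd ℝ E3 E3 + dS.smulRight z.2)) with hdY
  have hP := hY.inner ℝ (hasFDerivAt_snd (𝕜 := ℝ) (p := z))
  have hI := (hP.mul_const (ε ^ 2)⁻¹).smul hY
  have hW := hasFDerivAt_snd (𝕜 := ℝ) (p := z) |>.sub (hI.const_smul (2 : ℝ))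
  have hX := hY.sub (hS.smul hW)
  have hT := hX.prodMk hW
  -- The entry point stays on the sphere of radius ε near z, so its derivative is tangent to that
  -- sphere.
  have horth : ∀ a, inner ℝ y (dY a) = 0 := by
    intro a
    have h1 := hY.norm_sq
    have h2 : HasFDerivAt (fun z : E3 × E3 => ‖entryPoint ε z.1 z.2‖ ^ 2)
        (0 : E3 × E3 →L[ℝ] ℝ) z := by
      refine (hasFDerivAt_const (ε ^ 2) z).congr_of_eventuallyEq ?_
      have : ∀ᶠ x in nhds z, 0 < discr ε x.1 x.2 :=
        (continuous_discr ε).continuousAt.eventually (lt_mem_nhds h)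
      filter_upwards [this] with x hx using norm_sq_entryPoint hx
    have h3 := congrArg (fun L => L a) (h1.unique h2)
    simp at h3
    exact h3
  refine ⟨_, hT.congr_of_eventuallyEq ?_, ?_⟩
  · refine Filter.Eventually.of_forall fun x => ?_
    rw [scatter_eq]
    simp [impulse, div_eq_mul_inv]
  · refine abs_det_eq_one_of_comp_eq symplecticForm symplecticForm_nondegenerate _ ?_
    intro a b
    have hny : ‖y‖ ^ 2 = ε ^ 2 := norm_sq_entryPoint h
    -- The constant c is 2/ε², so that c‖y‖² = 2 and w - (c p) y is the reflection of w.
    have key := symplectic_identity (c := 2 * (ε ^ 2)⁻¹) (p := inner ℝ y z.2) (s := s)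
      (q := inner ℝ (dY a) z.2) (q' := inner ℝ (dY b) z.2) (r := inner ℝ y a.2)
      (r' := inner ℝ y b.2) (ds := dS a) (ds' := dS b) (y := y) (w := z.2) (dy := dY a)
      (dy' := dY b) (η := a.2) (η' := b.2) rfl (by rw [hny]; field_simp) rfl rfl rfl rfl
      (horth a) (horth b)
    simp only [symplecticForm_apply]
    refine (Eq.trans (Eq.trans ?_ key) ?_)
    · congr 2 <;> simp <;> module
    · congr 2 <;> simp [hdY] <;> module

lemma inner_impulse (hε : 0 < ε) (h : 0 < discr ε u w) :
    inner ℝ (entryPoint ε u w) (impulse ε u w) = inner ℝ (entryPoint ε u w) w := by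
  rw [impulse, real_inner_smul_right, real_inner_self_eq_norm_sq, norm_sq_entryPoint h]
  field_simp

/-- Time reversal: the reversed outgoing motion meets the sphere at the same point, at the opposite
time. -/
lemma entryTime_scatter (hε : 0 < ε) {z : E3 × E3} (h : 0 < discr ε z.1 z.2) :
    entryTime ε (scatter ε z).1 (-(scatter ε z).2) = -entryTime ε z.1 z.2 := by
  have h1 : (scatter ε z).1 = entryPoint ε z.1 z.2 -
      (-entryTime ε z.1 z.2) • (-(scatter ε z).2) := by
    rw [scatter_eq]; simp only; module
  rw [h1]
  apply entryTime_sub_smul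
  · rw [← sq_eq_sq₀ (norm_nonneg _) hε.le, norm_sq_entryPoint h]
  · have h2 : (scatter ε z).2 = z.2 - (2 : ℝ) • impulse ε z.1 z.2 := rfl
    rw [h2, inner_neg_right, inner_sub_right, real_inner_smul_right, inner_impulse hε h,
      inner_entryPoint h]
    have := Real.sqrt_pos.2 h
    linarith

/-- The reversed outgoing motion gives back the entry point, and from it the impulse and the entry
time, hence the incoming data. -/
lemma scatter_injOn (hε : 0 < ε) : Set.InjOn (scatter ε) {z | 0 < discr ε z.1 z.2} := by
  have key : ∀ z : E3 × E3, 0 < discr ε z.1 z.2 →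
      entryPoint ε z.1 z.2 = entryPoint ε (scatter ε z).1 (-(scatter ε z).2) ∧
      impulse ε z.1 z.2 = (-(inner ℝ (entryPoint ε z.1 z.2) (scatter ε z).2) / ε ^ 2) •
        entryPoint ε z.1 z.2 := by
    intro z h
    constructor
    · conv_rhs => rw [entryPoint, entryTime_scatter hε h, scatter_eq]
      simp only
      module
    · have h2 : (scatter ε z).2 = z.2 - (2 : ℝ) • impulse ε z.1 z.2 := rfl
      rw [h2, inner_sub_right, real_inner_smul_right, inner_impulse hε h]
      conv_lhs => rw [impulse]
      congr 2
      ring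
  intro a ha b hb hab
  obtain ⟨a1, a2⟩ := key a ha
  obtain ⟨b1, b2⟩ := key b hb
  have h1 : entryPoint ε a.1 a.2 = entryPoint ε b.1 b.2 := by rw [a1, b1, hab]
  have h2 : impulse ε a.1 a.2 = impulse ε b.1 b.2 := by rw [a2, b2, hab, h1]
  have h3 : entryTime ε a.1 a.2 = entryTime ε b.1 b.2 := by
    have ea := entryTime_scatter hε ha
    have eb := entryTime_scatter hε hb
    rw [hab, eb] at ea
    linarith
  have e1 := congrArg Prod.fst hab
  have e2 := congrArg Prod.snd hab
  simp only [scatter, h2, h3] at e1 e2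
  exact Prod.ext (add_right_cancel e1) (sub_left_injective e2)

/-- The relative positions and velocities for which a collision happens during `(0, δ]`, the
relative displacement being at most `ε`. -/
def hitRegion (ε δ : ℝ) : Set (E3 × E3) :=
  {z | 0 < discr ε z.1 z.2 ∧ 0 < entryTime ε z.1 z.2 ∧ entryTime ε z.1 z.2 ≤ δ ∧ δ * ‖z.2‖ ≤ ε}

lemma measurableSet_hitRegion (ε δ : ℝ) : MeasurableSet (hitRegion ε δ) := by
  have h1 := (continuous_discr ε).measurable
  have h2 := measurable_entryTime ε
  exact ((measurableSet_lt measurable_const h1).inter ((measurableSet_lt measurable_const h2).inter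
    ((measurableSet_le h2 measurable_const).inter
      (measurableSet_le (measurable_const.mul measurable_snd.norm) measurable_const))))

lemma lintegral_scatter (hε : 0 < ε) {H : Set (E3 × E3)} (hH : MeasurableSet H)
    (hpos : ∀ z ∈ H, 0 < discr ε z.1 z.2) (f : E3 × E3 → ℝ≥0∞) :
    ∫⁻ z in H, f (scatter ε z) = ∫⁻ z in scatter ε '' H, f z := by
  have hex : ∀ z : E3 × E3, ∃ D : E3 × E3 →L[ℝ] E3 × E3, 0 < discr ε z.1 z.2 →
      HasFDerivAt (scatter ε) D z ∧ |D.det| = 1 := by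
    intro z
    by_cases hz : 0 < discr ε z.1 z.2
    · obtain ⟨D, hD⟩ := scatter_hasFDerivAt hε hz
      exact ⟨D, fun _ => hD⟩
    · exact ⟨0, fun h => absurd h hz⟩
  choose D hD using hex
  have hinj : Set.InjOn (scatter ε) H := (scatter_injOn hε).mono fun z hz => hpos z hz
  have hd : ∀ z ∈ H, HasFDerivWithinAt (scatter ε) (D z) H z :=
    fun z hz => (hD z (hpos z hz)).1.hasFDerivWithinAt
  have : (volume : Measure (E3 × E3)).IsAddHaarMeasure :=
    Measure.prod.instIsAddHaarMeasure volume volume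
  have key := lintegral_image_eq_lintegral_abs_det_fderiv_mul volume hH hd hinj f
  rw [key]
  refine setLIntegral_congr_fun hH fun z hz => ?_
  simp [(hD z (hpos z hz)).2]
lemma inner_impulse_right (hε : 0 < ε) (h : 0 < discr ε u w) :
    inner ℝ w (impulse ε u w) = ‖impulse ε u w‖ ^ 2 := by
  rw [← real_inner_self_eq_norm_sq]
  conv_lhs => rw [impulse]
  conv_rhs => rw [impulse, real_inner_smul_left, real_inner_smul_right,
    real_inner_self_eq_norm_sq, norm_sq_entryPoint h]
  rw [real_inner_smul_right, real_inner_comm]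
  field_simp

lemma norm_scatter_snd (hε : 0 < ε) (h : 0 < discr ε u w) : ‖(scatter ε (u, w)).2‖ = ‖w‖ := by
  rw [← sq_eq_sq₀ (norm_nonneg _) (norm_nonneg _)]
  simp only [scatter, norm_sub_sq_real, real_inner_smul_right, inner_impulse_right hε h, norm_smul]
  norm_num
  ring

/-- Distance ε to the entry point plus a displacement of at most ε. The bound keeps the image inside
the fundamental cube. -/
lemma norm_scatter_fst_le (hε : 0 < ε) {δ : ℝ} {z : E3 × E3} (hz : z ∈ hitRegion ε δ) :
    ‖(scatter ε z).1‖ ≤ 2 * ε := by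
  obtain ⟨h1, h2, h3, h4⟩ := hz
  have e1 : (scatter ε z).1 = entryPoint ε z.1 z.2 - entryTime ε z.1 z.2 • (scatter ε z).2 := by
    rw [scatter_eq]
  have e2 : ‖entryPoint ε z.1 z.2‖ = ε := by
    rw [← sq_eq_sq₀ (norm_nonneg _) hε.le, norm_sq_entryPoint h1]
  have e3 : ‖(scatter ε z).2‖ = ‖z.2‖ := norm_scatter_snd hε h1
  have e4 : ‖entryTime ε z.1 z.2 • (scatter ε z).2‖ ≤ ε := by
    rw [norm_smul, e3, Real.norm_of_nonneg h2.le]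
    exact (mul_le_mul_of_nonneg_right h3 (norm_nonneg _)).trans h4
  rw [e1]
  refine (norm_sub_le _ _).trans ?_
  linarith

end OneBody

/-! ### Transfer to the torus through a fundamental cube -/

section TorusLift

lemma proj_add (u v : E3) : proj (u + v) = proj u + proj v := by
  ext a; simp [proj]

lemma proj_zero : proj 0 = 0 := by
  ext a; simp [proj]

lemma proj_neg (u : E3) : proj (-u) = -proj u := by
  ext a; simp [proj]

lemma proj_sub (u v : E3) : proj (u - v) = proj u - proj v := by
  ext a; simp [proj]

lemma continuous_proj : Continuous proj := by
  refine continuous_pi fun a => ?_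
  exact (AddCircle.continuous_mk' _).comp (by fun_prop)

/-- The representative of a point of the torus in the cube `(-π, π]³`. -/
def lift (x : Torus3) : E3 :=
  WithLp.toLp 2 fun a => (AddCircle.equivIoc (2 * Real.pi) (-Real.pi) (x a) : ℝ)

/-- The fundamental cube of the torus. -/
def cube : Set E3 := {u | ∀ a, u a ∈ Set.Ioc (-Real.pi) (-Real.pi + 2 * Real.pi)}

lemma lift_proj {u : E3} (hu : u ∈ cube) : lift (proj u) = u := by
  ext a
  exact AddCircle.equivIoc_coe_of_mem (hu a)

lemma mem_cube_of_norm_lt {u : E3} (hu : ‖u‖ < Real.pi) : u ∈ cube := by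
  intro a
  have h1 : |u a| ≤ ‖u‖ := by simpa using PiLp.norm_apply_le u a
  have h2 := abs_lt.1 (h1.trans_lt hu)
  constructor <;> linarith [h2.1, h2.2]

lemma measurable_lift : Measurable lift := by
  refine (WithLp.measurable_toLp 2 _).comp (measurable_pi_lambda _ fun a => ?_)
  exact (measurable_subtype_coe.comp
    (AddCircle.measurableEquivIoc (2 * Real.pi) (-Real.pi)).measurable).comp (measurable_pi_apply a)

lemma measurableSet_cube : MeasurableSet cube := by
  have : cube = ⋂ a, (fun u : E3 => u a) ⁻¹' Set.Ioc (-Real.pi) (-Real.pi + 2 * Real.pi) := by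
    ext u; simp [cube]
  rw [this]
  refine MeasurableSet.iInter fun a => ?_
  exact (by fun_prop : Measurable fun u : E3 => u a) measurableSet_Ioc

lemma measurePreserving_proj : MeasurePreserving proj (volume.restrict cube) volume := by
  have h1 : MeasurePreserving (fun (u : Fin 3 → ℝ) a => ((u a : ℝ) : AddCircle (2 * Real.pi)))
      (Measure.pi fun _ => volume.restrict (Set.Ioc (-Real.pi) (-Real.pi + 2 * Real.pi)))
      (Measure.pi fun _ => volume) :=
    measurePreserving_pi _ _ fun _ => AddCircle.measurePreserving_mk (2 * Real.pi) (-Real.pi)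
  rw [← Measure.restrict_pi_pi] at h1
  have h2 := (PiLp.volume_preserving_ofLp (Fin 3)).restrict_preimage
    (s := Set.univ.pi fun _ => Set.Ioc (-Real.pi) (-Real.pi + 2 * Real.pi))
    (MeasurableSet.univ_pi fun _ => measurableSet_Ioc)
  have h3 : (WithLp.ofLp ⁻¹' (Set.univ.pi fun _ : Fin 3 =>
      Set.Ioc (-Real.pi) (-Real.pi + 2 * Real.pi)) : Set E3) = cube := by
    ext u; simp [cube, Set.mem_pi]
  rw [h3] at h2
  exact h1.comp h2

lemma measurePreserving_proj_prod : MeasurePreserving (Prod.map proj (id : E3 → E3))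
      (volume.restrict (cube ×ˢ Set.univ)) volume := by
  have h := measurePreserving_proj.prod (MeasurePreserving.id (volume : Measure E3))
  have h2 : (volume.restrict cube).prod (volume : Measure E3) =
      (volume : Measure (E3 × E3)).restrict (cube ×ˢ Set.univ) := by
    rw [Measure.volume_eq_prod, ← Measure.prod_restrict, Measure.restrict_univ]
  rw [← h2]
  exact h

/-- The jumps of the relative position and velocity in a collision of two particles, as functions
of the relative position and velocity on the torus. The (virtual) position jump refers to the
straight motions before and after the collision. -/
def relJump (ε : ℝ) (z : Torus3 × E3) : Torus3 × E3 :=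
  (proj (entryTime ε (lift z.1) z.2 • impulse ε (lift z.1) z.2), -impulse ε (lift z.1) z.2)

lemma measurable_lift_prod : Measurable fun z : Torus3 × E3 => (lift z.1, z.2) :=
  (measurable_lift.comp measurable_fst).prodMk measurable_snd

lemma measurable_impulse_lift (ε : ℝ) :
    Measurable ((fun z : E3 × E3 => impulse ε z.1 z.2) ∘
      fun z : Torus3 × E3 => (lift z.1, z.2)) :=
  (measurable_impulse ε).comp measurable_lift_prod

lemma measurable_entryTime_lift (ε : ℝ) :
    Measurable ((fun z : E3 × E3 => entryTime ε z.1 z.2) ∘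
      fun z : Torus3 × E3 => (lift z.1, z.2)) :=
  (measurable_entryTime ε).comp measurable_lift_prod

lemma measurable_relJump (ε : ℝ) : Measurable (relJump ε) := by
  have hI : Measurable fun z : Torus3 × E3 => impulse ε (lift z.1) z.2 :=
    measurable_impulse_lift ε
  have hT : Measurable fun z : Torus3 × E3 => entryTime ε (lift z.1) z.2 :=
    measurable_entryTime_lift ε
  exact (continuous_proj.measurable.comp (hT.smul hI)).prodMk hI.neg

/-- Relative positions on the torus and relative velocities leading to a collision in `(0, δ]`. -/
def hitRegionTorus (ε δ : ℝ) : Set (Torus3 × E3) := {z | (lift z.1, z.2) ∈ hitRegion ε δ}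

lemma measurableSet_hitRegionTorus (ε δ : ℝ) : MeasurableSet (hitRegionTorus ε δ) :=
  measurable_lift_prod (measurableSet_hitRegion ε δ)

lemma measurable_add_two_relJump (ε : ℝ) :
    Measurable fun z : Torus3 × E3 => z + (relJump ε z + relJump ε z) := by
  have h := measurable_relJump ε
  exact (measurable_fst.add (h.fst.add h.fst)).prodMk (measurable_snd.add (h.snd.add h.snd))

lemma proj_scatter {ε : ℝ} {z : E3 × E3} (hz : z.1 ∈ cube) :
    Prod.map proj id z + (relJump ε (Prod.map proj id z) + relJump ε (Prod.map proj id z)) =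
      Prod.map proj id (scatter ε z) := by
  obtain ⟨u, w⟩ := z
  have hl : lift (proj u) = u := lift_proj hz
  refine Prod.ext ?_ ?_
  · simp only [relJump, Prod.map_apply, id, hl, scatter, Prod.fst_add, ← proj_add]
    congr 1
    module
  · simp only [relJump, Prod.map_apply, id, hl, scatter, Prod.snd_add]
    module

/-- The reflection does not increase volume on the torus. -/
lemma lintegral_scatter_torus_le {ε δ : ℝ} (hε : 0 < ε) (hε1 : ε ≤ 1)
    (f : Torus3 × E3 → ℝ≥0∞) (hf : Measurable f) :
    ∫⁻ z in hitRegionTorus ε δ, f (z + (relJump ε z + relJump ε z)) ≤ ∫⁻ z, f z := by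
  have hP := measurePreserving_proj_prod
  have hcube : MeasurableSet (cube ×ˢ (Set.univ : Set E3)) :=
    measurableSet_cube.prod MeasurableSet.univ
  have hF : Measurable fun z => f (z + (relJump ε z + relJump ε z)) :=
    hf.comp (measurable_add_two_relJump ε)
  rw [← lintegral_indicator (measurableSet_hitRegionTorus ε δ),
    ← hP.lintegral_comp (hF.indicator (measurableSet_hitRegionTorus ε δ)), ← hP.lintegral_comp hf]
  calc _ ≤ ∫⁻ z in cube ×ˢ Set.univ, (hitRegion ε δ).indicator
        (fun z => f (Prod.map proj id (scatter ε z))) z := by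
        refine (setLIntegral_congr_fun hcube fun z hz => ?_).le
        have hl : lift (proj z.1) = z.1 := lift_proj hz.1
        have hiff : Prod.map proj id z ∈ hitRegionTorus ε δ ↔ z ∈ hitRegion ε δ := by
          rw [hitRegionTorus, Set.mem_ofPred_eq, Prod.map_fst, Prod.map_snd, hl]
          rfl
        by_cases hz' : z ∈ hitRegion ε δ
        · rw [Set.indicator_of_mem hz', Set.indicator_of_mem (hiff.2 hz'), proj_scatter hz.1]
        · rw [Set.indicator_of_notMem hz', Set.indicator_of_notMem (mt hiff.1 hz')]
    _ ≤ ∫⁻ z in hitRegion ε δ, f (Prod.map proj id (scatter ε z)) := by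
        rw [← lintegral_indicator (measurableSet_hitRegion ε δ)]
        exact setLIntegral_le_lintegral _ _
    _ = ∫⁻ z in scatter ε '' hitRegion ε δ, f (Prod.map proj id z) :=
        lintegral_scatter hε (measurableSet_hitRegion ε δ) (fun z hz => hz.1)
          (fun z => f (Prod.map proj id z))
    _ ≤ _ := by
        refine lintegral_mono_set ?_
        rintro _ ⟨z, hz, rfl⟩
        -- Scattered points have norm at most 2ε ≤ 2 < π, so nothing wraps around and the projection
        -- is injective on the image.
        refine ⟨mem_cube_of_norm_lt ?_, trivial⟩
        have := norm_scatter_fst_le hε hz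
        linarith [Real.pi_gt_three]

end TorusLift

/-! ### Volume under the collision of a pair and under free flight -/

section PairCollision

instance : (volume : Measure Torus3).IsAddLeftInvariant :=
  Measure.pi.isAddLeftInvariant _

instance : (volume : Measure Torus3).IsAddRightInvariant :=
  IsAddLeftInvariant.isAddRightInvariant

instance : (volume : Measure State).IsAddRightInvariant :=
  Measure.prod.instIsAddRightInvariant (μ := (volume : Measure Torus3)) (ν := (volume : Measure E3))

/-- The collision of a pair of particles, as a map of their (virtual) states before and after. -/
lemma lintegral_pair_collision_le {ε δ : ℝ} (hε : 0 < ε) (hε1 : ε ≤ 1)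
    (f : State → State → ℝ≥0∞) (hf : Measurable (Function.uncurry f)) :
    ∫⁻ b, ∫⁻ a, (hitRegionTorus ε δ).indicator
        (fun z => f (z + b + relJump ε z) (b - relJump ε z)) (a - b) ≤
      ∫⁻ b, ∫⁻ a, f a b := by
  have hJ := measurable_relJump ε
  have h1 : ∀ b : State, ∫⁻ a : State, (hitRegionTorus ε δ).indicator
        (fun z => f (z + b + relJump ε z) (b - relJump ε z)) (a - b) =
      ∫⁻ z : State, (hitRegionTorus ε δ).indicator
        (fun z => f (z + b + relJump ε z) (b - relJump ε z)) z := fun b =>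
    lintegral_sub_right_eq_self _ b
  have h2 : ∀ b : State, ∫⁻ a : State, f a b = ∫⁻ z : State, f (z + b) b := fun b =>
    (lintegral_add_right_eq_self (fun a => f a b) b).symm
  have hm1 : Measurable fun p : State × State => f (p.2 + p.1) p.1 :=
    hf.comp ((measurable_snd.add measurable_fst).prodMk measurable_fst)
  have hm2 : Measurable (Function.uncurry fun (b z : State) => (hitRegionTorus ε δ).indicator
        (fun z => f (z + b + relJump ε z) (b - relJump ε z)) z) := by
    have : (Function.uncurry fun (b z : State) => (hitRegionTorus ε δ).indicator
        (fun z => f (z + b + relJump ε z) (b - relJump ε z)) z) =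
        (Prod.snd ⁻¹' hitRegionTorus ε δ).indicator (fun p : State × State =>
          f (p.2 + p.1 + relJump ε p.2) (p.1 - relJump ε p.2)) := by
      ext p
      rfl
    rw [this]
    refine Measurable.indicator ?_ (measurable_snd (measurableSet_hitRegionTorus ε δ))
    exact hf.comp (((measurable_snd.add measurable_fst).add (hJ.comp measurable_snd)).prodMk
      (measurable_fst.sub (hJ.comp measurable_snd)))
  simp_rw [h1, h2]
  rw [lintegral_lintegral_swap hm2.aemeasurable,
    lintegral_lintegral_swap (f := fun b z : State => f (z + b) b) hm1.aemeasurable]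
  have h3 : ∀ z : State, ∫⁻ b : State, (hitRegionTorus ε δ).indicator
        (fun z => f (z + b + relJump ε z) (b - relJump ε z)) z =
      (hitRegionTorus ε δ).indicator
        (fun z => (fun y => ∫⁻ b : State, f (y + b) b) (z + (relJump ε z + relJump ε z))) z := by
    intro z
    by_cases hz : z ∈ hitRegionTorus ε δ
    · simp only [Set.indicator_of_mem hz]
      -- Translating b by the jump restores the second particle and puts the whole jump, twice
      -- `relJump`, on the relative state.
      rw [← lintegral_add_right_eq_self _ (relJump ε z)]
      refine lintegral_congr fun b => ?_
      rw [add_sub_cancel_right]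
      congr 1
      abel
    · simp only [Set.indicator_of_notMem hz, lintegral_zero]
  simp_rw [h3]
  rw [lintegral_indicator (measurableSet_hitRegionTorus ε δ)]
  refine lintegral_scatter_torus_le hε hε1 (fun y => ∫⁻ b : State, f (y + b) b) ?_
  exact Measurable.lintegral_prod_right'
    (f := fun p : State × State => f (p.1 + p.2) p.2)
    (hf.comp ((measurable_fst.add measurable_snd).prodMk measurable_snd))

variable {N : ℕ}

/-- The instantaneous (virtual) collision of the particles `p` and `q`: the straight motions
through the old and the new configuration meet at the time of the collision. -/
def collide (ε : ℝ) (p q : Fin N) (Y : Config N) : Config N :=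
  Function.update (Function.update Y p (Y p + relJump ε (Y p - Y q))) q
    (Y q - relJump ε (Y p - Y q))

/-- The configurations such that `p` and `q` would collide during `(0, δ]` if left alone. -/
def hitSet (ε δ : ℝ) (p q : Fin N) : Set (Config N) := {Y | Y p - Y q ∈ hitRegionTorus ε δ}

lemma measurable_apply_sub (p q : Fin N) : Measurable fun Y : Config N => Y p - Y q :=
  (measurable_pi_apply p).sub (measurable_pi_apply q)

lemma measurableSet_hitSet (ε δ : ℝ) (p q : Fin N) : MeasurableSet (hitSet ε δ p q) :=
  measurable_apply_sub p q (measurableSet_hitRegionTorus ε δ)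

lemma measurable_collide (ε : ℝ) (p q : Fin N) : Measurable (collide ε p q) := by
  have hJ : Measurable fun Y : Config N => relJump ε (Y p - Y q) :=
    (measurable_relJump ε).comp (measurable_apply_sub p q)
  refine measurable_pi_lambda _ fun i => ?_
  unfold collide
  by_cases hq : i = q
  · subst hq
    simp only [Function.update_self]
    exact (measurable_pi_apply i).sub hJ
  · simp only [Function.update_of_ne hq]
    by_cases hp : i = p
    · subst hp
      simp only [Function.update_self]
      exact (measurable_pi_apply i).add hJ
    · simp only [Function.update_of_ne hp]
      exact measurable_pi_apply i

/-- Only the coordinates p and q change, so it suffices to integrate over them and apply the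
two-particle estimate with the others frozen. -/
lemma lmarginal_collide_le {ε δ : ℝ} (hε : 0 < ε) (hε1 : ε ≤ 1) {p q : Fin N} (hpq : p ≠ q)
    {I : Finset (Fin N)} (hp : p ∈ I) (hq : q ∈ I) (f : Config N → ℝ≥0∞) (hf : Measurable f) :
    lmarginal (fun _ => volume) I ((hitSet ε δ p q).indicator (f ∘ collide ε p q)) ≤
      lmarginal (fun _ => volume) I f := by
  have hF : Measurable ((hitSet ε δ p q).indicator (f ∘ collide ε p q)) :=
    (hf.comp (measurable_collide ε p q)).indicator (measurableSet_hitSet ε δ p q)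
  refine lmarginal_le_of_subset (s := {q, p}) ?_ hF hf ?_
  · intro i hi
    rcases Finset.mem_insert.1 hi with rfl | hi
    · exact hq
    · rwa [Finset.mem_singleton.1 hi]
  · intro x
    have hnot : q ∉ ({p} : Finset (Fin N)) := by simpa using hpq.symm
    rw [lmarginal_insert _ hF hnot, lmarginal_insert _ hf hnot]
    simp only [lmarginal_singleton]
    have key := lintegral_pair_collision_le (δ := δ) hε hε1
      (fun a b => f (Function.update (Function.update x q b) p a)) (by
        refine hf.comp (measurable_pi_lambda _ fun i => ?_)
        by_cases hip : i = p
        · subst hip; simpa using measurable_fst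
        · simp only [Function.update_of_ne hip]
          by_cases hiq : i = q
          · subst hiq; simpa using measurable_snd
          · simp [Function.update_of_ne hiq])
    refine le_trans (le_of_eq ?_) key
    refine lintegral_congr fun b => lintegral_congr fun a => ?_
    set Y := Function.update (Function.update x q b) p a with hY
    have hYp : Y p = a := by simp [hY]
    have hYq : Y q = b := by simp [hY, hpq.symm]
    have hmem : Y ∈ hitSet ε δ p q ↔ a - b ∈ hitRegionTorus ε δ := by
      rw [hitSet, Set.mem_ofPred_eq, hYp, hYq]
    by_cases h : a - b ∈ hitRegionTorus ε δ
    · rw [Set.indicator_of_mem h, Set.indicator_of_mem (hmem.2 h)]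
      simp only [Function.comp, collide, hYp, hYq, sub_add_cancel]
      congr 1
      ext1 i
      by_cases hip : i = p
      · subst hip; simp [hpq]
      · by_cases hiq : i = q
        · subst hiq; simp [hpq.symm]
        · simp [hY, hip, hiq]
    · rw [Set.indicator_of_notMem h, Set.indicator_of_notMem (mt hmem.1 h)]

/-- Free motion of one particle. -/
def freeState (s : ℝ) (z : State) : State := (z.1 + proj (s • z.2), z.2)

lemma freeFlow_apply (s : ℝ) (Z : Config N) (i : Fin N) : freeFlow s Z i = freeState s (Z i) := rfl

lemma continuous_freeState (s : ℝ) : Continuous (freeState s) :=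
  (continuous_fst.add (continuous_proj.comp (continuous_snd.const_smul s))).prodMk continuous_snd

lemma continuous_freeFlow (s : ℝ) : Continuous (freeFlow (N := N) s) :=
  continuous_pi fun i => (continuous_freeState s).comp (continuous_apply i)

lemma measurable_freeState (s : ℝ) : Measurable (freeState s) :=
  (measurable_fst.add (continuous_proj.measurable.comp (measurable_snd.const_smul s))).prodMk
    measurable_snd

lemma measurable_freeFlow (s : ℝ) : Measurable (freeFlow (N := N) s) :=
  measurable_pi_lambda _ fun i => (measurable_freeState s).comp (measurable_pi_apply i)

lemma lintegral_freeState (s : ℝ) (f : State → ℝ≥0∞) (hf : Measurable f) :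
    ∫⁻ z, f (freeState s z) = ∫⁻ z, f z := by
  rw [Measure.volume_eq_prod, lintegral_prod_symm f hf.aemeasurable,
    lintegral_prod_symm (f := fun z => f (freeState s z))
      (hf.comp (measurable_freeState s)).aemeasurable]
  refine lintegral_congr fun v => ?_
  exact lintegral_add_right_eq_self (fun x => f (x, v)) (proj (s • v))

lemma freeFlow_update (s : ℝ) (x : Config N) (i : Fin N) (z : State) :
    freeFlow s (Function.update x i z) = Function.update (freeFlow s x) i (freeState s z) := by
  ext1 j
  by_cases h : j = i
  · subst h; simp [freeFlow_apply]
  · simp [freeFlow_apply, h]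

lemma lmarginal_freeFlow (s : ℝ) (I : Finset (Fin N)) (f : Config N → ℝ≥0∞) (hf : Measurable f)
    (x : Config N) : lmarginal (fun _ => volume) I (f ∘ freeFlow s) x =
      lmarginal (fun _ => volume) I f (freeFlow s x) := by
  induction I using Finset.induction_on generalizing x with
  | empty => simp
  | insert i I hi ih =>
    rw [lmarginal_insert _ (hf.comp (measurable_freeFlow s)) hi,
      lmarginal_insert _ hf hi]
    simp_rw [ih, freeFlow_update]
    refine lintegral_freeState s
      (fun z => lmarginal (fun _ => volume) I f (Function.update (freeFlow s x) i z)) ?_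
    exact hf.lmarginal _ |>.comp (measurable_update _)

lemma lmarginal_eq_of_dependsOn {I : Finset (Fin N)} {f : Config N → ℝ≥0∞}
    (hf : DependsOn f (I : Set (Fin N))) (x y : Config N) :
    lmarginal (fun _ => volume) I f x = lmarginal (fun _ => volume) I f y := by
  simp only [lmarginal]
  refine lintegral_congr fun z => hf fun i hi => ?_
  have hi' : i ∈ I := hi
  simp [Function.updateFinset, hi']

/-- Collision of `p` and `q` in a time interval of length `δ` in which the other particles
move freely. -/
def collisionFlow (ε δ : ℝ) (p q : Fin N) (Y : Config N) : Config N :=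
  freeFlow δ (collide ε p q Y)

lemma measurable_collisionFlow (ε δ : ℝ) (p q : Fin N) : Measurable (collisionFlow ε δ p q) :=
  (measurable_freeFlow δ).comp (measurable_collide ε p q)

/-- Liouville's theorem, as an inequality, for a step made of one collision and free flight. Since f
depends on I only, the base point moved by the free flow may be reset. -/
lemma lmarginal_collisionFlow_le {ε δ : ℝ} (hε : 0 < ε) (hε1 : ε ≤ 1) {p q : Fin N} (hpq : p ≠ q)
    {I : Finset (Fin N)} (hp : p ∈ I) (hq : q ∈ I) {f : Config N → ℝ≥0∞} (hf : Measurable f)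
    (hfI : DependsOn f (I : Set (Fin N))) (x : Config N) :
    lmarginal (fun _ => volume) I ((hitSet ε δ p q).indicator (f ∘ collisionFlow ε δ p q)) x ≤
      lmarginal (fun _ => volume) I f x := by
  refine (lmarginal_collide_le hε hε1 hpq hp hq (f ∘ freeFlow δ)
    (hf.comp (measurable_freeFlow δ)) x).trans ?_
  rw [lmarginal_freeFlow _ _ _ hf, lmarginal_eq_of_dependsOn hfI]

end PairCollision

/-! ### Volume of the collision tube -/

section Tube

/-- The relative positions, and velocities `w`, reached at the end of a time interval of length
`δ` in which a collision happens, the relative displacement being at most `ε`. -/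
def exitRegion (ε δ : ℝ) : Set (E3 × E3) :=
  {z | 0 < discr ε z.1 z.2 ∧ 0 ≤ entryTime ε z.1 (-z.2) ∧ entryTime ε z.1 (-z.2) < δ ∧
    δ * ‖z.2‖ ≤ ε}

lemma measurable_exitTime (ε : ℝ) : Measurable fun z : E3 × E3 => entryTime ε z.1 (-z.2) := by
  have h : Measurable ((fun z : E3 × E3 => entryTime ε z.1 z.2) ∘ fun z : E3 × E3 =>
      (z.1, -z.2)) := (measurable_entryTime ε).comp (measurable_fst.prodMk measurable_snd.neg)
  exact h

lemma measurableSet_exitRegion (ε δ : ℝ) : MeasurableSet (exitRegion ε δ) := by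
  have h1 := (continuous_discr ε).measurable
  have h2 := measurable_exitTime ε
  exact ((measurableSet_lt measurable_const h1).inter ((measurableSet_le measurable_const h2).inter
    ((measurableSet_lt h2 measurable_const).inter
      (measurableSet_le (measurable_const.mul measurable_snd.norm) measurable_const))))

/-- The part of the tube swept by the ball in the time interval `[a, b)`. -/
def tubePiece (ε : ℝ) (w : E3) (a b : ℝ) : Set E3 :=
  {u | 0 < discr ε u w ∧ a ≤ entryTime ε u (-w) ∧ entryTime ε u (-w) < b}

lemma measurableSet_tubePiece (ε : ℝ) (w : E3) (a b : ℝ) :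
    MeasurableSet (tubePiece ε w a b) := by
  have h0 : Measurable fun u : E3 => (u, w) := measurable_id.prodMk measurable_const
  have h1 : Measurable ((fun z : E3 × E3 => discr ε z.1 z.2) ∘ fun u : E3 => (u, w)) :=
    (continuous_discr ε).measurable.comp h0
  have h2 : Measurable ((fun z : E3 × E3 => entryTime ε z.1 (-z.2)) ∘ fun u : E3 => (u, w)) :=
    (measurable_exitTime ε).comp h0
  exact ((measurableSet_lt measurable_const h1).inter ((measurableSet_le measurable_const h2).inter
    (measurableSet_lt h2 measurable_const)))

/-- Pieces of equal duration are translates of each other along w. -/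
lemma volume_tubePiece_add (ε : ℝ) (w : E3) (a b s : ℝ) :
    volume (tubePiece ε w (a + s) (b + s)) = volume (tubePiece ε w a b) := by
  rw [← measure_preimage_add volume (s • w) (tubePiece ε w (a + s) (b + s))]
  congr 1
  ext u
  have e1 : s • w + u = u + s • w := add_comm _ _
  have e2 : discr ε (u + s • w) w = discr ε u w := discr_add_smul s
  have e3 : 0 < discr ε u w → entryTime ε (u + s • w) (-w) = entryTime ε u (-w) + s := by
    intro h
    have h' : 0 < discr ε u (-w) := by rwa [discr_neg_right]
    have := entryTime_add_smul h' (-s)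
    rw [smul_neg, neg_smul, neg_neg] at this
    rw [this]; ring
  simp only [tubePiece, Set.mem_preimage, Set.mem_ofPred_eq, e1, e2]
  constructor
  · rintro ⟨h1, h2, h3⟩
    rw [e3 h1] at h2 h3
    exact ⟨h1, by linarith, by linarith⟩
  · rintro ⟨h1, h2, h3⟩
    rw [e3 h1]
    exact ⟨h1, by linarith, by linarith⟩

lemma norm_le_of_mem_tubePiece {ε : ℝ} (hε : 0 < ε) {w : E3} {b : ℝ} {u : E3}
    (hu : u ∈ tubePiece ε w 0 b) : ‖u‖ ≤ ε + b * ‖w‖ := by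
  obtain ⟨h1, h2, h3⟩ := hu
  have h1' : 0 < discr ε u (-w) := by rwa [discr_neg_right]
  have e1 : u = entryPoint ε u (-w) + entryTime ε u (-w) • w := by
    rw [entryPoint]; module
  have e2 : ‖entryPoint ε u (-w)‖ = ε := by
    rw [← sq_eq_sq₀ (norm_nonneg _) hε.le, norm_sq_entryPoint h1']
  calc ‖u‖ ≤ ‖entryPoint ε u (-w)‖ + ‖entryTime ε u (-w) • w‖ := by
        conv_lhs => rw [e1]
        exact norm_add_le _ _
    _ ≤ ε + b * ‖w‖ := by
        rw [e2, norm_smul, Real.norm_of_nonneg h2]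
        gcongr

/-- Rather than computing a cylinder volume, about ε/(δ‖w‖) disjoint translates of the piece are
packed in a ball of radius 3ε, whose volume is O(ε³). -/
lemma volume_tubePiece_le {ε δ : ℝ} (hε : 0 < ε) (hδ : 0 < δ) {w : E3} (hw : δ * ‖w‖ ≤ ε) :
    volume (tubePiece ε w 0 δ) ≤ ENNReal.ofReal (144 * ε ^ 2 * δ * ‖w‖) := by
  by_cases hw0 : w = 0
  · have : tubePiece ε w 0 δ = ∅ := by
      ext u
      simp only [tubePiece, Set.mem_ofPred_eq, Set.mem_empty_iff_false, iff_false]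
      rintro ⟨h, -⟩
      exact ne_zero_of_discr_pos h hw0
    simp [this]
  have hw1 : 0 < δ * ‖w‖ := mul_pos hδ (norm_pos_iff.2 hw0)
  set k := ⌈ε / (δ * ‖w‖)⌉₊ with hk
  have hk1 : ε ≤ k * (δ * ‖w‖) := by
    rw [← div_le_iff₀ hw1]; exact Nat.le_ceil _
  have hk2 : k * (δ * ‖w‖) ≤ 2 * ε := by
    have h1 : (k : ℝ) < ε / (δ * ‖w‖) + 1 := Nat.ceil_lt_add_one (by positivity)
    have h2 : (k : ℝ) * (δ * ‖w‖) ≤ (ε / (δ * ‖w‖) + 1) * (δ * ‖w‖) := by gcongr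
    rw [add_mul, div_mul_cancel₀ _ hw1.ne'] at h2
    linarith
  have hk0 : 0 < k := Nat.ceil_pos.2 (by positivity)
  have hsum : (k : ℝ≥0∞) * volume (tubePiece ε w 0 δ) ≤
      volume (Metric.closedBall (0 : E3) (3 * ε)) := by
    have h1 : ∀ i ∈ Finset.range k, volume (tubePiece ε w (0 + i * δ) (δ + i * δ)) =
        volume (tubePiece ε w 0 δ) := fun i _ => volume_tubePiece_add _ _ _ _ _
    have h2 : (k : ℝ≥0∞) * volume (tubePiece ε w 0 δ) =
        ∑ i ∈ Finset.range k, volume (tubePiece ε w (0 + i * δ) (δ + i * δ)) := by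
      rw [Finset.sum_congr rfl h1]; simp
    rw [h2, ← measure_biUnion_finset]
    · refine measure_mono ?_
      intro u hu
      simp only [Set.mem_iUnion] at hu
      obtain ⟨i, hi, hu1, hu2, hu3⟩ := hu
      have hi' : (i : ℝ) + 1 ≤ k := by exact_mod_cast Finset.mem_range.1 hi
      have hu' : u ∈ tubePiece ε w 0 (k * δ) := by
        refine ⟨hu1, le_trans (by positivity) hu2, hu3.trans_le ?_⟩
        nlinarith
      have := norm_le_of_mem_tubePiece hε hu'
      rw [mem_closedBall_zero_iff]
      linarith
    · intro i _ j _ hij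
      refine Set.disjoint_left.2 ?_
      rintro u ⟨_, hu2, hu3⟩ ⟨_, hv2, hv3⟩
      rcases lt_or_gt_of_ne hij with h | h
      · have h' : (i : ℝ) + 1 ≤ j := by exact_mod_cast h
        nlinarith
      · have h' : (j : ℝ) + 1 ≤ i := by exact_mod_cast h
        nlinarith
    · exact fun i _ => measurableSet_tubePiece _ _ _ _
  rw [EuclideanSpace.volume_closedBall_fin_three, ← ENNReal.ofReal_pow (by positivity),
    ← ENNReal.ofReal_mul (by positivity)] at hsum
  have hk' : (k : ℝ≥0∞) ≠ 0 := by exact_mod_cast hk0.ne'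
  rw [mul_comm, ← ENNReal.le_div_iff_mul_le (Or.inl hk') (Or.inl (ENNReal.natCast_ne_top k))]
    at hsum
  refine hsum.trans ?_
  rw [ENNReal.div_le_iff hk' (ENNReal.natCast_ne_top k), ← ENNReal.ofReal_natCast,
    ← ENNReal.ofReal_mul (by positivity)]
  apply ENNReal.ofReal_le_ofReal
  have h1 : 144 * ε ^ 2 * ε ≤ 144 * ε ^ 2 * (k * (δ * ‖w‖)) := by gcongr
  -- The ball of radius 3ε has volume 36πε³, and π < 4 gives the constant 144.
  have h2 : (3 * ε) ^ 3 * (Real.pi * 4 / 3) ≤ 144 * ε ^ 2 * ε := by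
    have := Real.pi_lt_four
    have h3 : 0 < ε ^ 3 := by positivity
    nlinarith
  linarith

end Tube

/-! ### Gaussian integration over the newly attached particle -/

section GaussianMoment

/-- The first absolute moment of a Gaussian weight on the velocities. -/
def gaussMoment (b : ℝ) : ℝ≥0∞ :=
  ∫⁻ v : E3, ENNReal.ofReal ((1 + ‖v‖) * Real.exp (-b * ‖v‖ ^ 2))

lemma lintegral_gauss_lt_top {b : ℝ} (hb : 0 < b) :
    ∫⁻ v : E3, ENNReal.ofReal (Real.exp (-b * ‖v‖ ^ 2)) < ∞ := by
  have h := GaussianFourier.integrable_cexp_neg_mul_sq_norm_add (V := E3) (b := b)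
    (by simpa using hb) 0 0
  have h2 := h.norm
  simp only [Complex.norm_exp] at h2
  have h3 : Integrable (fun v : E3 => Real.exp (-b * ‖v‖ ^ 2)) := by
    refine h2.congr (Filter.Eventually.of_forall fun v => ?_)
    simp [← Complex.ofReal_pow]
  exact h3.lintegral_lt_top

lemma gaussMoment_lt_top {b : ℝ} (hb : 0 < b) : gaussMoment b < ∞ := by
  have h1 : ∀ v : E3, (1 + ‖v‖) * Real.exp (-b * ‖v‖ ^ 2) ≤
      (2 + 2 / b) * Real.exp (-(b / 2) * ‖v‖ ^ 2) := by
    intro v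
    have e1 : Real.exp (-b * ‖v‖ ^ 2) =
        Real.exp (-(b / 2) * ‖v‖ ^ 2) * Real.exp (-(b / 2) * ‖v‖ ^ 2) := by
      rw [← Real.exp_add]; congr 1; ring
    have e2 : (1 + ‖v‖) * Real.exp (-(b / 2) * ‖v‖ ^ 2) ≤ 2 + 2 / b := by
      have e3 := Real.add_one_le_exp (b / 2 * ‖v‖ ^ 2)
      rw [neg_mul, Real.exp_neg, ← div_eq_mul_inv, div_le_iff₀ (Real.exp_pos _)]
      refine le_trans ?_ (mul_le_mul_of_nonneg_left e3 (by positivity))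
      have e4 : (2 + 2 / b) * (b / 2 * ‖v‖ ^ 2 + 1) =
        b * ‖v‖ ^ 2 + ‖v‖ ^ 2 + 2 + 2 / b := by field_simp; ring
      rw [e4]
      have : 0 < 2 / b := by positivity
      nlinarith [sq_nonneg (‖v‖ - 1), mul_nonneg hb.le (sq_nonneg ‖v‖)]
    rw [e1, ← mul_assoc]
    gcongr
  refine lt_of_le_of_lt (lintegral_mono fun v => ENNReal.ofReal_le_ofReal (h1 v)) ?_
  simp_rw [ENNReal.ofReal_mul (show (0 : ℝ) ≤ 2 + 2 / b by positivity)]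
  rw [lintegral_const_mul _ (by fun_prop)]
  exact ENNReal.mul_lt_top ENNReal.ofReal_lt_top (lintegral_gauss_lt_top (half_pos hb))

/-- The exit region on the torus. -/
def exitRegionTorus (ε δ : ℝ) : Set (Torus3 × E3) := {z | (lift z.1, z.2) ∈ exitRegion ε δ}

lemma measurableSet_exitRegionTorus (ε δ : ℝ) : MeasurableSet (exitRegionTorus ε δ) :=
  measurable_lift_prod (measurableSet_exitRegion ε δ)

/-- For slow relative motion the slice lifts into a tube piece; for δ‖w‖ > ε it is empty by the
truncation built into `exitRegion`. -/
lemma volume_exitRegionTorus_slice_le {ε δ : ℝ} (hε : 0 < ε) (hδ : 0 < δ) (w : E3) :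
    volume {x : Torus3 | (x, w) ∈ exitRegionTorus ε δ} ≤
      ENNReal.ofReal (144 * ε ^ 2 * δ * ‖w‖) := by
  by_cases hw : δ * ‖w‖ ≤ ε
  · have hm : MeasurableSet {x : Torus3 | (x, w) ∈ exitRegionTorus ε δ} :=
      measurable_prodMk_right (measurableSet_exitRegionTorus ε δ)
    rw [← measurePreserving_proj.measure_preimage hm.nullMeasurableSet,
      Measure.restrict_apply' measurableSet_cube]
    refine le_trans (measure_mono ?_) (volume_tubePiece_le hε hδ hw)
    rintro u ⟨⟨h1, h2, h3, h4⟩, hu⟩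
    simp only [lift_proj hu] at h1 h2 h3
    exact ⟨h1, h2, h3⟩
  · have : {x : Torus3 | (x, w) ∈ exitRegionTorus ε δ} = ∅ := by
      ext x
      simp only [Set.mem_ofPred_eq, Set.mem_empty_iff_false, iff_false]
      exact fun h => hw h.2.2.2
    simp [this]

/-- The Gaussian weight of the states of a particle that has just collided with a given one. -/
lemma lintegral_exitRegion_gauss_le {ε δ l b : ℝ} (hε : 0 < ε) (hδ : 0 < δ) (hb : b ≤ l)
    (z : State) :
    ∫⁻ a : State, (exitRegionTorus ε δ).indicator 1 (a - z) *
      ENNReal.ofReal (Real.exp (-l * ‖a.2‖ ^ 2)) ≤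
    ENNReal.ofReal (144 * ε ^ 2 * δ * (1 + ‖z.2‖)) * gaussMoment b := by
  have hm : Measurable fun a : State => (exitRegionTorus ε δ).indicator (1 : State → ℝ≥0∞) (a - z) *
      ENNReal.ofReal (Real.exp (-l * ‖a.2‖ ^ 2)) := by
    refine Measurable.mul ?_ (by fun_prop)
    exact (measurable_one.indicator (measurableSet_exitRegionTorus ε δ)).comp
      (measurable_id.sub_const z)
  rw [Measure.volume_eq_prod, lintegral_prod_symm _ hm.aemeasurable, gaussMoment,
    ← lintegral_const_mul _ (by fun_prop)]
  refine lintegral_mono fun v => ?_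
  simp only
  rw [lintegral_mul_const']
  · have h1 : ∫⁻ x : Torus3, (exitRegionTorus ε δ).indicator (1 : State → ℝ≥0∞) ((x, v) - z) =
        volume {x : Torus3 | (x, v - z.2) ∈ exitRegionTorus ε δ} := by
      have hs : MeasurableSet {x : Torus3 | (x, v - z.2) ∈ exitRegionTorus ε δ} :=
        measurable_prodMk_right (measurableSet_exitRegionTorus ε δ)
      rw [← lintegral_indicator_one hs, ← lintegral_sub_right_eq_self
        ({x : Torus3 | (x, v - z.2) ∈ exitRegionTorus ε δ}.indicator 1) z.1]
      rfl
    rw [h1]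
    refine (mul_le_mul_left (volume_exitRegionTorus_slice_le hε hδ _) _).trans ?_
    rw [← ENNReal.ofReal_mul (by positivity), ← ENNReal.ofReal_mul (by positivity)]
    apply ENNReal.ofReal_le_ofReal
    have e1 : ‖v - z.2‖ ≤ (1 + ‖z.2‖) * (1 + ‖v‖) := by
      have := norm_sub_le v z.2
      nlinarith [norm_nonneg v, norm_nonneg z.2]
    have e2 : Real.exp (-l * ‖v‖ ^ 2) ≤ Real.exp (-b * ‖v‖ ^ 2) := by
      apply Real.exp_le_exp.2
      nlinarith [sq_nonneg ‖v‖]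
    calc 144 * ε ^ 2 * δ * ‖v - z.2‖ * Real.exp (-l * ‖v‖ ^ 2)
        ≤ 144 * ε ^ 2 * δ * ((1 + ‖z.2‖) * (1 + ‖v‖)) * Real.exp (-b * ‖v‖ ^ 2) := by gcongr
      _ = _ := by ring
  · exact ENNReal.ofReal_ne_top

end GaussianMoment

/-! ### Gaussian measures of groups and cylinder events -/

section Weights

variable {N : ℕ}

instance : SecondCountableTopology (AddCircle (2 * Real.pi)) :=
  inferInstanceAs (SecondCountableTopology (ℝ ⧸ AddSubgroup.zmultiples (2 * Real.pi)))

/-- The Gaussian weight of the velocities of the particles in `I`. -/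
def weight (l : ℝ) (I : Finset (Fin N)) (Y : Config N) : ℝ≥0∞ :=
  ∏ i ∈ I, ENNReal.ofReal (Real.exp (-l * ‖(Y i).2‖ ^ 2))

lemma measurable_weight (l : ℝ) (I : Finset (Fin N)) : Measurable (weight l I) := by
  unfold weight
  refine Finset.measurable_fun_prod _ fun i _ => ?_
  have : Measurable fun Y : Config N => (Y i).2 := measurable_snd.comp (measurable_pi_apply i)
  fun_prop

lemma weight_freeFlow (l s : ℝ) (I : Finset (Fin N)) (Y : Config N) :
    weight l I (freeFlow s Y) = weight l I Y := rfl

lemma weight_congr (l : ℝ) {I : Finset (Fin N)} {Y Y' : Config N} (h : ∀ i ∈ I, Y i = Y' i) :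
    weight l I Y = weight l I Y' :=
  Finset.prod_congr rfl fun i hi => by rw [h i hi]

/-- The impulse g is the projection of the relative velocity on the line of centres, so ⟨w, g⟩ =
‖g‖² and the kinetic energy is unchanged. -/
lemma energy_relJump {ε δ : ℝ} (hε : 0 < ε) {a b : State} (h : a - b ∈ hitRegionTorus ε δ) :
    ‖(a + relJump ε (a - b)).2‖ ^ 2 + ‖(b - relJump ε (a - b)).2‖ ^ 2 =
      ‖a.2‖ ^ 2 + ‖b.2‖ ^ 2 := by
  set g := impulse ε (lift (a - b).1) (a - b).2 with hg
  have h1 : (relJump ε (a - b)).2 = -g := rfl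
  have h2 : (inner ℝ (a - b).2 g : ℝ) = ‖g‖ ^ 2 := inner_impulse_right hε h.1
  rw [Prod.snd_add, Prod.snd_sub, h1, norm_add_sq_real, norm_sub_sq_real]
  rw [Prod.snd_sub, inner_sub_left] at h2
  simp only [inner_neg_right, norm_neg]
  linarith

lemma collide_of_ne {ε : ℝ} {p q i : Fin N} (hp : i ≠ p) (hq : i ≠ q) (Y : Config N) :
    collide ε p q Y i = Y i := by
  simp [collide, hp, hq]

lemma collide_left {ε : ℝ} {p q : Fin N} (hpq : p ≠ q) (Y : Config N) :
    collide ε p q Y p = Y p + relJump ε (Y p - Y q) := by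
  simp [collide, hpq]

lemma collide_right {ε : ℝ} {p q : Fin N} (Y : Config N) :
    collide ε p q Y q = Y q - relJump ε (Y p - Y q) := by
  simp [collide]

lemma weight_collisionFlow {ε δ : ℝ} (hε : 0 < ε) (l : ℝ) {I : Finset (Fin N)} {p q : Fin N}
    (hpq : p ≠ q) (hp : p ∈ I) (hq : q ∈ I) {Y : Config N} (hY : Y ∈ hitSet ε δ p q) :
    weight l I (collisionFlow ε δ p q Y) = weight l I Y := by
  have hq' : q ∈ I.erase p := Finset.mem_erase.2 ⟨hpq.symm, hq⟩
  rw [collisionFlow, weight_freeFlow, weight, weight, ← Finset.mul_prod_erase I _ hp,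
    ← Finset.mul_prod_erase I _ hp, ← Finset.mul_prod_erase _ _ hq',
    ← Finset.mul_prod_erase _ _ hq', ← mul_assoc, ← mul_assoc, collide_left hpq, collide_right]
  congr 1
  · rw [← ENNReal.ofReal_mul (Real.exp_pos _).le, ← ENNReal.ofReal_mul (Real.exp_pos _).le,
      ← Real.exp_add, ← Real.exp_add]
    congr 2
    have := energy_relJump hε hY
    linear_combination -l * this
  · refine Finset.prod_congr rfl fun i hi => ?_
    have h1 := Finset.mem_erase.1 hi
    have h2 := Finset.mem_erase.1 h1.2
    rw [collide_of_ne h2.1 h1.1]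

/-- The unnormalized Gibbs measure of the particles in `I`, regardless of exclusion; the other
particles are put at the origin. -/
def reduced (l : ℝ) (I : Finset (Fin N)) : Measure (Config N) :=
  ((Measure.pi fun _ : I => (volume : Measure State)).map
    (Function.updateFinset (0 : Config N) I)).withDensity (weight l I)

lemma lintegral_reduced (l : ℝ) (I : Finset (Fin N)) (f : Config N → ℝ≥0∞) (hf : Measurable f) :
    ∫⁻ Y, f Y ∂(reduced l I) =
      lmarginal (fun _ => volume) I (fun Y => weight l I Y * f Y) 0 := by
  rw [reduced, lintegral_withDensity_eq_lintegral_mul _ (measurable_weight l I) hf,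
    lintegral_map ((measurable_weight l I).mul hf) measurable_updateFinset]
  rfl

lemma reduced_apply (l : ℝ) (I : Finset (Fin N)) {S : Set (Config N)} (hS : MeasurableSet S) :
    reduced l I S = lmarginal (fun _ => volume) I (S.indicator (weight l I)) 0 := by
  rw [← lintegral_indicator_one hS, lintegral_reduced _ _ _ (measurable_one.indicator hS)]
  congr 1
  ext Y
  by_cases h : Y ∈ S <;> simp [h]

/-- A measurable event concerning only the particles in `I`. -/
structure IsCylinder (I : Finset (Fin N)) (S : Set (Config N)) : Prop where
  measurableSet : MeasurableSet S
  mem_of_eq : ∀ Y Y' : Config N, (∀ i ∈ I, Y i = Y' i) → Y ∈ S → Y' ∈ S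

lemma IsCylinder.mem_iff {I : Finset (Fin N)} {S : Set (Config N)} (h : IsCylinder I S)
    {Y Y' : Config N} (hY : ∀ i ∈ I, Y i = Y' i) : Y ∈ S ↔ Y' ∈ S :=
  ⟨h.mem_of_eq Y Y' hY, h.mem_of_eq Y' Y fun i hi => (hY i hi).symm⟩

lemma IsCylinder.dependsOn {I : Finset (Fin N)} {S : Set (Config N)} (h : IsCylinder I S) (l : ℝ) :
    DependsOn (S.indicator (weight l I)) (I : Set (Fin N)) := by
  intro Y Y' hY
  have hY' : ∀ i ∈ I, Y i = Y' i := fun i hi => hY i hi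
  by_cases hm : Y ∈ S
  · rw [Set.indicator_of_mem hm, Set.indicator_of_mem ((h.mem_iff hY').1 hm), weight_congr l hY']
  · rw [Set.indicator_of_notMem hm, Set.indicator_of_notMem (mt (h.mem_iff hY').2 hm)]

lemma IsCylinder.inter {I : Finset (Fin N)} {S T : Set (Config N)} (hS : IsCylinder I S)
    (hT : IsCylinder I T) : IsCylinder I (S ∩ T) :=
  ⟨hS.1.inter hT.1, fun Y Y' h hY => ⟨hS.2 Y Y' h hY.1, hT.2 Y Y' h hY.2⟩⟩

lemma IsCylinder.diff {I : Finset (Fin N)} {S T : Set (Config N)} (hS : IsCylinder I S)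
    (hT : IsCylinder I T) : IsCylinder I (S \ T) :=
  ⟨hS.1.diff hT.1, fun Y Y' h hY => ⟨hS.2 Y Y' h hY.1, mt (hT.mem_iff h).2 hY.2⟩⟩

lemma IsCylinder.union {I : Finset (Fin N)} {S T : Set (Config N)} (hS : IsCylinder I S)
    (hT : IsCylinder I T) : IsCylinder I (S ∪ T) :=
  ⟨hS.1.union hT.1, fun Y Y' h hY => hY.imp (hS.2 Y Y' h) (hT.2 Y Y' h)⟩

lemma IsCylinder.iUnion {κ : Sort*} [Countable κ] {I : Finset (Fin N)} {S : κ → Set (Config N)}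
    (hS : ∀ k, IsCylinder I (S k)) : IsCylinder I (⋃ k, S k) :=
  ⟨MeasurableSet.iUnion fun k => (hS k).1, fun Y Y' h hY => by
    obtain ⟨k, hk⟩ := Set.mem_iUnion.1 hY
    exact Set.mem_iUnion.2 ⟨k, (hS k).2 Y Y' h hk⟩⟩

lemma IsCylinder.empty {I : Finset (Fin N)} : IsCylinder I (∅ : Set (Config N)) :=
  ⟨MeasurableSet.empty, fun _ _ _ h => h⟩

lemma IsCylinder.mono {I J : Finset (Fin N)} {S : Set (Config N)} (h : IsCylinder I S)
    (hIJ : I ⊆ J) : IsCylinder J S :=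
  ⟨h.1, fun Y Y' hY => h.2 Y Y' fun i hi => hY i (hIJ hi)⟩

lemma IsCylinder.freeFlow {I : Finset (Fin N)} {S : Set (Config N)} (h : IsCylinder I S) (s : ℝ) :
    IsCylinder I (HardSpheres.freeFlow s ⁻¹' S) :=
  ⟨measurable_freeFlow s h.1, fun Y Y' hY => h.2 _ _ fun i hi => by
    rw [freeFlow_apply, freeFlow_apply, hY i hi]⟩

lemma IsCylinder.collisionFlow {ε δ : ℝ} {I : Finset (Fin N)} {S : Set (Config N)}
    (h : IsCylinder I S) {p q : Fin N} (hp : p ∈ I) (hq : q ∈ I) :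
    IsCylinder I (HardSpheres.collisionFlow ε δ p q ⁻¹' S) :=
  ⟨measurable_collisionFlow ε δ p q h.1, fun Y Y' hY => h.2 _ _ fun i hi => by
    rw [HardSpheres.collisionFlow, HardSpheres.collisionFlow, freeFlow_apply, freeFlow_apply]
    congr 1
    simp only [collide, hY p hp, hY q hq]
    by_cases h1 : i = q
    · simp [h1]
    · by_cases h2 : i = p
      · simp [Function.update_of_ne (h2 ▸ h1 : p ≠ q), h2]
      · simp [h1, h2, hY i hi]⟩

lemma isCylinder_hitSet {ε δ : ℝ} {I : Finset (Fin N)} {p q : Fin N} (hp : p ∈ I) (hq : q ∈ I) :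
    IsCylinder I (hitSet ε δ p q) :=
  ⟨measurableSet_hitSet ε δ p q, fun Y Y' hY h => by
    rw [hitSet, Set.mem_ofPred_eq, ← hY p hp, ← hY q hq]; exact h⟩

lemma reduced_freeFlow_preimage (l s : ℝ) {I : Finset (Fin N)} {S : Set (Config N)}
    (hS : IsCylinder I S) : reduced l I (freeFlow s ⁻¹' S) = reduced l I S := by
  rw [reduced_apply _ _ (measurable_freeFlow s hS.1), reduced_apply _ _ hS.1,
    lmarginal_eq_of_dependsOn (hS.dependsOn l) 0 (freeFlow s 0),
    ← lmarginal_freeFlow s I _ ((measurable_weight l I).indicator hS.1)]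
  rfl

/-- Volume does not increase and the Gaussian weight is constant along the step because energy is
conserved. -/
lemma reduced_collisionFlow_preimage_le {ε δ : ℝ} (hε : 0 < ε) (hε1 : ε ≤ 1) (l : ℝ)
    {I : Finset (Fin N)} {S : Set (Config N)} (hS : IsCylinder I S) {p q : Fin N} (hpq : p ≠ q)
    (hp : p ∈ I) (hq : q ∈ I) :
    reduced l I (hitSet ε δ p q ∩ collisionFlow ε δ p q ⁻¹' S) ≤ reduced l I S := by
  rw [reduced_apply _ _ ((measurableSet_hitSet ε δ p q).inter
    (measurable_collisionFlow ε δ p q hS.1)), reduced_apply _ _ hS.1]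
  refine le_trans (le_of_eq ?_) (lmarginal_collisionFlow_le (δ := δ) hε hε1 hpq hp hq
    ((measurable_weight l I).indicator hS.1) (hS.dependsOn l) 0)
  congr 1
  ext Y
  by_cases h1 : Y ∈ hitSet ε δ p q
  · by_cases h2 : collisionFlow ε δ p q Y ∈ S
    · rw [Set.indicator_of_mem (Set.mem_inter h1 h2), Set.indicator_of_mem h1, Function.comp,
        Set.indicator_of_mem h2, weight_collisionFlow hε l hpq hp hq h1]
    · have h3 : Y ∉ hitSet ε δ p q ∩ collisionFlow ε δ p q ⁻¹' S := fun h => h2 h.2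
      rw [Set.indicator_of_notMem h3, Set.indicator_of_mem h1,
        Function.comp, Set.indicator_of_notMem h2]
  · rw [Set.indicator_of_notMem (mt Set.mem_of_mem_inter_left h1), Set.indicator_of_notMem h1]

end Weights

/-! ### Reading the last collision off the final configuration -/

section FirstContact

variable {N : ℕ}

lemma continuous_torusDist {X : Type*} [TopologicalSpace X] {f g : X → Torus3}
    (hf : Continuous f) (hg : Continuous g) : Continuous fun x => torusDist (f x) (g x) := by
  unfold torusDist
  refine Real.continuous_sqrt.comp (continuous_finsetSum _ fun a _ => ?_)
  exact (((continuous_apply a).comp hf).sub ((continuous_apply a).comp hg)).norm.pow 2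

lemma continuous_freeFlow_position (s : ℝ) (p : Fin N) :
    Continuous fun Y : Config N => (freeFlow s Y p).1 :=
  continuous_fst.comp ((continuous_apply p).comp (continuous_freeFlow s))

lemma continuous_dist_freeFlow (s : ℝ) (p q : Fin N) : Continuous fun Y : Config N =>
    torusDist (freeFlow s Y p).1 (freeFlow s Y q).1 :=
  continuous_torusDist (continuous_freeFlow_position s p) (continuous_freeFlow_position s q)

lemma torusDist_comm (x y : Torus3) : torusDist x y = torusDist y x := by
  simp only [torusDist, norm_sub_rev]

/-- Going back in time from the configuration, with the particles in `I` moving freely, the first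
contact within `I` during `[0, δ)` is that of `p` and `q`, and it is not grazing. -/
def firstContact (ε δ : ℝ) (I : Finset (Fin N)) (p q : Fin N) : Set (Config N) :=
  {Y | ∃ s : ℚ, (0 < (s : ℝ) ∧ (s : ℝ) < δ) ∧
    torusDist (freeFlow (-(s : ℝ)) Y p).1 (freeFlow (-(s : ℝ)) Y q).1 < ε ∧
    ∀ r ∈ Set.Icc 0 (s : ℝ), ∀ k ∈ I, ∀ m ∈ I, k ≠ m → ¬(k = p ∧ m = q) → ¬(k = q ∧ m = p) →
      ε ≤ torusDist (freeFlow (-r) Y k).1 (freeFlow (-r) Y m).1}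

/-- The rational witness makes the event a countable union of intersections of an open and a closed
condition, hence measurable. -/
lemma isCylinder_firstContact {ε δ : ℝ} {I : Finset (Fin N)} {p q : Fin N} (hp : p ∈ I)
    (hq : q ∈ I) : IsCylinder I (firstContact ε δ I p q) := by
  constructor
  · have : firstContact ε δ I p q = ⋃ s : ℚ, {Y : Config N | (0 < (s : ℝ) ∧ (s : ℝ) < δ) ∧
        torusDist (freeFlow (-(s : ℝ)) Y p).1 (freeFlow (-(s : ℝ)) Y q).1 < ε ∧
        ∀ r ∈ Set.Icc 0 (s : ℝ), ∀ k ∈ I, ∀ m ∈ I, k ≠ m →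
          ¬(k = p ∧ m = q) → ¬(k = q ∧ m = p) →
          ε ≤ torusDist (freeFlow (-r) Y k).1 (freeFlow (-r) Y m).1} := by
      ext Y
      simp [firstContact]
    rw [this]
    refine MeasurableSet.iUnion fun s => ?_
    refine (MeasurableSet.const _).inter (MeasurableSet.inter ?_ ?_)
    · exact (isOpen_lt (continuous_dist_freeFlow _ p q) continuous_const).measurableSet
    · have hc : IsClosed {Y : Config N | ∀ r ∈ Set.Icc 0 (s : ℝ), ∀ k ∈ I, ∀ m ∈ I, k ≠ m →
          ¬(k = p ∧ m = q) → ¬(k = q ∧ m = p) →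
          ε ≤ torusDist (freeFlow (-r) Y k).1 (freeFlow (-r) Y m).1} := by
        simp only [Set.ofPred_forall]
        refine isClosed_iInter fun r => isClosed_iInter fun _ => isClosed_iInter fun k =>
          isClosed_iInter fun _ => isClosed_iInter fun m => isClosed_iInter fun _ =>
          isClosed_iInter fun _ => isClosed_iInter fun _ => isClosed_iInter fun _ => ?_
        exact isClosed_le continuous_const (continuous_dist_freeFlow _ k m)
      exact hc.measurableSet
  · rintro Y Y' h ⟨s, hs, h1, h2⟩
    refine ⟨s, hs, ?_, fun r hr k hk m hm => ?_⟩
    · simpa only [freeFlow_apply, h p hp, h q hq] using h1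
    · have := h2 r hr k hk m hm
      simpa only [freeFlow_apply, h k hk, h m hm] using this

/-- At the smaller of the two witness times one pair overlaps while the other event forbids it. -/
lemma disjoint_firstContact {ε δ : ℝ} {I : Finset (Fin N)} {p q p' q' : Fin N} (hp : p ∈ I)
    (hq : q ∈ I) (hp' : p' ∈ I) (hq' : q' ∈ I) (h : p < q) (h' : p' < q')
    (hne : ¬(p = p' ∧ q = q')) :
    Disjoint (firstContact ε δ I p q) (firstContact ε δ I p' q') := by
  refine Set.disjoint_left.2 ?_
  rintro Y ⟨s, hs, h1, h2⟩ ⟨s', hs', h1', h2'⟩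
  rcases le_total (s : ℝ) s' with hle | hle
  · have := h2' s ⟨hs.1.le, hle⟩ p hp q hq h.ne hne (by rintro ⟨rfl, rfl⟩; exact lt_asymm h h')
    linarith
  · have := h2 s' ⟨hs'.1.le, hle⟩ p' hp' q' hq' h'.ne (fun hh => hne ⟨hh.1.symm, hh.2.symm⟩)
      (by rintro ⟨rfl, rfl⟩; exact lt_asymm h h')
    linarith

end FirstContact

/-! ### One backward time step: staying or joining -/

section Evolution

variable {N : ℕ}

/-- The initial configurations of a time interval of length `δ` in which the particles of `I`
do not collide with others, have at most one collision, and end in `S`. -/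
def stay (ε δ : ℝ) (I : Finset (Fin N)) (S : Set (Config N)) : Set (Config N) :=
  freeFlow δ ⁻¹' (S \ ⋃ x ∈ (I ×ˢ I).filter (fun x => x.1 < x.2), firstContact ε δ I x.1 x.2) ∪
  ⋃ x ∈ (I ×ˢ I).filter (fun x => x.1 < x.2), hitSet ε δ x.1 x.2 ∩
    collisionFlow ε δ x.1 x.2 ⁻¹' (S ∩ firstContact ε δ I x.1 x.2)

/-- The configurations in which `p` may just have collided with `q`. -/
def exitSet (ε δ : ℝ) (p q : Fin N) : Set (Config N) := {Y | Y p - Y q ∈ exitRegionTorus ε δ}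

/-- The initial configurations of a time interval of length `δ` in which the particle `j` collides
with the particle `q` of a group and the group ends in `S`. -/
def join (ε δ : ℝ) (j q : Fin N) (S : Set (Config N)) : Set (Config N) :=
  hitSet ε δ j q ∩ collisionFlow ε δ j q ⁻¹' (S ∩ exitSet ε δ j q)

/-- One backward time step for a family of events indexed by groups of particles. -/
def evolve (ε δ : ℝ) (A : Finset (Fin N) → Set (Config N)) (I : Finset (Fin N)) :
    Set (Config N) :=
  stay ε δ I (A I) ∪ ⋃ j ∈ I, ⋃ q ∈ I.erase j, join ε δ j q (A (I.erase j))

lemma isCylinder_exitSet {ε δ : ℝ} {I : Finset (Fin N)} {p q : Fin N} (hp : p ∈ I) (hq : q ∈ I) :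
    IsCylinder I (exitSet ε δ p q) :=
  ⟨measurable_apply_sub p q (measurableSet_exitRegionTorus ε δ), fun Y Y' hY h => by
    rw [exitSet, Set.mem_ofPred_eq, ← hY p hp, ← hY q hq]; exact h⟩

lemma isCylinder_biUnion {κ : Type*} [Countable κ] {I : Finset (Fin N)} {T : Finset κ}
    {S : κ → Set (Config N)} (hS : ∀ k ∈ T, IsCylinder I (S k)) : IsCylinder I (⋃ k ∈ T, S k) :=
  IsCylinder.iUnion fun k => IsCylinder.iUnion fun hk => hS k hk

lemma mem_pairs {I : Finset (Fin N)} {x : Fin N × Fin N}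
    (hx : x ∈ (I ×ˢ I).filter (fun x => x.1 < x.2)) : x.1 ∈ I ∧ x.2 ∈ I ∧ x.1 < x.2 := by
  simpa [and_assoc] using hx

lemma isCylinder_stay {ε δ : ℝ} {I : Finset (Fin N)} {S : Set (Config N)} (hS : IsCylinder I S) :
    IsCylinder I (stay ε δ I S) := by
  refine IsCylinder.union ?_ (isCylinder_biUnion fun x hx => ?_)
  · refine (hS.diff (isCylinder_biUnion fun x hx => ?_)).freeFlow δ
    obtain ⟨h1, h2, -⟩ := mem_pairs hx
    exact isCylinder_firstContact h1 h2
  · obtain ⟨h1, h2, -⟩ := mem_pairs hx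
    exact (isCylinder_hitSet h1 h2).inter ((hS.inter (isCylinder_firstContact h1 h2)).collisionFlow
      h1 h2)

lemma isCylinder_join {ε δ : ℝ} {I : Finset (Fin N)} {S : Set (Config N)} {j q : Fin N}
    (hj : j ∈ I) (hq : q ∈ I.erase j) (hS : IsCylinder (I.erase j) S) :
    IsCylinder I (join ε δ j q S) := by
  have hq' := (Finset.mem_erase.1 hq).2
  exact (isCylinder_hitSet hj hq').inter
    (((hS.mono (Finset.erase_subset j I)).inter (isCylinder_exitSet hj hq')).collisionFlow hj hq')

lemma isCylinder_evolve {ε δ : ℝ} {A : Finset (Fin N) → Set (Config N)}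
    (hA : ∀ I, IsCylinder I (A I)) (I : Finset (Fin N)) : IsCylinder I (evolve ε δ A I) :=
  (isCylinder_stay (hA I)).union (isCylinder_biUnion fun _ hj => isCylinder_biUnion fun _ hq =>
    isCylinder_join hj hq (hA _))

/-- The branches of a step (no collision, or collision of a given pair) lead to disjoint parts of S,
told apart by the first contact going backward. Each branch does not increase measure, so the sum
stays below the measure of S; a plain union bound would lose a factor per step. -/
lemma reduced_stay_le {ε δ : ℝ} (hε : 0 < ε) (hε1 : ε ≤ 1) (l : ℝ) {I : Finset (Fin N)}
    {S : Set (Config N)} (hS : IsCylinder I S) : reduced l I (stay ε δ I S) ≤ reduced l I S := by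
  set T := (I ×ˢ I).filter (fun x : Fin N × Fin N => x.1 < x.2) with hT
  have hD : ∀ x ∈ T, IsCylinder I (firstContact ε δ I x.1 x.2) := fun x hx => by
    obtain ⟨h1, h2, -⟩ := mem_pairs hx
    exact isCylinder_firstContact h1 h2
  have hU : IsCylinder I (⋃ x ∈ T, firstContact ε δ I x.1 x.2) := isCylinder_biUnion hD
  have hdisj : (T : Set (Fin N × Fin N)).PairwiseDisjoint
      (fun x => S ∩ firstContact ε δ I x.1 x.2) := by
    intro x hx y hy hxy
    obtain ⟨h1, h2, h3⟩ := mem_pairs hx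
    obtain ⟨h1', h2', h3'⟩ := mem_pairs hy
    have := disjoint_firstContact (ε := ε) (δ := δ) h1 h2 h1' h2' h3 h3'
      (fun h => hxy (Prod.ext h.1 h.2))
    exact this.mono Set.inter_subset_right Set.inter_subset_right
  calc reduced l I (stay ε δ I S)
      ≤ reduced l I (freeFlow δ ⁻¹' (S \ ⋃ x ∈ T, firstContact ε δ I x.1 x.2)) +
        ∑ x ∈ T, reduced l I (hitSet ε δ x.1 x.2 ∩
          collisionFlow ε δ x.1 x.2 ⁻¹' (S ∩ firstContact ε δ I x.1 x.2)) :=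
        (measure_union_le _ _).trans (add_le_add le_rfl (measure_biUnion_finset_le _ _))
    _ ≤ reduced l I (S \ ⋃ x ∈ T, firstContact ε δ I x.1 x.2) +
        ∑ x ∈ T, reduced l I (S ∩ firstContact ε δ I x.1 x.2) := by
        refine add_le_add (reduced_freeFlow_preimage l δ (hS.diff hU)).le
          (Finset.sum_le_sum fun x hx => ?_)
        obtain ⟨h1, h2, h3⟩ := mem_pairs hx
        exact reduced_collisionFlow_preimage_le hε hε1 l (hS.inter (hD x hx)) h3.ne h1 h2
    _ = reduced l I (S \ ⋃ x ∈ T, firstContact ε δ I x.1 x.2) +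
        reduced l I (S ∩ ⋃ x ∈ T, firstContact ε δ I x.1 x.2) := by
        rw [← measure_biUnion_finset hdisj fun x hx => (hS.inter (hD x hx)).1, Set.inter_iUnion₂]
    _ = reduced l I S := measure_sdiff_add_inter _ hU.1

/-- The numerical constant governing the growth of clusters at inverse temperature `β`. -/
def growthConst (β : ℝ) : ℝ≥0∞ := ENNReal.ofReal (144 * (3 / 2 + 2 / β)) * gaussMoment (β / 4)

lemma growthConst_lt_top {β : ℝ} (hβ : 0 < β) : growthConst β < ∞ :=
  ENNReal.mul_lt_top ENNReal.ofReal_lt_top (gaussMoment_lt_top (by positivity))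

/-- The energy of a group of particles. -/
def energy (I : Finset (Fin N)) (Y : Config N) : ℝ := ∑ i ∈ I, ‖(Y i).2‖ ^ 2

lemma weight_eq_exp (l : ℝ) (I : Finset (Fin N)) (Y : Config N) :
    weight l I Y = ENNReal.ofReal (Real.exp (-l * energy I Y)) := by
  rw [weight, ← ENNReal.ofReal_prod_of_nonneg fun i _ => (Real.exp_pos _).le, ← Real.exp_sum,
    energy, Finset.mul_sum]

/-- From 1+x ≤ 3/2+x²/2 the sum is controlled by cardinality and energy, and E·exp(-aE) ≤ 1/a
absorbs the energy. -/
lemma sum_one_add_norm_mul_exp_le {a : ℝ} (ha : 0 < a) (I : Finset (Fin N)) (Y : Config N) :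
    (∑ q ∈ I, (1 + ‖(Y q).2‖)) * Real.exp (-a * energy I Y) ≤ 3 / 2 * I.card + 1 / (2 * a) := by
  have h1 : ∑ q ∈ I, (1 + ‖(Y q).2‖) ≤ 3 / 2 * I.card + 1 / 2 * energy I Y := by
    calc ∑ q ∈ I, (1 + ‖(Y q).2‖) ≤ ∑ q ∈ I, (3 / 2 + 1 / 2 * ‖(Y q).2‖ ^ 2) :=
          Finset.sum_le_sum fun q _ => by nlinarith [sq_nonneg (‖(Y q).2‖ - 1)]
      _ = _ := by
          rw [Finset.sum_add_distrib, Finset.sum_const, nsmul_eq_mul, ← Finset.mul_sum, energy]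
          ring
  have hE : 0 ≤ energy I Y := Finset.sum_nonneg fun i _ => sq_nonneg _
  have h2 : Real.exp (-a * energy I Y) ≤ 1 := Real.exp_le_one_iff.2 (by nlinarith)
  have h3 : energy I Y * Real.exp (-a * energy I Y) ≤ 1 / a := by
    rw [neg_mul, Real.exp_neg, ← div_eq_mul_inv, div_le_iff₀ (Real.exp_pos _)]
    have := Real.add_one_le_exp (a * energy I Y)
    calc energy I Y = 1 / a * (a * energy I Y) := by field_simp
      _ ≤ _ := mul_le_mul_of_nonneg_left (by linarith) (by positivity)
  calc _ ≤ (3 / 2 * I.card + 1 / 2 * energy I Y) * Real.exp (-a * energy I Y) := by gcongr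
    _ = 3 / 2 * I.card * Real.exp (-a * energy I Y) +
        1 / 2 * (energy I Y * Real.exp (-a * energy I Y)) := by ring
    _ ≤ 3 / 2 * I.card * 1 + 1 / 2 * (1 / a) := by gcongr
    _ = _ := by field_simp

/-- The step is transported to its end, where j lies in the exit region of q. There the state of j
is integrated out, leaving an event of the smaller group weighted by 1+|v_q|. -/
lemma reduced_join_le {ε δ l b : ℝ} (hε : 0 < ε) (hε1 : ε ≤ 1) (hδ : 0 < δ) (hb : b ≤ l)
    {I : Finset (Fin N)} {S : Set (Config N)} {j q : Fin N} (hj : j ∈ I) (hq : q ∈ I.erase j)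
    (hS : IsCylinder (I.erase j) S) :
    reduced l I (join ε δ j q S) ≤
      lmarginal (fun _ => volume) (I.erase j) (fun Y => S.indicator (weight l (I.erase j)) Y *
        (ENNReal.ofReal (144 * ε ^ 2 * δ * (1 + ‖(Y q).2‖)) * gaussMoment b)) 0 := by
  obtain ⟨hqj, hq'⟩ := Finset.mem_erase.1 hq
  have hSE := (hS.mono (Finset.erase_subset j I)).inter
    (isCylinder_exitSet (ε := ε) (δ := δ) hj hq')
  refine (reduced_collisionFlow_preimage_le hε hε1 l hSE hqj.symm hj hq').trans ?_
  rw [reduced_apply _ _ hSE.1, lmarginal_erase' _ ((measurable_weight l I).indicator hSE.1) hj]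
  refine lmarginal_mono (fun Y => ?_) 0
  have h1 : ∀ z : State, (S ∩ exitSet ε δ j q).indicator (weight l I) (Function.update Y j z) =
      S.indicator (weight l (I.erase j)) Y * ((exitRegionTorus ε δ).indicator 1 (z - Y q) *
        ENNReal.ofReal (Real.exp (-l * ‖z.2‖ ^ 2))) := by
    intro z
    set Y' := Function.update Y j z with hY'
    have e1 : ∀ i ∈ I.erase j, Y' i = Y i := fun i hi => by
      simp [hY', (Finset.mem_erase.1 hi).1]
    have e2 : weight l I Y' = weight l (I.erase j) Y *
        ENNReal.ofReal (Real.exp (-l * ‖z.2‖ ^ 2)) := by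
      rw [← weight_congr l e1, weight, ← Finset.mul_prod_erase I _ hj, mul_comm, weight]
      simp [hY']
    have e3 : Y' ∈ exitSet ε δ j q ↔ z - Y q ∈ exitRegionTorus ε δ := by
      rw [exitSet, Set.mem_ofPred_eq, e1 q hq]
      simp [hY']
    by_cases hm : Y ∈ S
    · have hm' := (hS.mem_iff e1).2 hm
      by_cases hx : z - Y q ∈ exitRegionTorus ε δ
      · rw [Set.indicator_of_mem (Set.mem_inter hm' (e3.2 hx)), Set.indicator_of_mem hm,
          Set.indicator_of_mem hx, e2]
        simp
      · rw [Set.indicator_of_notMem (fun h => hx (e3.1 (Set.mem_of_mem_inter_right h))),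
          Set.indicator_of_notMem hx]
        simp
    · rw [Set.indicator_of_notMem
        (fun h => hm ((hS.mem_iff e1).1 (Set.mem_of_mem_inter_left h))),
        Set.indicator_of_notMem hm]
      simp
  simp_rw [h1]
  have hm : Measurable fun z : State => (exitRegionTorus ε δ).indicator (1 : State → ℝ≥0∞)
      (z - Y q) * ENNReal.ofReal (Real.exp (-l * ‖z.2‖ ^ 2)) := by
    refine Measurable.mul ?_ (by fun_prop)
    exact (measurable_one.indicator (measurableSet_exitRegionTorus ε δ)).comp
      (measurable_id.sub_const _)
  rw [lintegral_const_mul _ hm]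
  gcongr
  exact lintegral_exitRegion_gauss_le hε hδ hb (Y q)

/-- Lowering the exponent from l to l' spends exp(-β·energy/(4K)) on the sum of the speeds. The
price is linear in K, instead of involving the energy of the group. -/
lemma sum_reduced_join_le {ε δ l l' β : ℝ} {K : ℕ} (hε : 0 < ε) (hε1 : ε ≤ 1) (hδ : 0 < δ)
    (hβ : 0 < β) (hl : β / 4 ≤ l) (hll : l = l' + β / (4 * K)) {I : Finset (Fin N)}
    {S : Set (Config N)} {j : Fin N} (hj : j ∈ I) (hK : I.card ≤ K)
    (hS : IsCylinder (I.erase j) S) :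
    reduced l I (⋃ q ∈ I.erase j, join ε δ j q S) ≤
      growthConst β * ENNReal.ofReal (ε ^ 2 * δ * K) * reduced l' (I.erase j) S := by
  have hIpos : 0 < I.card := Finset.card_pos.2 ⟨j, hj⟩
  have hKpos : (0 : ℝ) < K := by exact_mod_cast hIpos.trans_le hK
  have hmeas : ∀ q, Measurable fun Y : Config N => S.indicator (weight l (I.erase j)) Y *
        (ENNReal.ofReal (144 * ε ^ 2 * δ * (1 + ‖(Y q).2‖)) * gaussMoment (β / 4)) := by
    intro q
    have h : Measurable fun Y : Config N => (Y q).2 := measurable_snd.comp (measurable_pi_apply q)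
    exact ((measurable_weight l _).indicator hS.1).mul
      (Measurable.mul_const (by fun_prop) _)
  have hsum : ∑ q ∈ I.erase j, lmarginal (fun _ => volume) (I.erase j)
        (fun Y => S.indicator (weight l (I.erase j)) Y *
        (ENNReal.ofReal (144 * ε ^ 2 * δ * (1 + ‖(Y q).2‖)) * gaussMoment (β / 4))) 0 =
      lmarginal (fun _ => volume) (I.erase j) (fun Y => ∑ q ∈ I.erase j,
        S.indicator (weight l (I.erase j)) Y *
        (ENNReal.ofReal (144 * ε ^ 2 * δ * (1 + ‖(Y q).2‖)) * gaussMoment (β / 4))) 0 := by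
    simp only [lmarginal]
    rw [lintegral_finsetSum]
    exact fun q _ => (hmeas q).comp measurable_updateFinset
  calc reduced l I (⋃ q ∈ I.erase j, join ε δ j q S)
      ≤ ∑ q ∈ I.erase j, reduced l I (join ε δ j q S) := measure_biUnion_finset_le _ _
    _ ≤ _ := (Finset.sum_le_sum fun q hq => reduced_join_le hε hε1 hδ hl hj hq hS).trans hsum.le
    _ ≤ lmarginal (fun _ => volume) (I.erase j) (fun Y =>
        (growthConst β * ENNReal.ofReal (ε ^ 2 * δ * K)) *
          S.indicator (weight l' (I.erase j)) Y) 0 := by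
        refine lmarginal_mono (fun Y => ?_) 0
        by_cases hY : Y ∈ S
        · simp only [Set.indicator_of_mem hY]
          rw [← Finset.mul_sum, ← Finset.sum_mul, ← ENNReal.ofReal_sum_of_nonneg
            (fun q _ => by positivity), ← Finset.mul_sum, weight_eq_exp, weight_eq_exp, growthConst]
          have key := sum_one_add_norm_mul_exp_le (a := β / (4 * K)) (by positivity)
            (I.erase j) Y
          have hcard : ((I.erase j).card : ℝ) ≤ K := by
            exact_mod_cast (Finset.card_le_card (Finset.erase_subset j I)).trans hK
          have key2 : (∑ q ∈ I.erase j, (1 + ‖(Y q).2‖)) *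
              Real.exp (-(β / (4 * K)) * energy (I.erase j) Y) ≤ (3 / 2 + 2 / β) * K := by
            refine key.trans ?_
            have : 1 / (2 * (β / (4 * K))) = 2 / β * K := by field_simp; ring
            rw [this]
            nlinarith
          have e1 : Real.exp (-l * energy (I.erase j) Y) =
              Real.exp (-(β / (4 * K)) * energy (I.erase j) Y) *
                Real.exp (-l' * energy (I.erase j) Y) := by
            rw [← Real.exp_add, hll]; congr 1; ring
          rw [← mul_assoc, ← ENNReal.ofReal_mul (by positivity), mul_right_comm (ENNReal.ofReal _)
            (gaussMoment _), mul_right_comm _ (gaussMoment _),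
            ← ENNReal.ofReal_mul (by positivity), ← ENNReal.ofReal_mul (by positivity)]
          refine mul_le_mul_left ?_ _
          apply ENNReal.ofReal_le_ofReal
          rw [e1]
          calc _ = 144 * ε ^ 2 * δ * ((∑ q ∈ I.erase j, (1 + ‖(Y q).2‖)) *
              Real.exp (-(β / (4 * K)) * energy (I.erase j) Y)) *
                Real.exp (-l' * energy (I.erase j) Y) := by ring
            _ ≤ 144 * ε ^ 2 * δ * ((3 / 2 + 2 / β) * K) *
                Real.exp (-l' * energy (I.erase j) Y) := by gcongr
            _ = _ := by ring
        · simp [Set.indicator_of_notMem hY]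
    _ = _ := by
        rw [reduced_apply _ _ hS.1]
        simp only [lmarginal]
        rw [lintegral_const_mul]
        exact ((measurable_weight l' _).indicator hS.1).comp measurable_updateFinset

end Evolution

/-! ### Summation over groups and iteration of the step -/

section Iteration

variable {N : ℕ}

/-- The total measure of a family of events over the groups of `n` particles. -/
def total (l : ℝ) (n : ℕ) (A : Finset (Fin N) → Set (Config N)) : ℝ≥0∞ :=
  ∑ I ∈ Finset.powersetCard n Finset.univ, reduced l I (A I)

/-- For fixed j, erasing j is injective on the groups containing j, so each smaller group occurs at
most once per j, hence at most N times. -/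
lemma sum_erase_le (f : Finset (Fin N) → ℝ≥0∞) (n : ℕ) :
    ∑ I ∈ Finset.powersetCard (n + 1) Finset.univ, ∑ j ∈ I, f (I.erase j) ≤
      N * ∑ I ∈ Finset.powersetCard n Finset.univ, f I := by
  have h1 : ∑ I ∈ Finset.powersetCard (n + 1) Finset.univ, ∑ j ∈ I, f (I.erase j) =
      ∑ j : Fin N, ∑ I ∈ (Finset.powersetCard (n + 1) Finset.univ).filter (fun I => j ∈ I),
        f (I.erase j) := by
    refine Finset.sum_comm' fun I j => ?_
    simp
  have h2 : (N : ℝ≥0∞) * ∑ I ∈ Finset.powersetCard n (Finset.univ : Finset (Fin N)), f I =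
      ∑ _j : Fin N, ∑ I ∈ Finset.powersetCard n Finset.univ, f I := by
    simp
  rw [h1, h2]
  refine Finset.sum_le_sum fun j _ => ?_
  rw [← Finset.sum_image (g := fun I : Finset (Fin N) => I.erase j) (f := f)]
  · refine Finset.sum_le_sum_of_subset fun I hI => ?_
    obtain ⟨I', hI', rfl⟩ := Finset.mem_image.1 hI
    obtain ⟨h3, h4⟩ := Finset.mem_filter.1 hI'
    rw [Finset.mem_powersetCard] at h3 ⊢
    exact ⟨Finset.subset_univ _, by rw [Finset.card_erase_of_mem h4, h3.2]; rfl⟩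
  · intro I hI I' hI' h
    have h3 := (Finset.mem_filter.1 hI).2
    have h4 := (Finset.mem_filter.1 hI').2
    rw [← Finset.insert_erase h3, ← Finset.insert_erase h4]
    exact congrArg (insert j) h

lemma reduced_evolve_le {ε δ l l' β : ℝ} {K : ℕ} (hε : 0 < ε) (hε1 : ε ≤ 1) (hδ : 0 < δ)
    (hβ : 0 < β) (hl : β / 4 ≤ l) (hll : l = l' + β / (4 * K)) {I : Finset (Fin N)}
    {A : Finset (Fin N) → Set (Config N)} (hK : I.card ≤ K) (hA : ∀ I, IsCylinder I (A I)) :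
    reduced l I (evolve ε δ A I) ≤ reduced l I (A I) + ∑ j ∈ I,
      growthConst β * ENNReal.ofReal (ε ^ 2 * δ * K) * reduced l' (I.erase j) (A (I.erase j)) :=
  (measure_union_le _ _).trans (add_le_add (reduced_stay_le hε hε1 l (hA I))
    ((measure_biUnion_finset_le _ _).trans (Finset.sum_le_sum fun _ hj =>
      sum_reduced_join_le hε hε1 hδ hβ hl hll hj hK (hA _))))

/-- The factor N of the choice of the new particle is cancelled by ε² of the tube, as ε²N = 1 in the
Boltzmann-Grad scaling. -/
lemma total_evolve_le {ε δ l l' β : ℝ} {K n : ℕ} (hε : 0 < ε) (hε1 : ε ≤ 1)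
    (hN : ε ^ 2 * (N : ℝ) = 1) (hδ : 0 < δ) (hβ : 0 < β) (hl : β / 4 ≤ l)
    (hll : l = l' + β / (4 * K)) (hK : n + 1 ≤ K) {A : Finset (Fin N) → Set (Config N)}
    (hA : ∀ I, IsCylinder I (A I)) :
    total l (n + 1) (evolve ε δ A) ≤ total l (n + 1) A +
      growthConst β * ENNReal.ofReal (δ * K) * total l' n A := by
  have h1 : total l (n + 1) (evolve ε δ A) ≤ total l (n + 1) A +
      ∑ I ∈ Finset.powersetCard (n + 1) Finset.univ, ∑ j ∈ I, growthConst β *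
        ENNReal.ofReal (ε ^ 2 * δ * K) * reduced l' (I.erase j) (A (I.erase j)) := by
    rw [total, total, ← Finset.sum_add_distrib]
    refine Finset.sum_le_sum fun I hI => reduced_evolve_le hε hε1 hδ hβ hl hll ?_ hA
    rw [(Finset.mem_powersetCard.1 hI).2]
    exact hK
  refine h1.trans (add_le_add le_rfl ?_)
  simp_rw [← Finset.mul_sum]
  refine (mul_le_mul_right (sum_erase_le (fun I => reduced l' I (A I)) n) _).trans ?_
  rw [← mul_assoc, total, mul_assoc (growthConst β)]
  refine mul_le_mul_left (mul_le_mul_right (le_of_eq ?_) _) _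
  rw [← ENNReal.ofReal_natCast, ← ENNReal.ofReal_mul (by positivity)]
  congr 1
  linear_combination (δ * K) * hN

/-- The inverse temperature parameters used when `n` particles out of `K` have been created. -/
def level (β : ℝ) (K n : ℕ) : ℝ := β / 2 - (K - n) * (β / (4 * K))

lemma level_self (β : ℝ) (K : ℕ) : level β K K = β / 2 := by simp [level]

lemma level_succ (β : ℝ) (K n : ℕ) : level β K (n + 1) = level β K n + β / (4 * K) := by
  simp only [level]; push_cast; ring

lemma le_level {β : ℝ} (hβ : 0 < β) {K n : ℕ} (hK : 0 < K) : β / 4 ≤ level β K n := by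
  have hK' : (0 : ℝ) < K := by exact_mod_cast hK
  have h1 : (K - n : ℝ) * (β / (4 * K)) ≤ K * (β / (4 * K)) := by
    have : (0 : ℝ) ≤ n := Nat.cast_nonneg n
    gcongr
    linarith
  have h2 : (K : ℝ) * (β / (4 * K)) = β / 4 := by field_simp
  simp only [level]
  linarith

lemma isCylinder_iterate {ε δ : ℝ} {A : Finset (Fin N) → Set (Config N)}
    (hA : ∀ I, IsCylinder I (A I)) (j : ℕ) (I : Finset (Fin N)) :
    IsCylinder I ((evolve ε δ)^[j] A I) := by
  induction j generalizing I with
  | zero => exact hA I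
  | succ j ih => rw [Function.iterate_succ_apply']; exact isCylinder_evolve ih I

lemma evolve_eq_empty {ε δ : ℝ} {A : Finset (Fin N) → Set (Config N)} {n : ℕ}
    (hA : ∀ I, I.card < n → A I = ∅) {I : Finset (Fin N)} (hI : I.card < n) :
    evolve ε δ A I = ∅ := by
  have h1 : ∀ j, A (I.erase j) = ∅ := fun j =>
    hA _ ((Finset.card_le_card (Finset.erase_subset j I)).trans_lt hI)
  simp [evolve, stay, join, hA I hI, h1]

lemma iterate_eq_empty {ε δ : ℝ} {A : Finset (Fin N) → Set (Config N)} {n : ℕ}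
    (hA : ∀ I, I.card < n → A I = ∅) (j : ℕ) (I : Finset (Fin N)) (hI : I.card < n) :
    (evolve ε δ)^[j] A I = ∅ := by
  induction j generalizing I with
  | zero => exact hA I hI
  | succ j ih => rw [Function.iterate_succ_apply']; exact evolve_eq_empty ih hI

lemma total_eq_zero {A : Finset (Fin N) → Set (Config N)} {l : ℝ} {n : ℕ}
    (h : ∀ I, I.card = n → A I = ∅) : total l n A = 0 := by
  refine Finset.sum_eq_zero fun I hI => ?_
  rw [h I (Finset.mem_powersetCard.1 hI).2, measure_empty]

/-- A step either keeps n+i or raises n+i-1 to n+i at cost GδK, G being `growthConst β`, so the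
coefficients satisfy Pascal's recursion. The level rises with the size, as required by the loss of
weight at each creation. -/
lemma total_iterate_le {ε δ β : ℝ} {K n i : ℕ} (hε : 0 < ε) (hε1 : ε ≤ 1)
    (hN : ε ^ 2 * (N : ℝ) = 1) (hδ : 0 < δ) (hβ : 0 < β) (hn : 0 < n) (hK : n + i ≤ K)
    {A : Finset (Fin N) → Set (Config N)} (hA : ∀ I, IsCylinder I (A I))
    (hcard : ∀ I, I.card ≠ n → A I = ∅) (j : ℕ) :
    total (level β K (n + i)) (n + i) ((evolve ε δ)^[j] A) ≤
      j.choose i * (growthConst β * ENNReal.ofReal (δ * K)) ^ i * total (level β K n) n A := by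
  have hlt : ∀ I : Finset (Fin N), I.card < n → A I = ∅ := fun I hI => hcard I hI.ne
  induction j generalizing i with
  | zero =>
    rcases Nat.eq_zero_or_pos i with rfl | hi
    · simp
    · rw [Function.iterate_zero, id, total_eq_zero fun I hI => hcard I (by omega)]
      exact zero_le
  | succ j ih =>
    rw [Function.iterate_succ_apply']
    have hKpos : 0 < K := by omega
    rcases i with _ | i
    -- Without creation there is no gain term: the family is empty on groups smaller than n and
    -- remains so.
    · obtain ⟨n', rfl⟩ := Nat.exists_eq_succ_of_ne_zero hn.ne'
      refine (total_evolve_le hε hε1 hN hδ hβ (le_level hβ hKpos) (level_succ β K n') (by omega)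
        (isCylinder_iterate hA j)).trans ?_
      rw [total_eq_zero (n := n') (fun I hI => iterate_eq_empty hlt j I (by omega)), mul_zero,
        add_zero]
      simpa using ih hK
    · refine (total_evolve_le hε hε1 hN hδ hβ (le_level hβ hKpos) (level_succ β K (n + i)) hK
        (isCylinder_iterate hA j)).trans ?_
      refine (add_le_add (ih hK) (mul_le_mul_right (ih (i := i) (by omega)) _)).trans
        (le_of_eq ?_)
      rw [Nat.choose_succ_succ]
      push_cast
      ring

/-- The family of events concentrated on the group `{p}`. -/
def rootFamily (p : Fin N) (I : Finset (Fin N)) : Set (Config N) :=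
  if I = {p} then Set.univ else ∅

/-- Restriction of a family of events to the groups of `n` particles. -/
def restrictCard (n : ℕ) (A : Finset (Fin N) → Set (Config N)) (I : Finset (Fin N)) :
    Set (Config N) :=
  if I.card = n then A I else ∅

lemma isCylinder_rootFamily (p : Fin N) (I : Finset (Fin N)) : IsCylinder I (rootFamily p I) := by
  unfold rootFamily
  split_ifs
  · exact ⟨MeasurableSet.univ, fun _ _ _ _ => trivial⟩
  · exact IsCylinder.empty

lemma isCylinder_restrictCard {A : Finset (Fin N) → Set (Config N)}
    (hA : ∀ I, IsCylinder I (A I)) (n : ℕ) (I : Finset (Fin N)) :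
    IsCylinder I (restrictCard n A I) := by
  unfold restrictCard
  split_ifs
  · exact hA I
  · exact IsCylinder.empty

lemma total_restrictCard (l : ℝ) (n : ℕ) (A : Finset (Fin N) → Set (Config N)) :
    total l n (restrictCard n A) = total l n A :=
  Finset.sum_congr rfl fun I hI => by
    rw [restrictCard, if_pos (Finset.mem_powersetCard.1 hI).2]

/-- A bound of the unnormalized one-particle partition function. -/
def rootConst (β : ℝ) : ℝ≥0∞ := volume (Set.univ : Set Torus3) * gaussMoment (β / 4)

lemma rootConst_lt_top {β : ℝ} (hβ : 0 < β) : rootConst β < ∞ :=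
  ENNReal.mul_lt_top (measure_lt_top _ _) (gaussMoment_lt_top (by positivity))

lemma lintegral_state_snd (f : E3 → ℝ≥0∞) (hf : Measurable f) (T : Set Torus3)
    (hT : MeasurableSet T) :
    ∫⁻ z : State, T.indicator 1 z.1 * f z.2 = volume T * ∫⁻ v, f v := by
  rw [Measure.volume_eq_prod, lintegral_prod_mul (measurable_one.indicator hT).aemeasurable
    hf.aemeasurable, lintegral_indicator_one hT]

lemma total_rootFamily_le {β l : ℝ} (hl : β / 4 ≤ l) (p : Fin N) :
    total l 1 (rootFamily p) ≤ rootConst β := by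
  have h1 : total l 1 (rootFamily p) = reduced l {p} Set.univ := by
    rw [total, Finset.sum_eq_single {p}]
    · simp [rootFamily]
    · intro I _ hI
      simp [rootFamily, hI]
    · intro h
      exact absurd (Finset.mem_powersetCard.2 ⟨Finset.subset_univ _, Finset.card_singleton p⟩) h
  rw [h1, reduced_apply _ _ MeasurableSet.univ, lmarginal_singleton]
  simp only [Set.indicator_univ, weight, Finset.prod_singleton, Function.update_self]
  have h2 := lintegral_state_snd (fun v => ENNReal.ofReal (Real.exp (-l * ‖v‖ ^ 2)))
    (by fun_prop) Set.univ MeasurableSet.univ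
  simp only [Set.indicator_univ, Pi.one_apply, one_mul] at h2
  rw [h2, rootConst, gaussMoment]
  refine mul_le_mul_right (lintegral_mono fun v => ENNReal.ofReal_le_ofReal ?_) _
  have h3 : Real.exp (-l * ‖v‖ ^ 2) ≤ Real.exp (-(β / 4) * ‖v‖ ^ 2) :=
    Real.exp_le_exp.2 (by nlinarith [sq_nonneg ‖v‖])
  nlinarith [norm_nonneg v, Real.exp_pos (-(β / 4) * ‖v‖ ^ 2)]

/-- The family of the events that the cluster of `p`, followed backward, has `m + 1` elements after
`J` time steps, and is the given group after `J'` further time steps. -/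
def clusterFamily (ε δ : ℝ) (p : Fin N) (J J' m : ℕ) : Finset (Fin N) → Set (Config N) :=
  (evolve ε δ)^[J'] (restrictCard (m + 1) ((evolve ε δ)^[J] (rootFamily p)))

lemma isCylinder_clusterFamily (ε δ : ℝ) (p : Fin N) (J J' m : ℕ) (I : Finset (Fin N)) :
    IsCylinder I (clusterFamily ε δ p J J' m I) :=
  isCylinder_iterate (isCylinder_restrictCard (isCylinder_iterate (isCylinder_rootFamily p) J) _)
    J' I

/-- Two runs of the iteration are chained: from one to m+1 particles, then to L+1. The same K = L+1
is used in both, so that the level reached at the end is exactly β/2, that of the Gibbs measure. -/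
lemma total_clusterFamily_le {ε δ β : ℝ} (hε : 0 < ε) (hε1 : ε ≤ 1)
    (hN : ε ^ 2 * (N : ℝ) = 1) (hδ : 0 < δ) (hβ : 0 < β) (p : Fin N) (J J' : ℕ) {m L : ℕ}
    (hmL : m ≤ L) :
    total (β / 2) (L + 1) (clusterFamily ε δ p J J' m) ≤
      J'.choose (L - m) * J.choose m * (growthConst β * ENNReal.ofReal (δ * (L + 1 : ℕ))) ^ L *
        rootConst β := by
  have h1 := total_iterate_le (K := L + 1) (n := m + 1) (i := L - m) hε hε1 hN hδ hβ (by omega)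
    (by omega) (isCylinder_restrictCard (isCylinder_iterate (isCylinder_rootFamily p)
      (ε := ε) (δ := δ) J) (m + 1))
    (fun I hI => by rw [restrictCard, if_neg hI]) J'
  have h2 := total_iterate_le (K := L + 1) (n := 1) (i := m) hε hε1 hN hδ hβ (by omega)
    (by omega) (isCylinder_rootFamily p)
    (fun I hI => by rw [rootFamily, if_neg (by rintro rfl; simp at hI)]) J
  rw [total_restrictCard] at h1
  rw [show m + 1 + (L - m) = L + 1 by omega, level_self] at h1
  rw [add_comm 1 m] at h2
  refine h1.trans ((mul_le_mul_right (h2.trans (mul_le_mul_right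
    (total_rootFamily_le (le_level hβ (by omega)) p) _)) _).trans (le_of_eq ?_))
  conv_rhs => rw [show L = (L - m) + m by omega, pow_add]
  rw [show L - m + m - m = L - m by omega, show L - m + m = L by omega]
  ring

end Iteration

/-! ### From groups to the canonical Gibbs measure -/

section Gibbs

variable {N : ℕ}

/-- The configurations in which the particles in `J` do not overlap. -/
def apartSet (ε : ℝ) (J : Finset (Fin N)) : Set (Config N) :=
  {Y | ∀ i ∈ J, ∀ j ∈ J, i ≠ j → ε ≤ torusDist (Y i).1 (Y j).1}

lemma continuous_position (p : Fin N) : Continuous fun Y : Config N => (Y p).1 :=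
  continuous_fst.comp (continuous_apply p)

lemma isCylinder_apartSet (ε : ℝ) (J : Finset (Fin N)) : IsCylinder J (apartSet ε J) := by
  constructor
  · have hc : IsClosed (apartSet ε J) := by
      simp only [apartSet, Set.ofPred_forall]
      refine isClosed_iInter fun i => isClosed_iInter fun _ => isClosed_iInter fun j =>
        isClosed_iInter fun _ => isClosed_iInter fun _ => ?_
      exact isClosed_le continuous_const
        (continuous_torusDist (continuous_position i) (continuous_position j))
    exact hc.measurableSet
  · intro Y Y' h hY i hi j hj hij
    rw [← h i hi, ← h j hj]
    exact hY i hi j hj hij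

lemma measurableSet_phaseSpace (N : ℕ) (ε : ℝ) : MeasurableSet (phaseSpace N ε) := by
  have h : phaseSpace N ε = ⋂ i, ⋂ j, ⋂ (_ : i ≠ j),
      {Z : Config N | ε < torusDist (Z i).1 (Z j).1} := by
    ext Z; simp [phaseSpace]
  rw [h]
  refine MeasurableSet.iInter fun i => MeasurableSet.iInter fun j => MeasurableSet.iInter fun _ => ?_
  exact (isOpen_lt continuous_const
    (continuous_torusDist (continuous_position i) (continuous_position j))).measurableSet

lemma reduced_univ_apply (l : ℝ) {S : Set (Config N)} (hS : MeasurableSet S) :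
    reduced l Finset.univ S = ∫⁻ Y, S.indicator (weight l Finset.univ) Y := by
  rw [reduced_apply _ _ hS, lmarginal_univ]
  rfl

lemma gibbsWeight_apply (ε β : ℝ) {S : Set (Config N)} (hS : MeasurableSet S) :
    gibbsWeight N ε β S = reduced (β / 2) Finset.univ (S ∩ phaseSpace N ε) := by
  rw [reduced_univ_apply _ (hS.inter (measurableSet_phaseSpace N ε)), gibbsWeight,
    withDensity_apply _ hS, Measure.restrict_restrict hS,
    lintegral_indicator (hS.inter (measurableSet_phaseSpace N ε))]
  refine lintegral_congr fun Y => ?_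
  rw [weight, ENNReal.ofReal_prod_of_nonneg fun i _ => (Real.exp_pos _).le]

lemma lmarginal_const_mul (c : ℝ≥0∞) (I : Finset (Fin N)) {f : Config N → ℝ≥0∞}
    (hf : Measurable f) (x : Config N) :
    lmarginal (fun _ => volume) I (fun Y => c * f Y) x =
      c * lmarginal (fun _ => volume) I f x := by
  have h : Measurable fun z : I → State => f (Function.updateFinset x I z) :=
    hf.comp measurable_updateFinset
  simp only [lmarginal]
  rw [lintegral_const_mul _ h]

/-- Exclusion inside I, and between I and its complement, is dropped; only that within the
complement is kept, and the integral factorizes. -/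
lemma reduced_inter_apartSet_le (ε l : ℝ) (I : Finset (Fin N)) {S : Set (Config N)}
    (hS : IsCylinder I S) :
    reduced l Finset.univ (S ∩ apartSet ε Finset.univ) ≤
      reduced l I S * reduced l Iᶜ (apartSet ε Iᶜ) := by
  have hm := hS.1.inter (isCylinder_apartSet ε (Finset.univ : Finset (Fin N))).1
  have hS' := (measurable_weight l I).indicator hS.1
  have hA' := (measurable_weight l Iᶜ).indicator (isCylinder_apartSet ε Iᶜ).1
  rw [reduced_apply _ _ hm, reduced_apply _ _ hS.1, reduced_apply _ _ (isCylinder_apartSet ε Iᶜ).1,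
    ← Finset.union_compl I, lmarginal_union _ _ ((measurable_weight l _).indicator ?_)
      disjoint_compl_right]
  · have h1 : ∀ Y, lmarginal (fun _ => volume) Iᶜ ((S ∩ apartSet ε (I ∪ Iᶜ)).indicator
        (weight l (I ∪ Iᶜ))) Y ≤ lmarginal (fun _ => volume) Iᶜ
          ((apartSet ε Iᶜ).indicator (weight l Iᶜ)) 0 * S.indicator (weight l I) Y := by
      intro Y
      rw [lmarginal_eq_of_dependsOn ((isCylinder_apartSet ε Iᶜ).dependsOn l) 0 Y]
      rw [mul_comm (lmarginal _ _ _ _), ← lmarginal_const_mul _ _ hA']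
      refine lintegral_mono fun z => ?_
      set Y' := Function.updateFinset Y Iᶜ z with hY'
      have e1 : ∀ i ∈ I, Y' i = Y i := fun i hi => by
        have : i ∉ Iᶜ := by simpa using hi
        simp [hY', Function.updateFinset, hi]
      by_cases hmem : Y' ∈ S ∩ apartSet ε (I ∪ Iᶜ)
      · have e2 : Y ∈ S := (hS.mem_iff e1).1 hmem.1
        have e3 : Y' ∈ apartSet ε Iᶜ := fun i hi j hj =>
          hmem.2 i (Finset.mem_union_right _ hi) j (Finset.mem_union_right _ hj)
        rw [Set.indicator_of_mem hmem, Set.indicator_of_mem e2]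
        simp only
        rw [Set.indicator_of_mem e3, ← weight_congr l e1,
          weight, Finset.prod_union disjoint_compl_right]
        exact le_rfl
      · rw [Set.indicator_of_notMem hmem]
        exact zero_le
    exact (lmarginal_mono h1 0).trans
      ((lmarginal_const_mul _ I hS' 0).trans (mul_comm _ _)).le
  · rw [Finset.union_compl]; exact hm

lemma volume_torus_univ : volume (Set.univ : Set Torus3) = ENNReal.ofReal (2 * Real.pi) ^ 3 := by
  rw [← Set.pi_univ Set.univ, volume_pi_pi]
  simp [AddCircle.measure_univ]

/-- The ball lies in a product of three arcs of length at most 2ε. -/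
lemma volume_torusDist_lt_le {ε : ℝ} (y : Torus3) :
    volume {x : Torus3 | torusDist y x < ε} ≤ ENNReal.ofReal (2 * ε) ^ 3 := by
  have h1 : {x : Torus3 | torusDist y x < ε} ⊆ Set.univ.pi fun a => Metric.closedBall (y a) ε := by
    intro x hx a _
    rw [Metric.mem_closedBall, dist_comm, dist_eq_norm]
    refine le_trans ?_ (le_of_lt hx)
    refine Real.le_sqrt_of_sq_le ?_
    exact Finset.single_le_sum (f := fun a => ‖y a - x a‖ ^ 2) (fun _ _ => sq_nonneg _)
      (Finset.mem_univ a)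
  refine (measure_mono h1).trans ?_
  rw [volume_pi_pi]
  calc ∏ a, volume (Metric.closedBall (y a) ε) ≤ ∏ _a : Fin 3, ENNReal.ofReal (2 * ε) :=
        Finset.prod_le_prod' fun a _ => by
          rw [AddCircle.volume_closedBall]
          exact ENNReal.ofReal_le_ofReal (min_le_right _ _)
    _ = _ := by simp

/-- There is room for one more particle. -/
lemma one_le_volume_free {ε : ℝ} (hε : 0 < ε) (hε1 : ε ≤ 1) (hN : ε ^ 2 * (N : ℝ) = 1)
    (J : Finset (Fin N)) (Y : Config N) :
    1 ≤ volume {x : Torus3 | ∀ i ∈ J, ε ≤ torusDist (Y i).1 x} := by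
  set F := {x : Torus3 | ∀ i ∈ J, ε ≤ torusDist (Y i).1 x}
  have h1 : volume (Set.univ : Set Torus3) ≤ volume F +
      ∑ i ∈ J, volume {x : Torus3 | torusDist (Y i).1 x < ε} := by
    refine le_trans (measure_mono fun x _ => ?_)
      ((measure_union_le F (⋃ i ∈ J, {x : Torus3 | torusDist (Y i).1 x < ε})).trans
        (add_le_add le_rfl (measure_biUnion_finset_le _ _)))
    by_cases hx : x ∈ F
    · exact Or.inl hx
    · right
      simp only [F, Set.mem_ofPred_eq, not_forall, not_le] at hx
      obtain ⟨i, hi, hlt⟩ := hx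
      exact Set.mem_biUnion hi hlt
  have h2 : ∑ i ∈ J, volume {x : Torus3 | torusDist (Y i).1 x < ε} ≤ 8 := by
    calc _ ≤ ∑ _i ∈ J, ENNReal.ofReal (2 * ε) ^ 3 :=
          Finset.sum_le_sum fun i _ => volume_torusDist_lt_le _
      _ ≤ ∑ _i : Fin N, ENNReal.ofReal (2 * ε) ^ 3 :=
          Finset.sum_le_sum_of_subset (Finset.subset_univ J)
      _ = ENNReal.ofReal (N * (2 * ε) ^ 3) := by
          rw [ENNReal.ofReal_mul (Nat.cast_nonneg N), ENNReal.ofReal_pow (by positivity),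
            Finset.sum_const, nsmul_eq_mul, ENNReal.ofReal_natCast, Finset.card_univ,
            Fintype.card_fin]
      _ ≤ ENNReal.ofReal 8 := by
          apply ENNReal.ofReal_le_ofReal
          -- The excluded volume is at most 8ε ≤ 8, against a torus of volume (2π)³ ≥ 9.
          have : N * (2 * ε) ^ 3 = 8 * ε * (ε ^ 2 * N) := by ring
          rw [this, hN]; linarith
      _ = 8 := by norm_num
  have h3 : (9 : ℝ≥0∞) ≤ volume (Set.univ : Set Torus3) := by
    rw [volume_torus_univ, ← ENNReal.ofReal_pow (by positivity)]
    have : (9 : ℝ) ≤ (2 * Real.pi) ^ 3 := by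
      calc (9 : ℝ) ≤ (2 * 3) ^ 3 := by norm_num
        _ ≤ _ := by gcongr; exact Real.pi_gt_three.le
    calc (9 : ℝ≥0∞) = ENNReal.ofReal 9 := by norm_num
      _ ≤ _ := ENNReal.ofReal_le_ofReal this
  have h4 : (9 : ℝ≥0∞) ≤ volume F + 8 := h3.trans (h1.trans (add_le_add le_rfl h2))
  have h5 : (1 : ℝ≥0∞) + 8 ≤ volume F + 8 := by
    calc (1 : ℝ≥0∞) + 8 = 9 := by norm_num
      _ ≤ _ := h4
  exact (ENNReal.add_le_add_iff_right (by norm_num)).1 h5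

/-- The Gaussian integral over the velocities. -/
def gaussInt (l : ℝ) : ℝ≥0∞ := ∫⁻ v : E3, ENNReal.ofReal (Real.exp (-l * ‖v‖ ^ 2))

lemma gaussInt_pos (l : ℝ) : 0 < gaussInt l := by
  rw [gaussInt, lintegral_pos_iff_support (by fun_prop)]
  have : Function.support (fun v : E3 => ENNReal.ofReal (Real.exp (-l * ‖v‖ ^ 2))) = Set.univ := by
    ext v
    simp [Real.exp_pos]
  rw [this]
  simp

/-- Adding one sphere multiplies the partition function by at least g, because the free volume left
by the others is at least 1. -/
lemma gaussInt_mul_reduced_le {ε : ℝ} (hε : 0 < ε) (hε1 : ε ≤ 1) (hN : ε ^ 2 * (N : ℝ) = 1)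
    (l : ℝ) {J : Finset (Fin N)} {j : Fin N} (hj : j ∉ J) :
    gaussInt l * reduced l J (apartSet ε J) ≤
      reduced l (insert j J) (apartSet ε (insert j J)) := by
  have hA := isCylinder_apartSet ε J
  have hA' := isCylinder_apartSet ε (insert j J)
  rw [reduced_apply _ _ hA.1, reduced_apply _ _ hA'.1,
    lmarginal_insert' _ ((measurable_weight l _).indicator hA'.1) hj]
  rw [← lmarginal_const_mul _ _ ((measurable_weight l J).indicator hA.1)]
  refine lmarginal_mono (fun Y => ?_) 0
  by_cases hY : Y ∈ apartSet ε J
  · rw [Set.indicator_of_mem hY]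
    set F := {x : Torus3 | ∀ i ∈ J, ε ≤ torusDist (Y i).1 x} with hF
    have hFm : MeasurableSet F := by
      have hc : IsClosed F := by
        simp only [hF, Set.ofPred_forall]
        exact isClosed_iInter fun i => isClosed_iInter fun _ =>
          isClosed_le continuous_const (continuous_torusDist continuous_const continuous_id)
      exact hc.measurableSet
    have h1 : ∀ z : State, weight l J Y * (F.indicator 1 z.1 *
        ENNReal.ofReal (Real.exp (-l * ‖z.2‖ ^ 2))) ≤
        (apartSet ε (insert j J)).indicator (weight l (insert j J)) (Function.update Y j z) := by
      intro z
      by_cases hz : z.1 ∈ F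
      · have e1 : ∀ i ∈ J, Function.update Y j z i = Y i := fun i hi => by
          have : i ≠ j := by rintro rfl; exact hj hi
          simp [this]
        have hmem : Function.update Y j z ∈ apartSet ε (insert j J) := by
          intro i hi k hk hik
          rcases Finset.mem_insert.1 hi with rfl | hi
          · rcases Finset.mem_insert.1 hk with rfl | hk
            · exact absurd rfl hik
            · rw [e1 k hk, Function.update_self, torusDist_comm]
              exact hz k hk
          · rcases Finset.mem_insert.1 hk with hkj | hk
            · rw [e1 i hi, hkj, Function.update_self]
              exact hz i hi
            · rw [e1 i hi, e1 k hk]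
              exact hY i hi k hk hik
        rw [Set.indicator_of_mem hmem, Set.indicator_of_mem hz, weight,
          weight, Finset.prod_insert hj, Function.update_self, Pi.one_apply, one_mul, mul_comm]
        refine mul_le_mul_right (le_of_eq (Finset.prod_congr rfl fun i hi => ?_)) _
        rw [e1 i hi]
      · rw [Set.indicator_of_notMem hz]
        simp
    refine le_trans ?_ (lintegral_mono h1)
    have hgm : Measurable fun v : E3 => ENNReal.ofReal (Real.exp (-l * ‖v‖ ^ 2)) := by fun_prop
    have hprod : Measurable fun z : State => F.indicator (1 : Torus3 → ℝ≥0∞) z.1 *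
        ENNReal.ofReal (Real.exp (-l * ‖z.2‖ ^ 2)) :=
      ((measurable_one.indicator hFm).comp measurable_fst).mul (hgm.comp measurable_snd)
    rw [lintegral_const_mul _ hprod, lintegral_state_snd _ hgm F hFm, mul_comm]
    refine mul_le_mul_right ?_ _
    calc gaussInt l = 1 * gaussInt l := (one_mul _).symm
      _ ≤ _ := mul_le_mul_left (one_le_volume_free hε hε1 hN J Y) _
  · rw [Set.indicator_of_notMem hY, mul_zero]
    exact zero_le

/-- The particles of I are put back one at a time, each gaining a factor of at least g. -/
lemma gaussInt_pow_mul_reduced_le {ε : ℝ} (hε : 0 < ε) (hε1 : ε ≤ 1) (hN : ε ^ 2 * (N : ℝ) = 1)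
    (l : ℝ) (I : Finset (Fin N)) :
    gaussInt l ^ I.card * reduced l Iᶜ (apartSet ε Iᶜ) ≤
      reduced l Finset.univ (apartSet ε (Finset.univ : Finset (Fin N))) := by
  induction I using Finset.induction_on with
  | empty => simp [Finset.compl_empty]
  | insert j I hj ih =>
    refine le_trans ?_ ih
    have hj' : j ∉ (insert j I)ᶜ := by simp
    have h1 : insert j (insert j I)ᶜ = Iᶜ := by
      ext i
      by_cases h : i = j
      · subst h; simp [hj]
      · simp [h]
    have h2 := gaussInt_mul_reduced_le hε hε1 hN l hj'
    rw [h1] at h2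
    rw [Finset.card_insert_of_notMem hj, pow_succ, mul_assoc]
    exact mul_le_mul_right h2 _

lemma torusDist_proj_zero {u : E3} (hu : u ∈ cube) : torusDist (proj u) 0 = ‖u‖ := by
  rw [torusDist, EuclideanSpace.norm_eq]
  congr 1
  refine Finset.sum_congr rfl fun a _ => ?_
  congr 1
  rw [Pi.zero_apply, sub_zero, proj, Real.norm_eq_abs]
  refine (AddCircle.norm_coe_eq_abs_iff _ Real.two_pi_pos.ne').2 ?_
  rw [abs_of_pos Real.two_pi_pos, abs_le]
  have := hu a
  constructor <;> linarith [this.1, this.2]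

lemma torusDist_sub (x y z : Torus3) : torusDist (x - z) (y - z) = torusDist x y := by
  simp [torusDist]

lemma volume_torusDist_eq {ε : ℝ} (y : Torus3) :
    volume {x : Torus3 | torusDist x y = ε} = 0 := by
  have hm : ∀ y : Torus3, MeasurableSet {x : Torus3 | torusDist x y = ε} := fun y =>
    (isClosed_eq (continuous_torusDist continuous_id continuous_const)
      continuous_const).measurableSet
  have h1 : volume {x : Torus3 | torusDist x 0 = ε} = 0 := by
    rw [← measurePreserving_proj.measure_preimage (hm 0).nullMeasurableSet,
      Measure.restrict_apply' measurableSet_cube]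
    refine measure_mono_null ?_ (Measure.addHaar_sphere volume (0 : E3) ε)
    rintro u ⟨hu1, hu2⟩
    rw [mem_sphere_zero_iff_norm, ← torusDist_proj_zero hu2]
    exact hu1
  rw [← h1, ← measure_preimage_add_right volume y {x : Torus3 | torusDist x y = ε}]
  congr 1
  ext x
  have h2 : torusDist (x + y) y = torusDist x 0 := by
    rw [← torusDist_sub _ _ y, add_sub_cancel_right, sub_self]
  simp only [Set.mem_preimage, Set.mem_ofPred_eq, h2]

lemma volume_contact_eq_zero {ε : ℝ} {i j : Fin N} (hij : i ≠ j) :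
    volume {Y : Config N | torusDist (Y i).1 (Y j).1 = ε} = 0 := by
  have hm : MeasurableSet {Y : Config N | torusDist (Y i).1 (Y j).1 = ε} :=
    (isClosed_eq (continuous_torusDist (continuous_position i) (continuous_position j))
      continuous_const).measurableSet
  rw [← lintegral_indicator_one hm, volume_pi]
  have h0 : ∫⁻ Y : Config N, (0 : ℝ≥0∞) ∂(Measure.pi fun _ => volume) = 0 := by simp
  rw [← h0]
  refine lintegral_eq_of_lmarginal_eq {i} (measurable_one.indicator hm) measurable_const ?_
  rw [lmarginal_singleton, lmarginal_singleton]
  ext Y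
  rw [lintegral_zero]
  have hs : MeasurableSet {x : Torus3 | torusDist x (Y j).1 = ε} :=
    (isClosed_eq (continuous_torusDist continuous_id continuous_const)
      continuous_const).measurableSet
  have h1 : ∀ z : State, {Y : Config N | torusDist (Y i).1 (Y j).1 = ε}.indicator 1
      (Function.update Y i z) = {x : Torus3 | torusDist x (Y j).1 = ε}.indicator 1 z.1 *
        (fun _ : E3 => (1 : ℝ≥0∞)) z.2 := by
    intro z
    rw [mul_one]
    simp only [Set.indicator, Set.mem_ofPred_eq, Function.update_self,
      Function.update_of_ne hij.symm, Pi.one_apply]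
  simp_rw [h1]
  rw [lintegral_state_snd _ measurable_const _ hs, volume_torusDist_eq, zero_mul]

/-- Contacts are allowed in `apartSet`, since an intermediate time may be a collision time, but not
in the phase space. The two differ by a null set. -/
lemma reduced_apartSet_le_gibbsWeight (ε β : ℝ) :
    reduced (β / 2) Finset.univ (apartSet ε (Finset.univ : Finset (Fin N))) ≤
      gibbsWeight N ε β Set.univ := by
  have hA := (isCylinder_apartSet ε (Finset.univ : Finset (Fin N))).1
  rw [gibbsWeight_apply _ _ MeasurableSet.univ, Set.univ_inter, reduced_univ_apply _ hA,
    reduced_univ_apply _ (measurableSet_phaseSpace N ε)]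
  refine lintegral_mono_ae ?_
  have h1 : ∀ᵐ Y : Config N, ∀ i j, i ≠ j → torusDist (Y i).1 (Y j).1 ≠ ε := by
    rw [ae_all_iff]; intro i
    rw [ae_all_iff]; intro j
    by_cases hij : i = j
    · exact Filter.Eventually.of_forall fun _ h => absurd hij h
    · rw [ae_iff]
      refine measure_mono_null (fun Y hY => ?_) (volume_contact_eq_zero (ε := ε) hij)
      simpa [hij] using hY
  filter_upwards [h1] with Y hY
  by_cases hmem : Y ∈ apartSet ε Finset.univ
  · have : Y ∈ phaseSpace N ε := fun i j hij =>
      lt_of_le_of_ne (hmem i (Finset.mem_univ i) j (Finset.mem_univ j) hij) (hY i j hij).symm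
    rw [Set.indicator_of_mem hmem, Set.indicator_of_mem this]
  · rw [Set.indicator_of_notMem hmem]
    exact zero_le

lemma isCylinder_iterate_stay {ε δ : ℝ} {I : Finset (Fin N)} {S : Set (Config N)}
    (hS : IsCylinder I S) (J : ℕ) : IsCylinder I ((stay ε δ I)^[J] S) := by
  induction J with
  | zero => exact hS
  | succ J ih => rw [Function.iterate_succ_apply']; exact isCylinder_stay ih

lemma reduced_iterate_stay_le {ε δ : ℝ} (hε : 0 < ε) (hε1 : ε ≤ 1) (l : ℝ) {I : Finset (Fin N)}
    {S : Set (Config N)} (hS : IsCylinder I S) (J : ℕ) :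
    reduced l I ((stay ε δ I)^[J] S) ≤ reduced l I S := by
  induction J with
  | zero => exact le_rfl
  | succ J ih =>
    rw [Function.iterate_succ_apply']
    exact (reduced_stay_le hε hε1 l (isCylinder_iterate_stay hS J)).trans ih

/-- The initial configurations leading in `J` time steps, without overlap at the final time, to an
event of the family for one of the groups of `n` particles. -/
def pastEvent (ε δ : ℝ) (J n : ℕ) (A : Finset (Fin N) → Set (Config N)) : Set (Config N) :=
  (stay ε δ Finset.univ)^[J]
    ((⋃ I ∈ Finset.powersetCard n Finset.univ, A I) ∩ apartSet ε Finset.univ)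

/-- The invariance of the Gibbs measure and the bound of its marginals. -/
lemma gibbs_pastEvent_le {ε δ β : ℝ} (hε : 0 < ε) (hε1 : ε ≤ 1) (hN : ε ^ 2 * (N : ℝ) = 1)
    (hβ : 0 < β) (J n : ℕ) {A : Finset (Fin N) → Set (Config N)}
    (hA : ∀ I, IsCylinder I (A I)) :
    gibbs N ε β (pastEvent ε δ J n A) ≤ (gaussInt (β / 2))⁻¹ ^ n * total (β / 2) n A := by
  set g := gaussInt (β / 2) with hg
  have hg0 : g ≠ 0 := (gaussInt_pos _).ne'
  have hgtop : g ≠ ∞ := (lintegral_gauss_lt_top (half_pos hβ)).ne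
  set Q := gibbsWeight N ε β Set.univ with hQ
  have hU : IsCylinder (Finset.univ : Finset (Fin N))
      ((⋃ I ∈ Finset.powersetCard n Finset.univ, A I) ∩ apartSet ε Finset.univ) :=
    (isCylinder_biUnion fun I _ => (hA I).mono (Finset.subset_univ I)).inter
      (isCylinder_apartSet ε _)
  have h1 : gibbsWeight N ε β (pastEvent ε δ J n A) ≤ Q * (g⁻¹ ^ n * total (β / 2) n A) := by
    calc gibbsWeight N ε β (pastEvent ε δ J n A)
        ≤ reduced (β / 2) Finset.univ (pastEvent ε δ J n A) := by
          rw [gibbsWeight_apply _ _ (show MeasurableSet (pastEvent ε δ J n A) from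
            (isCylinder_iterate_stay hU J).1)]
          exact measure_mono Set.inter_subset_left
      _ ≤ reduced (β / 2) Finset.univ
          ((⋃ I ∈ Finset.powersetCard n Finset.univ, A I) ∩ apartSet ε Finset.univ) :=
          reduced_iterate_stay_le hε hε1 _ hU J
      _ ≤ ∑ I ∈ Finset.powersetCard n Finset.univ,
          reduced (β / 2) Finset.univ (A I ∩ apartSet ε Finset.univ) := by
          rw [Set.iUnion₂_inter]
          exact measure_biUnion_finset_le _ _
      _ ≤ ∑ I ∈ Finset.powersetCard n Finset.univ, reduced (β / 2) I (A I) * (g⁻¹ ^ n * Q) := by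
          refine Finset.sum_le_sum fun I hI => (reduced_inter_apartSet_le ε _ I (hA I)).trans ?_
          refine mul_le_mul_right ?_ _
          have h2 := (gaussInt_pow_mul_reduced_le hε hε1 hN (β / 2) I).trans
            (reduced_apartSet_le_gibbsWeight ε β)
          rw [(Finset.mem_powersetCard.1 hI).2] at h2
          rw [← ENNReal.inv_pow, mul_comm (g ^ n)⁻¹, ← div_eq_mul_inv,
            ENNReal.le_div_iff_mul_le (Or.inl (pow_ne_zero n hg0))
              (Or.inl (ENNReal.pow_ne_top hgtop))]
          exact (mul_comm _ _).le.trans h2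
      _ = _ := by
          rw [← Finset.sum_mul, total]
          ring
  rw [gibbs, Measure.smul_apply, smul_eq_mul]
  calc Q⁻¹ * gibbsWeight N ε β (pastEvent ε δ J n A)
      ≤ Q⁻¹ * (Q * (g⁻¹ ^ n * total (β / 2) n A)) := mul_le_mul_right h1 _
    _ = (Q⁻¹ * Q) * (g⁻¹ ^ n * total (β / 2) n A) := by ring
    _ ≤ 1 * (g⁻¹ ^ n * total (β / 2) n A) := mul_le_mul_left (ENNReal.inv_mul_le_one Q) _
    _ = _ := one_mul _

end Gibbs

/-! ### The collision rule in terms of the step maps -/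

section CollisionGeometry

variable {N : ℕ}

lemma freeState_freeState (r s : ℝ) (z : State) :
    freeState r (freeState s z) = freeState (s + r) z := by
  simp only [freeState, add_smul, proj_add, add_assoc]

lemma freeState_zero (z : State) : freeState 0 z = z := by
  simp [freeState, proj_zero]

lemma freeFlow_freeFlow (r s : ℝ) (Z : Config N) :
    freeFlow r (freeFlow s Z) = freeFlow (s + r) Z := by
  ext1 i
  rw [freeFlow_apply, freeFlow_apply, freeFlow_apply, freeState_freeState]

lemma freeFlow_zero (Z : Config N) : freeFlow 0 Z = Z := by
  ext1 i
  rw [freeFlow_apply, freeState_zero]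

lemma norm_mk_le_abs (x : ℝ) : ‖(x : AddCircle (2 * Real.pi))‖ ≤ |x| :=
  QuotientAddGroup.norm_mk_le_norm

lemma torusDist_le_norm {x y : Torus3} {u : E3} (h : x - y = proj u) : torusDist x y ≤ ‖u‖ := by
  rw [torusDist, EuclideanSpace.norm_eq]
  refine Real.sqrt_le_sqrt (Finset.sum_le_sum fun a _ => ?_)
  have h1 : x a - y a = ((u a : ℝ) : AddCircle (2 * Real.pi)) := congrFun h a
  rw [h1, Real.norm_eq_abs]
  exact pow_le_pow_left₀ (norm_nonneg _) (norm_mk_le_abs _) 2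

/-- `Y'` results from `Y` by the elastic collision of `i` and `j`. -/
def ElasticPair (ε : ℝ) (Y Y' : Config N) (i j : Fin N) : Prop :=
  i ≠ j ∧ ∃ ω : E3, ‖ω‖ = 1 ∧
    (Y i).1 - (Y j).1 = proj (ε • ω) ∧
    inner ℝ ω ((Y i).2 - (Y j).2) < 0 ∧
    (∀ k l, k ≠ l → torusDist (Y k).1 (Y l).1 ≤ ε → (k = i ∧ l = j) ∨ (k = j ∧ l = i)) ∧
    Y' i = ((Y i).1, (Y i).2 - inner ℝ ω ((Y i).2 - (Y j).2) • ω) ∧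
    Y' j = ((Y j).1, (Y j).2 + inner ℝ ω ((Y i).2 - (Y j).2) • ω) ∧
    ∀ l, l ≠ i → l ≠ j → Y' l = Y l

lemma ElasticPair.symm {ε : ℝ} {Y Y' : Config N} {i j : Fin N} (h : ElasticPair ε Y Y' i j) :
    ElasticPair ε Y Y' j i := by
  obtain ⟨hij, ω, h1, h2, h3, h4, h5, h6, h7⟩ := h
  have e : (inner ℝ (-ω) ((Y j).2 - (Y i).2) : ℝ) = inner ℝ ω ((Y i).2 - (Y j).2) := by
    rw [← neg_sub, inner_neg_neg]
  refine ⟨hij.symm, -ω, by simpa using h1, ?_, by rw [e]; exact h3,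
    fun k l hkl hd => (h4 k l hkl hd).symm, ?_, ?_, fun l hl hl' => h7 l hl' hl⟩
  · rw [smul_neg, proj_neg, ← h2, neg_sub]
  · rw [e, h6, smul_neg, sub_neg_eq_add]
  · rw [e, h5, smul_neg, sub_eq_add_neg]

lemma ElasticPair.position {ε : ℝ} {Y Y' : Config N} {i j : Fin N} (h : ElasticPair ε Y Y' i j)
    (k : Fin N) : (Y' k).1 = (Y k).1 := by
  obtain ⟨hij, ω, h1, h2, h3, h4, h5, h6, h7⟩ := h
  by_cases hi : k = i
  · rw [hi, h5]
  · by_cases hj : k = j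
    · rw [hj, h6]
    · rw [h7 k hi hj]

lemma ElasticPair.eq_of_dist_le {ε : ℝ} {Y Y' : Config N} {i j k l : Fin N}
    (h : ElasticPair ε Y Y' i j) (hkl : k ≠ l) (hd : torusDist (Y' k).1 (Y' l).1 ≤ ε) :
    (k = i ∧ l = j) ∨ (k = j ∧ l = i) := by
  rw [h.position, h.position] at hd
  obtain ⟨hij, ω, h1, h2, h3, h4, h5, h6, h7⟩ := h
  exact h4 k l hkl hd

lemma mem_cube_of_norm_le {ε : ℝ} (hε1 : ε ≤ 1) {u : E3} (hu : ‖u‖ ≤ 2 * ε) : u ∈ cube :=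
  mem_cube_of_norm_lt (by linarith [Real.pi_gt_three])

/-- The outgoing relative velocity. -/
lemma inner_reflect {ω w : E3} (hω : ‖ω‖ = 1) :
    inner ℝ ω (w - (2 * inner ℝ ω w) • ω) = -inner ℝ ω w := by
  rw [inner_sub_right, real_inner_smul_right, real_inner_self_eq_norm_sq, hω]
  ring

lemma norm_reflect {ω w : E3} (hω : ‖ω‖ = 1) : ‖w - (2 * inner ℝ ω w) • ω‖ = ‖w‖ := by
  rw [← sq_eq_sq₀ (norm_nonneg _) (norm_nonneg _), norm_sub_sq_real, real_inner_smul_right,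
    real_inner_comm ω w, norm_smul, hω, mul_one, Real.norm_eq_abs, sq_abs]
  ring

/-- In a step the relative displacement is at most ε, so the relative position lifts without
wrapping. Its entry time is the collision time s and its entry point εω, whence the abstract step
agrees with the true collision followed by free flight. -/
lemma ElasticPair.collisionFlow_spec {ε δ s : ℝ} (hε : 0 < ε) (hε1 : ε ≤ 1) {Y Y' : Config N}
    {p q : Fin N} (h : ElasticPair ε (freeFlow s Y) Y' p q) (hs : 0 < s) (hsδ : s ≤ δ)
    (hw : δ * ‖(Y p).2 - (Y q).2‖ ≤ ε) :
    Y ∈ hitSet ε δ p q ∧ collisionFlow ε δ p q Y p = freeState (δ - s) (Y' p) ∧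
      collisionFlow ε δ p q Y q = freeState (δ - s) (Y' q) ∧
      collisionFlow ε δ p q Y ∈ exitSet ε δ p q := by
  obtain ⟨hpq, ω, h1, h2, h3, -, h5, h6, -⟩ := h
  have hv : ∀ k, (freeFlow s Y k).2 = (Y k).2 := fun k => rfl
  rw [hv, hv] at h3 h5 h6
  set w := (Y p).2 - (Y q).2 with hwdef
  set g := (inner ℝ ω w : ℝ) • ω with hg
  have hn : ‖ε • ω‖ = ε := by rw [norm_smul, h1, mul_one, Real.norm_of_nonneg hε.le]
  have hneg : (inner ℝ (ε • ω) w : ℝ) < 0 := by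
    rw [real_inner_smul_left]; exact mul_neg_of_pos_of_neg hε h3
  have hcube : ∀ (r : ℝ) (v : E3), 0 ≤ r → r ≤ δ → δ * ‖v‖ ≤ ε → ε • ω + r • v ∈ cube := by
    intro r v hr hrδ hv
    refine mem_cube_of_norm_le hε1 ((norm_add_le _ _).trans ?_)
    have : ‖r • v‖ ≤ ε := by
      rw [norm_smul, Real.norm_of_nonneg hr]
      exact (mul_le_mul_of_nonneg_right hrδ (norm_nonneg _)).trans hv
    linarith
  have hpos : (Y p).1 - (Y q).1 = proj (ε • ω - s • w) := by
    have : (freeFlow s Y p).1 - (freeFlow s Y q).1 = (Y p).1 - (Y q).1 + proj (s • w) := by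
      simp only [freeFlow, hwdef, smul_sub, proj_sub]
      abel
    rw [proj_sub, ← h2, this, add_sub_cancel_right]
  have hlift : lift (Y p - Y q).1 = ε • ω - s • w := by
    rw [Prod.fst_sub, hpos, lift_proj]
    have := hcube s (-w) hs.le hsδ (by rwa [norm_neg])
    rwa [smul_neg, ← sub_eq_add_neg] at this
  have htime : entryTime ε (ε • ω - s • w) w = s := entryTime_sub_smul hn hneg s
  have hdisc : 0 < discr ε (ε • ω - s • w) w := by
    rw [sub_eq_add_neg, ← neg_smul, discr_add_smul, discr_of_norm_eq hn]
    exact sq_pos_of_neg hneg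
  have hpoint : entryPoint ε (ε • ω - s • w) w = ε • ω := by
    rw [entryPoint, htime, sub_add_cancel]
  have himp : impulse ε (ε • ω - s • w) w = g := by
    rw [impulse, hpoint, real_inner_smul_left, smul_smul, hg]
    congr 1
    field_simp
  have hJ : relJump ε (Y p - Y q) = (proj (s • g), -g) := by
    rw [relJump, hlift, Prod.snd_sub, ← hwdef, himp, htime]
  have hcp : collisionFlow ε δ p q Y p = freeState (δ - s) (Y' p) := by
    rw [collisionFlow, freeFlow_apply, collide_left hpq, hJ, h5]
    refine Prod.ext ?_ ?_
    · simp only [freeState, Prod.fst_add, Prod.snd_add, freeFlow]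
      rw [add_assoc, add_assoc, ← proj_add, ← proj_add]
      congr 2
      module
    · simp only [freeState, Prod.snd_add]
      module
  have hcq : collisionFlow ε δ p q Y q = freeState (δ - s) (Y' q) := by
    rw [collisionFlow, freeFlow_apply, collide_right, hJ, h6]
    refine Prod.ext ?_ ?_
    · simp only [freeState, Prod.fst_sub, Prod.snd_sub, freeFlow]
      rw [sub_add_eq_add_sub, add_sub_assoc, add_assoc, ← proj_sub, ← proj_add]
      congr 2
      module
    · simp only [freeState, Prod.snd_sub]
      module
  refine ⟨?_, hcp, hcq, ?_⟩
  · rw [hitSet, Set.mem_ofPred_eq, hitRegionTorus, Set.mem_ofPred_eq, hlift, Prod.snd_sub, ← hwdef]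
    exact ⟨hdisc, by rwa [htime], by rwa [htime], hw⟩
  · set w' := w - (2 * inner ℝ ω w) • ω with hw'
    have hw'n : ‖w'‖ = ‖w‖ := norm_reflect h1
    have hdiff : collisionFlow ε δ p q Y p - collisionFlow ε δ p q Y q =
        (proj (ε • ω + (δ - s) • w'), w') := by
      rw [hcp, hcq, h5, h6]
      refine Prod.ext ?_ ?_
      · simp only [freeState, Prod.fst_sub]
        rw [add_sub_add_comm, h2, ← proj_sub, ← proj_add]
        congr 2
        rw [hw', hwdef]
        module
      · simp only [freeState, Prod.snd_sub]
        rw [hw', hwdef]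
        module
    have hl : lift (proj (ε • ω + (δ - s) • w')) = ε • ω + (δ - s) • w' :=
      lift_proj (hcube _ _ (by linarith) (by linarith) (by rwa [hw'n]))
    have hin : (inner ℝ (ε • ω) w' : ℝ) = -(ε * inner ℝ ω w) := by
      rw [real_inner_smul_left, inner_reflect h1]; ring
    have hneg' : (inner ℝ (ε • ω) (-w') : ℝ) < 0 := by
      rw [inner_neg_right, hin, neg_neg]
      exact mul_neg_of_pos_of_neg hε h3
    have ht' : entryTime ε (ε • ω + (δ - s) • w') (-w') = δ - s := by
      have := entryTime_sub_smul hn hneg' (δ - s)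
      rwa [smul_neg, sub_neg_eq_add] at this
    have hd' : 0 < discr ε (ε • ω + (δ - s) • w') w' := by
      rw [discr_add_smul, discr_of_norm_eq hn, ← neg_sq, ← inner_neg_right]
      exact sq_pos_of_neg hneg'
    rw [exitSet, Set.mem_ofPred_eq, hdiff, exitRegionTorus, Set.mem_ofPred_eq, hl]
    exact ⟨hd', by rw [ht']; linarith, by rw [ht']; linarith, by rwa [hw'n]⟩

lemma continuous_freeState_time (z : State) : Continuous fun r : ℝ => (freeState r z).1 :=
  continuous_const.add (continuous_proj.comp (continuous_id.smul continuous_const))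

/-- Shortly before an elastic collision continued freely backward, the two particles overlap and
no other pair does. -/
lemma ElasticPair.overlap {ε : ℝ} (hε : 0 < ε) {Y Y' : Config N} {p q : Fin N}
    (h : ElasticPair ε Y Y' p q) : ∃ η > 0, ∀ r, 0 < r → r < η →
      torusDist (freeFlow (-r) Y' p).1 (freeFlow (-r) Y' q).1 < ε ∧
      ∀ k m, k ≠ m → ¬(k = p ∧ m = q) → ¬(k = q ∧ m = p) →
        ε ≤ torusDist (freeFlow (-r) Y' k).1 (freeFlow (-r) Y' m).1 := by
  have h1 : ∀ᶠ r in nhds (0 : ℝ), ∀ k m, k ≠ m → ¬(k = p ∧ m = q) → ¬(k = q ∧ m = p) →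
      ε < torusDist (freeFlow (-r) Y' k).1 (freeFlow (-r) Y' m).1 := by
    rw [Filter.eventually_all]; intro k
    rw [Filter.eventually_all]; intro m
    by_cases hk : k ≠ m ∧ ¬(k = p ∧ m = q) ∧ ¬(k = q ∧ m = p)
    · have hlt : ε < torusDist (Y' k).1 (Y' m).1 := by
        by_contra hle
        rcases h.eq_of_dist_le hk.1 (not_lt.1 hle) with h' | h'
        · exact hk.2.1 h'
        · exact hk.2.2 h'
      have hc : Continuous fun r : ℝ =>
          torusDist (freeState (-r) (Y' k)).1 (freeState (-r) (Y' m)).1 :=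
        continuous_torusDist ((continuous_freeState_time _).comp continuous_neg)
          ((continuous_freeState_time _).comp continuous_neg)
      have h0 : ε < torusDist (freeState (-0) (Y' k)).1 (freeState (-0) (Y' m)).1 := by
        rw [neg_zero, freeState_zero, freeState_zero]; exact hlt
      filter_upwards [hc.continuousAt.eventually (lt_mem_nhds h0)] with r hr _ _ _
      exact hr
    · exact Filter.Eventually.of_forall fun r h1 h2 h3 => absurd ⟨h1, h2, h3⟩ hk
  obtain ⟨η₁, hη₁, h1⟩ := Metric.eventually_nhds_iff.1 h1
  have hpos := h.position
  obtain ⟨hpq, ω, g1, g2, g3, g4, g5, g6, g7⟩ := h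
  set w := (Y p).2 - (Y q).2 with hw
  set w' := w - (2 * inner ℝ ω w) • ω with hw'
  set a := (inner ℝ ω w : ℝ) with ha
  -- The squared distance at backward time r is ε² + 2εar + r²‖w'‖² with a < 0, hence below ε² for 0
  -- < r < -2εa/‖w'‖²; the +1 avoids a vanishing denominator.
  refine ⟨min η₁ (-(2 * ε * a) / (‖w'‖ ^ 2 + 1)),
    lt_min hη₁ (div_pos (by nlinarith) (by positivity)), fun r hr hrη => ⟨?_, ?_⟩⟩
  · have e1 : (freeFlow (-r) Y' p).1 - (freeFlow (-r) Y' q).1 = proj (ε • ω - r • w') := by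
      simp only [freeFlow, g5, g6]
      rw [add_sub_add_comm, g2, ← proj_sub, ← proj_add]
      congr 1
      rw [hw', hw]
      module
    have e2 : ‖ε • ω - r • w'‖ ^ 2 < ε ^ 2 := by
      rw [norm_sub_sq_real, real_inner_smul_left, real_inner_smul_right, inner_reflect g1,
        norm_smul, norm_smul, g1, Real.norm_of_nonneg hε.le, Real.norm_of_nonneg hr.le]
      have e3 := (lt_div_iff₀ (by positivity)).1 (hrη.trans_le (min_le_right _ _))
      have e4 : r * (r * ‖w'‖ ^ 2) < r * (-(2 * ε * a)) := by
        apply mul_lt_mul_of_pos_left _ hr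
        nlinarith
      rw [← ha]
      nlinarith
    exact (torusDist_le_norm e1).trans_lt ((sq_lt_sq₀ (norm_nonneg _) hε.le).1 e2)
  · intro k m hkm h2 h3
    refine (h1 ?_ k m hkm h2 h3).le
    rw [Real.dist_eq, sub_zero, abs_of_pos hr]
    exact hrη.trans_le (min_le_left _ _)

end CollisionGeometry

/-! ### True trajectories follow the discretized step -/

section Dynamics

variable {N : ℕ}

/-- The time step `δ` is so small that collisions are separated and that the relative displacement
of two particles during a time step is less than their diameter. -/
structure FineStep (ε t : ℝ) (γ : ℝ → Config N) (δ : ℝ) : Prop where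
  pos : 0 < δ
  separated : ∀ s ∈ collisionTimes ε t γ, ∀ s' ∈ collisionTimes ε t γ, s ≠ s' → δ ≤ |s - s'|
  slow : ∀ s ∈ Set.Icc 0 t, ∀ i j, δ * ‖(γ s i).2 - (γ s j).2‖ ≤ ε

variable {ε t δ : ℝ} {Z : Config N} {γ : ℝ → Config N}

lemma FineStep.eq_of_mem (hδ : FineStep ε t γ δ) {a s s' : ℝ} (hs : s ∈ collisionTimes ε t γ)
    (hs' : s' ∈ collisionTimes ε t γ) (h : s ∈ Set.Ioc a (a + δ)) (h' : s' ∈ Set.Ioc a (a + δ)) :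
    s = s' := by
  by_contra hne
  have h1 := hδ.separated s hs s' hs' hne
  have h2 : |s - s'| < δ := abs_lt.2 ⟨by linarith [h.1, h'.2], by linarith [h.2, h'.1]⟩
  linarith

lemma IsTrajectory.elasticPair (hγ : IsTrajectory ε t Z γ) {a s : ℝ} (ha : 0 ≤ a) (has : a < s)
    (hst : s ≤ t) {i j : Fin N} (hc : Collide ε γ s i j)
    (hno : ∀ r ∈ Set.Ioo a s, r ∉ collisionTimes ε t γ) :
    ElasticPair ε (freeFlow (s - a) (γ a)) (γ s) i j := by
  obtain ⟨i', j', h⟩ := hγ.collision a s ha has ⟨⟨ha.trans has.le, hst⟩, i, j, hc⟩ hno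
  have h' : ElasticPair ε (freeFlow (s - a) (γ a)) (γ s) i' j' := h
  rcases h'.eq_of_dist_le hc.1 hc.2.le with ⟨rfl, rfl⟩ | ⟨rfl, rfl⟩
  · exact h'
  · exact h'.symm

/-- Another pair may collide during the step; particle k is untouched by it, and the two free
flights compose. -/
lemma IsTrajectory.free_apply (hγ : IsTrajectory ε t Z γ) (hδ : FineStep ε t γ δ) {a : ℝ}
    (ha : 0 ≤ a) (hb : a + δ ≤ t) {k : Fin N}
    (hk : ∀ s ∈ Set.Ioc a (a + δ), ∀ j, ¬Collide ε γ s k j) {s : ℝ}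
    (hs : s ∈ Set.Icc a (a + δ)) : γ s k = freeState (s - a) (γ a k) := by
  have hst : s ≤ t := hs.2.trans hb
  by_cases h : ∃ r ∈ Set.Ioc a s, r ∈ collisionTimes ε t γ
  · obtain ⟨r, hr, hrc⟩ := h
    have hmem : r ∈ Set.Ioc a (a + δ) := ⟨hr.1, hr.2.trans hs.2⟩
    have huniq : ∀ r' ∈ Set.Ioc a (a + δ), r' ∈ collisionTimes ε t γ → r' = r :=
      fun r' h1 h2 => hδ.eq_of_mem h2 hrc h1 hmem
    obtain ⟨hr0, i, j, hij⟩ := hrc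
    obtain ⟨-, ω, -, -, -, -, -, -, hl⟩ := hγ.elasticPair ha hr.1 hr0.2 hij
      fun r' h1 h2 => h1.2.ne (huniq r' ⟨h1.1, h1.2.le.trans hmem.2⟩ h2)
    have hki : k ≠ i := by rintro rfl; exact hk r hmem j hij
    have hkj : k ≠ j := by
      rintro rfl
      exact hk r hmem i ⟨hij.1.symm, by rw [torusDist_comm]; exact hij.2⟩
    rw [hγ.free r s hr0.1 hr.2 hst fun r' h1 h2 =>
      h1.1.ne' (huniq r' ⟨hr.1.trans h1.1, h1.2.trans hs.2⟩ h2), freeFlow_apply, hl k hki hkj,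
      freeFlow_apply, freeState_freeState]
    congr 1
    ring
  · push Not at h
    rw [hγ.free a s ha hs.1 hst h, freeFlow_apply]

lemma collide_apply_of_ne (ε : ℝ) {p q k : Fin N} (Y : Config N) (hp : k ≠ p) (hq : k ≠ q) :
    collide ε p q Y k = Y k := by
  rw [collide, Function.update_of_ne hq, Function.update_of_ne hp]

lemma IsTrajectory.freeFlow_neg (hγ : IsTrajectory ε t Z γ) {s b r : ℝ} (hs : 0 ≤ s) (hb : b ≤ t)
    (hno : ∀ r ∈ Set.Ioc s b, r ∉ collisionTimes ε t γ) (hr : r ∈ Set.Icc 0 (b - s)) :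
    freeFlow (-r) (γ b) = γ (b - r) := by
  rw [hγ.free (b - r) b (by linarith [hr.2]) (by linarith [hr.1]) hb
    fun r' h1 => hno r' ⟨by linarith [hr.2, h1.1], h1.2⟩, freeFlow_freeFlow]
  rw [show b - (b - r) + -r = 0 by ring, freeFlow_zero]

/-- A collision during a time step. -/
lemma IsTrajectory.collision_spec (hγ : IsTrajectory ε t Z γ) (hε : 0 < ε) (hε1 : ε ≤ 1)
    (hδ : FineStep ε t γ δ) {a s : ℝ} (ha : 0 ≤ a) (hb : a + δ ≤ t)
    (hs : s ∈ Set.Ioc a (a + δ)) {i j : Fin N} (hc : Collide ε γ s i j) :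
    γ a ∈ hitSet ε δ i j ∧ collisionFlow ε δ i j (γ a) = γ (a + δ) ∧
      γ (a + δ) ∈ exitSet ε δ i j ∧ ∀ I, γ (a + δ) ∈ firstContact ε δ I i j := by
  have hs0 : 0 ≤ s := ha.trans hs.1.le
  have hsc : s ∈ collisionTimes ε t γ := ⟨⟨hs0, hs.2.trans hb⟩, i, j, hc⟩
  have huniq : ∀ r ∈ Set.Ioc a (a + δ), r ∈ collisionTimes ε t γ → r = s :=
    fun r h1 h2 => hδ.eq_of_mem h2 hsc h1 hs
  have hE := hγ.elasticPair ha hs.1 (hs.2.trans hb) hc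
    fun r h1 h2 => h1.2.ne (huniq r ⟨h1.1, h1.2.le.trans hs.2⟩ h2)
  have hno : ∀ r ∈ Set.Ioc s (a + δ), r ∉ collisionTimes ε t γ :=
    fun r h1 h2 => h1.1.ne' (huniq r ⟨hs.1.trans h1.1, h1.2⟩ h2)
  obtain ⟨h1, h2, h3, h4⟩ := hE.collisionFlow_spec hε hε1 (sub_pos.2 hs.1)
    (by linarith [hs.2]) (hδ.slow a ⟨ha, by linarith [hδ.pos]⟩ i j)
  have hfree := hγ.free s (a + δ) hs0 hs.2 hb hno
  have hflow : collisionFlow ε δ i j (γ a) = γ (a + δ) := by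
    ext1 k
    rw [hfree, freeFlow_apply]
    by_cases hi : k = i
    · subst hi; rw [h2]; congr 1; ring
    by_cases hj : k = j
    · subst hj; rw [h3]; congr 1; ring
    obtain ⟨-, ω, -, -, -, -, -, -, hl⟩ := hE
    rw [hl k hi hj, collisionFlow, freeFlow_apply, collide_apply_of_ne ε _ hi hj, freeFlow_apply,
      freeState_freeState]
    congr 1; ring
  refine ⟨h1, hflow, hflow ▸ h4, fun I => ?_⟩
  obtain ⟨η, hη, hov⟩ := hE.overlap hε
  -- A rational backward time just past the collision: the pair now overlaps virtually, while the
  -- other pairs remain apart. Before it the backward motion is the true one, without overlaps.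
  obtain ⟨u, hu1, hu2⟩ := exists_rat_btwn
    (show a + δ - s < min (a + δ - s + η) δ from lt_min (by linarith) (by linarith [hs.1]))
  have hback : ∀ r, freeFlow (-r) (γ (a + δ)) = freeFlow (-(r - (a + δ - s))) (γ s) := by
    intro r
    rw [hfree, freeFlow_freeFlow]
    congr 1; ring
  have hu3 : (u : ℝ) < a + δ - s + η := hu2.trans_le (min_le_left _ _)
  refine ⟨u, ⟨by linarith [hs.2], hu2.trans_le (min_le_right _ _)⟩, ?_, ?_⟩
  · rw [hback]
    exact (hov _ (by linarith) (by linarith)).1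
  · intro r hr k _ m _ hkm hn1 hn2
    rcases le_or_gt r (a + δ - s) with hle | hlt
    · rw [hγ.freeFlow_neg hs0 hb hno ⟨hr.1, hle⟩]
      exact hγ.apart _ ⟨by linarith, by linarith [hr.1]⟩ k m hkm
    · rw [hback]
      exact (hov _ (by linarith) (by linarith [hr.2])).2 k m hkm hn1 hn2

/-- If the group has a collision, it is internal and unique, and the step is the collision branch of
that pair. If not, the free backward motion retraces the true one, whose spheres never overlap, so
no first contact is recorded. -/
lemma IsTrajectory.mem_stay (hγ : IsTrajectory ε t Z γ) (hε : 0 < ε) (hε1 : ε ≤ 1)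
    (hδ : FineStep ε t γ δ) {a : ℝ} (ha : 0 ≤ a) (hb : a + δ ≤ t) {I : Finset (Fin N)}
    (hI : ∀ s ∈ Set.Ioc a (a + δ), ∀ i ∈ I, ∀ j, Collide ε γ s i j → j ∈ I)
    {S : Set (Config N)} (hS : IsCylinder I S) (hmem : γ (a + δ) ∈ S) :
    γ a ∈ stay ε δ I S := by
  by_cases h : ∃ s ∈ Set.Ioc a (a + δ), ∃ i ∈ I, ∃ j, Collide ε γ s i j
  · obtain ⟨s, hs, i, hi, j, hc⟩ := h
    have hj := hI s hs i hi j hc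
    have key : ∀ i ∈ I, ∀ j ∈ I, i < j → Collide ε γ s i j → γ a ∈ stay ε δ I S := by
      intro i hi j hj hij hc
      obtain ⟨h1, h2, -, h4⟩ := hγ.collision_spec hε hε1 hδ ha hb hs hc
      refine Or.inr (Set.mem_iUnion₂.2 ⟨(i, j), by simp [hi, hj, hij], h1, ?_⟩)
      rw [Set.mem_preimage, h2]
      exact ⟨hmem, h4 I⟩
    rcases lt_or_gt_of_ne hc.1 with hij | hij
    · exact key i hi j hj hij hc
    · exact key j hj i hi hij ⟨hc.1.symm, by rw [torusDist_comm]; exact hc.2⟩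
  · push Not at h
    have hfree : ∀ i ∈ I, ∀ s ∈ Set.Icc a (a + δ), γ s i = freeState (s - a) (γ a i) :=
      fun i hi s hs => hγ.free_apply hδ ha hb (fun s hs => h s hs i hi) hs
    have hend : ∀ i ∈ I, γ (a + δ) i = freeFlow δ (γ a) i := fun i hi => by
      rw [hfree i hi _ ⟨by linarith [hδ.pos], le_rfl⟩, freeFlow_apply, add_sub_cancel_left]
    refine Or.inl ⟨hS.2 _ _ hend hmem, fun hmem' => ?_⟩
    obtain ⟨⟨k, m⟩, hx, s, hs, hlt, -⟩ := Set.mem_iUnion₂.1 hmem'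
    obtain ⟨hk, hm, hkm⟩ := mem_pairs hx
    have hback : ∀ i ∈ I, freeFlow (-(s : ℝ)) (freeFlow δ (γ a)) i = γ (a + (δ - s)) i := by
      intro i hi
      rw [hfree i hi _ ⟨by linarith [hs.2], by linarith [hs.1]⟩, freeFlow_freeFlow,
        freeFlow_apply]
      congr 1; ring
    rw [hback k hk, hback m hm] at hlt
    exact absurd hlt (not_lt.2 (hγ.apart _ ⟨by linarith [hs.2], by linarith [hs.1]⟩ k m hkm.ne))

lemma IsTrajectory.mem_iterate_stay (hγ : IsTrajectory ε t Z γ) (hε : 0 < ε) (hε1 : ε ≤ 1)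
    (hδ : FineStep ε t γ δ) {b : ℝ} (hb : b ≤ t) {S : Set (Config N)}
    (hS : IsCylinder Finset.univ S) (hmem : γ b ∈ S) (J : ℕ) (hJ : 0 ≤ b - J * δ) :
    γ (b - J * δ) ∈ (stay ε δ Finset.univ)^[J] S := by
  induction J with
  | zero => simpa using hmem
  | succ J ih =>
    push_cast at hJ ⊢
    have hδ0 := hδ.pos
    have hJδ : 0 ≤ J * δ := by positivity
    have e : b - J * δ = b - (J + 1) * δ + δ := by ring
    have ih' := ih (by linarith)
    rw [e] at ih'
    rw [Function.iterate_succ_apply']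
    exact hγ.mem_stay hε hε1 hδ hJ (by linarith) (fun _ _ _ _ _ _ => Finset.mem_univ _)
      (isCylinder_iterate_stay hS J) ih'

end Dynamics

/-! ### Backward clusters and the evolution of groups -/

section Cluster

variable {N : ℕ}

variable {ε t δ : ℝ} {Z : Config N} {γ : ℝ → Config N}

/-- The part of a backward cluster which is created after the time `s`. -/
def clusterAt {k : ℕ} (c : Fin (k + 1) → Fin N) (τ : Fin (k + 1) → ℝ) (s : ℝ) : Finset (Fin N) :=
  (Finset.univ.filter fun r => r = 0 ∨ s < τ r).image c

variable {p : Fin N} {k : ℕ} {c : Fin (k + 1) → Fin N} {τ : Fin (k + 1) → ℝ}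

lemma mem_clusterAt {s : ℝ} {i : Fin N} :
    i ∈ clusterAt c τ s ↔ ∃ r, (r = 0 ∨ s < τ r) ∧ c r = i := by
  simp [clusterAt]

lemma IsBackwardCluster.tau_le (hc : IsBackwardCluster ε t γ p k c τ) (r : Fin (k + 1)) :
    τ r ≤ t := hc.start ▸ hc.decreasing.antitone (Fin.zero_le r)

lemma IsBackwardCluster.clusterAt_start (hc : IsBackwardCluster ε t γ p k c τ) :
    clusterAt c τ t = {p} := by
  ext i
  rw [mem_clusterAt, Finset.mem_singleton]
  constructor
  · rintro ⟨r, rfl | hr, rfl⟩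
    · exact hc.root
    · exact absurd hr (not_lt.2 (hc.tau_le r))
  · rintro rfl
    exact ⟨0, Or.inl rfl, hc.root⟩

lemma IsBackwardCluster.card_clusterAt_zero (hc : IsBackwardCluster ε t γ p k c τ) :
    (clusterAt c τ 0).card = k + 1 := by
  rw [clusterAt, Finset.card_image_of_injective _ hc.distinct, Finset.filter_true_of_mem,
    Finset.card_univ, Fintype.card_fin]
  intro r _
  rcases Fin.eq_zero_or_eq_succ r with rfl | ⟨r', rfl⟩
  · exact Or.inl rfl
  · exact Or.inr (hc.pos r')

lemma IsBackwardCluster.mem_collisionTimes (hc : IsBackwardCluster ε t γ p k c τ)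
    {r : Fin (k + 1)} (hr : r ≠ 0) : τ r ∈ collisionTimes ε t γ := by
  obtain ⟨r, rfl⟩ := Fin.exists_succ_eq.2 hr
  obtain ⟨q, -, hq⟩ := hc.creation r
  exact ⟨⟨(hc.pos r).le, hc.tau_le _⟩, _, _, hq⟩

/-- Collisions are separated by δ, so at most one creation falls in the step. With a creation, the
last particle joins through the collision creating it; without one, every collision of a cluster
particle must be internal. -/
lemma IsBackwardCluster.mem_evolve (hc : IsBackwardCluster ε t γ p k c τ)
    (hγ : IsTrajectory ε t Z γ) (hε : 0 < ε) (hε1 : ε ≤ 1) (hδ : FineStep ε t γ δ) {a : ℝ}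
    (ha : 0 ≤ a) (hb : a + δ ≤ t) {A : Finset (Fin N) → Set (Config N)}
    (hA : ∀ I, IsCylinder I (A I)) (hmem : γ (a + δ) ∈ A (clusterAt c τ (a + δ))) :
    γ a ∈ evolve ε δ A (clusterAt c τ a) := by
  have hδ0 := hδ.pos
  by_cases hex : ∃ r : Fin k, τ r.succ ∈ Set.Ioc a (a + δ)
  · obtain ⟨r, hr⟩ := hex
    have huniq : ∀ r', r' ≠ 0 → τ r' ∈ Set.Ioc a (a + δ) → r' = r.succ := fun r' h0 h =>
      hc.decreasing.injective (hδ.eq_of_mem (hc.mem_collisionTimes h0)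
        (hc.mem_collisionTimes r.succ_ne_zero) h hr)
    have hnot : c r.succ ∉ clusterAt c τ (a + δ) := by
      rw [mem_clusterAt]
      rintro ⟨r', h, he⟩
      obtain rfl := hc.distinct he
      rcases h with h | h
      · exact r.succ_ne_zero h
      · exact absurd h (not_lt.2 hr.2)
    have hins : clusterAt c τ a = insert (c r.succ) (clusterAt c τ (a + δ)) := by
      ext i
      rw [Finset.mem_insert, mem_clusterAt, mem_clusterAt]
      constructor
      · rintro ⟨r', h, rfl⟩
        by_cases h0 : r' = 0
        · exact Or.inr ⟨r', Or.inl h0, rfl⟩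
        · rcases le_or_gt (τ r') (a + δ) with hle | hlt
          · exact Or.inl (congrArg c (huniq r' h0 ⟨h.resolve_left h0, hle⟩))
          · exact Or.inr ⟨r', Or.inr hlt, rfl⟩
      · rintro (rfl | ⟨r', h, rfl⟩)
        · exact ⟨r.succ, Or.inr hr.1, rfl⟩
        · exact ⟨r', h.imp_right fun h => by linarith, rfl⟩
    obtain ⟨q, hq, hcol⟩ := hc.creation r
    have hqr : q < r.succ := hq.trans_lt r.castSucc_lt_succ
    have hqmem : c q ∈ clusterAt c τ (a + δ) := by
      refine mem_clusterAt.2 ⟨q, or_iff_not_imp_left.2 fun h0 => ?_, rfl⟩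
      by_contra hle
      exact hqr.ne (huniq q h0 ⟨hr.1.trans (hc.decreasing hqr), not_lt.1 hle⟩)
    have herase : (clusterAt c τ a).erase (c r.succ) = clusterAt c τ (a + δ) := by
      rw [hins, Finset.erase_insert hnot]
    refine Or.inr (Set.mem_iUnion₂.2 ⟨c r.succ, hins ▸ Finset.mem_insert_self _ _,
      Set.mem_iUnion₂.2 ⟨c q, herase ▸ hqmem, ?_⟩⟩)
    obtain ⟨h1, h2, h3, -⟩ := hγ.collision_spec hε hε1 hδ ha hb hr
      (show Collide ε γ (τ r.succ) (c r.succ) (c q) from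
        ⟨hcol.1.symm, by rw [torusDist_comm]; exact hcol.2⟩)
    refine ⟨h1, ?_⟩
    rw [Set.mem_preimage, h2, herase]
    exact ⟨hmem, h3⟩
  · push Not at hex
    have hlow : ∀ r, r ≠ 0 → τ r ≤ a + δ → τ r ≤ a := by
      intro r h0 hle
      obtain ⟨r, rfl⟩ := Fin.exists_succ_eq.2 h0
      by_contra hlt
      exact hex r ⟨not_le.1 hlt, hle⟩
    have heq : clusterAt c τ a = clusterAt c τ (a + δ) := by
      ext i
      rw [mem_clusterAt, mem_clusterAt]
      refine exists_congr fun r => and_congr_left fun _ => ?_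
      by_cases h0 : r = 0
      · simp [h0]
      · simp only [h0, false_or]
        exact ⟨fun h => by by_contra hle; linarith [hlow r h0 (not_lt.1 hle)],
          fun h => by linarith⟩
    refine Or.inl (hγ.mem_stay hε hε1 hδ ha hb ?_ (hA _) (heq ▸ hmem))
    intro s hs i hi j hcol
    have hst : s < t := (hγ.interior ⟨⟨ha.trans hs.1.le, hs.2.trans hb⟩, i, j, hcol⟩).2
    obtain ⟨R, hR, hmax⟩ := (Finset.univ.filter fun r => s < τ r).exists_max_image id
      ⟨0, by simp [hc.start, hst]⟩
    -- R is the last index created after time s. A collision at s therefore lies between two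
    -- successive creations, or after all of them backward, which is what `first` and `last` govern.
    have hRs : s < τ R := (Finset.mem_filter.1 hR).2
    have hle : ∀ r, r ≤ R → c r ∈ clusterAt c τ a := fun r hr =>
      mem_clusterAt.2 ⟨r, Or.inr (hs.1.trans (hRs.trans_le (hc.decreasing.antitone hr))), rfl⟩
    obtain ⟨q, hq, rfl⟩ := mem_clusterAt.1 hi
    have hqR : q ≤ R := by
      by_cases h0 : q = 0
      · exact h0 ▸ Fin.zero_le R
      · refine hmax q (Finset.mem_filter.2 ⟨Finset.mem_univ _, ?_⟩)
        by_contra hns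
        have := hlow q h0 ((not_lt.1 hns).trans hs.2)
        have := hq.resolve_left h0
        linarith
    rcases Fin.eq_castSucc_or_eq_last R with ⟨R', rfl⟩ | rfl
    · have h1 : τ R'.succ ≤ s := by
        by_contra hlt
        have := hmax R'.succ (Finset.mem_filter.2 ⟨Finset.mem_univ _, not_le.1 hlt⟩)
        exact absurd R'.castSucc_lt_succ (not_lt.2 this)
      have h2 := hlow _ R'.succ_ne_zero (h1.trans hs.2)
      obtain ⟨q', hq', rfl⟩ := hc.first R' s ⟨h2.trans_lt hs.1, hRs⟩ q hqR j hcol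
      exact hle q' hq'
    · obtain ⟨q', rfl⟩ := hc.last s ⟨ha.trans_lt hs.1, hRs⟩ q j hcol
      exact hle q' (Fin.le_last q')

lemma IsBackwardCluster.mem_iterate_evolve (hc : IsBackwardCluster ε t γ p k c τ)
    (hγ : IsTrajectory ε t Z γ) (hε : 0 < ε) (hε1 : ε ≤ 1) (hδ : FineStep ε t γ δ) {b : ℝ}
    (hb : b ≤ t) {A : Finset (Fin N) → Set (Config N)} (hA : ∀ I, IsCylinder I (A I))
    (hmem : γ b ∈ A (clusterAt c τ b)) (J : ℕ) (hJ : 0 ≤ b - J * δ) :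
    γ (b - J * δ) ∈ (evolve ε δ)^[J] A (clusterAt c τ (b - J * δ)) := by
  induction J with
  | zero => simpa using hmem
  | succ J ih =>
    push_cast at hJ ⊢
    have hδ0 := hδ.pos
    have hJδ : 0 ≤ J * δ := by positivity
    have e : b - J * δ = b - (J + 1) * δ + δ := by ring
    have ih' := ih (by linarith)
    rw [e] at ih'
    rw [Function.iterate_succ_apply']
    exact hc.mem_evolve hγ hε hε1 hδ hJ (by linarith) (isCylinder_iterate hA J) ih'

/-- Three stretches, backward from t: growth to m+1, growth to L+1, then evolution of all N
particles down to time 0, which transports the event without following the cluster any more. -/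
lemma IsBackwardCluster.mem_pastEvent (hc : IsBackwardCluster ε t γ p k c τ)
    (hγ : IsTrajectory ε t Z γ) (hε : 0 < ε) (hε1 : ε ≤ 1) (hδ : FineStep ε t γ δ)
    {J J' J'' m L : ℕ} (hJ : (J + J' + J'') * δ = t)
    (hm : (clusterAt c τ (t - J * δ)).card = m + 1)
    (hL : (clusterAt c τ (t - (J + J') * δ)).card = L + 1) :
    Z ∈ pastEvent ε δ J'' (L + 1) (clusterFamily ε δ p J J' m) := by
  have hδ0 := hδ.pos
  have h0 : 0 ≤ J * δ := by positivity
  have h0' : 0 ≤ J' * δ := by positivity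
  have h0'' : 0 ≤ J'' * δ := by positivity
  have h1 := hc.mem_iterate_evolve hγ hε hε1 hδ le_rfl (isCylinder_rootFamily p)
    (by rw [hc.clusterAt_start, rootFamily, if_pos rfl]; trivial) J (by nlinarith)
  have h2 := hc.mem_iterate_evolve hγ hε hε1 hδ (b := t - J * δ) (by linarith)
    (isCylinder_restrictCard (isCylinder_iterate (isCylinder_rootFamily p) J) (m + 1))
    (by rw [restrictCard, if_pos hm]; exact h1) J' (by nlinarith)
  have e : t - J * δ - J' * δ = t - (J + J') * δ := by ring
  rw [e] at h2
  have hU : IsCylinder (Finset.univ : Finset (Fin N))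
      ((⋃ I ∈ Finset.powersetCard (L + 1) Finset.univ, clusterFamily ε δ p J J' m I) ∩
        apartSet ε Finset.univ) :=
    (isCylinder_biUnion fun I _ => (isCylinder_clusterFamily ε δ p J J' m I).mono
      (Finset.subset_univ I)).inter (isCylinder_apartSet ε _)
  have h3 := hγ.mem_iterate_stay hε hε1 hδ (b := t - (J + J') * δ) (by nlinarith) hU
    ⟨Set.mem_iUnion₂.2 ⟨_, Finset.mem_powersetCard.2 ⟨Finset.subset_univ _, hL⟩, h2⟩,
      fun i _ j _ hij => hγ.apart _ ⟨by nlinarith, by nlinarith⟩ i j hij⟩ J'' (by nlinarith)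
  rwa [show t - (J + J') * δ - J'' * δ = 0 by linarith, hγ.initial] at h3

end Cluster

/-! ### Existence of fine time steps -/

section FineSteps

variable {N : ℕ}

open Filter Topology

lemma IsTrajectory.exists_velocity_eq {ε t : ℝ} {Z : Config N} {γ : ℝ → Config N}
    (hγ : IsTrajectory ε t Z γ) {s : ℝ} (hs : s ∈ Set.Icc 0 t) :
    ∃ s' ∈ insert 0 (collisionTimes ε t γ), ∀ i, (γ s i).2 = (γ s' i).2 := by
  obtain ⟨s', ⟨h1, h2⟩, hmax⟩ := Set.exists_max_image
    (insert 0 (collisionTimes ε t γ) ∩ Set.Iic s) id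
    ((hγ.finite.insert 0).subset Set.inter_subset_left) ⟨0, Set.mem_insert _ _, hs.1⟩
  have h0 : 0 ≤ s' := by
    rcases h1 with rfl | h1
    · exact le_rfl
    · exact h1.1.1
  refine ⟨s', h1, fun i => ?_⟩
  rw [hγ.free s' s h0 h2 hs.2 fun r hr hrc =>
    absurd (hmax r ⟨Set.mem_insert_of_mem _ hrc, hr.2⟩) (not_le.2 hr.1)]
  rfl

lemma IsTrajectory.eventually_fineStep {ε t : ℝ} {Z : Config N} {γ : ℝ → Config N} (hε : 0 < ε)
    (hγ : IsTrajectory ε t Z γ) : ∀ᶠ δ in 𝓝[>] (0 : ℝ), FineStep ε t γ δ := by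
  have h1 : ∀ᶠ δ in 𝓝[>] (0 : ℝ), ∀ s ∈ collisionTimes ε t γ, ∀ s' ∈ collisionTimes ε t γ,
      s ≠ s' → δ ≤ |s - s'| := by
    refine (Filter.eventually_all_finite hγ.finite).2 fun s _ =>
      (Filter.eventually_all_finite hγ.finite).2 fun s' _ => ?_
    by_cases hne : s = s'
    · exact Eventually.of_forall fun _ h => absurd hne h
    · filter_upwards [nhdsWithin_le_nhds (Iic_mem_nhds (abs_pos.2 (sub_ne_zero.2 hne)))]
        with δ hδ _
      exact hδ
  have h2 : ∀ᶠ δ in 𝓝[>] (0 : ℝ), ∀ s ∈ insert 0 (collisionTimes ε t γ), ∀ i j,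
      δ * ‖(γ s i).2 - (γ s j).2‖ ≤ ε := by
    refine (Filter.eventually_all_finite (hγ.finite.insert 0)).2 fun s _ => ?_
    rw [eventually_all]; intro i
    rw [eventually_all]; intro j
    have hc : Continuous fun δ : ℝ => δ * ‖(γ s i).2 - (γ s j).2‖ := by fun_prop
    refine nhdsWithin_le_nhds ((hc.tendsto 0).eventually (Iic_mem_nhds ?_))
    rwa [zero_mul]
  filter_upwards [h1, h2, self_mem_nhdsWithin] with δ h1 h2 h3
  refine ⟨h3, h1, fun s hs i j => ?_⟩
  obtain ⟨s', hs', hv⟩ := hγ.exists_velocity_eq hs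
  rw [hv, hv]
  exact h2 s' hs' i j

end FineSteps

/-! ### Probability of growth in one time window -/

section PhaseBounds

variable {N : ℕ}

lemma choose_mul_choose_mul_pow_le {t : ℝ} (ht : 0 ≤ t) {n M j m L : ℕ} (hn : 0 < n) (hM : 0 < M)
    (hj : j ≤ n) (hmL : m ≤ L) :
    (M.choose (L - m) : ℝ) * (j * M).choose m * (t / (n * M) * (L + 1 : ℕ)) ^ L ≤
      Real.exp 1 * (2 * Real.exp 1) ^ L * (t ^ m * (t / n) ^ (L - m)) := by
  have hn' : (0 : ℝ) < n := by exact_mod_cast hn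
  have hM' : (0 : ℝ) < M := by exact_mod_cast hM
  have h1 : (M.choose (L - m) : ℝ) ≤ (M : ℝ) ^ (L - m) / ((L - m).factorial : ℝ) :=
    Nat.choose_le_pow_div _ _
  have h2 : ((j * M).choose m : ℝ) ≤ ((n : ℝ) * M) ^ m / (m.factorial : ℝ) := by
    refine (Nat.choose_le_pow_div _ _).trans ?_
    push_cast
    gcongr
  have h3 : ((L + 1 : ℕ) : ℝ) ^ L / (L.factorial : ℝ) ≤ Real.exp 1 ^ (L + 1) := by
    rw [← Real.exp_nat_mul, mul_one]
    exact Real.pow_div_factorial_le_exp _ (by positivity) L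
  have h4 : (L.choose m : ℝ) ≤ 2 ^ L := by exact_mod_cast Nat.choose_le_two_pow L m
  have h5 : (L.choose m : ℝ) * (m.factorial * (L - m).factorial) = L.factorial := by
    rw [← mul_assoc]; exact_mod_cast Nat.choose_mul_factorial_mul_factorial hmL
  have hm0 : (0 : ℝ) < m.factorial := by exact_mod_cast m.factorial_pos
  have hl0 : (0 : ℝ) < (L - m).factorial := by exact_mod_cast (L - m).factorial_pos
  have hc0 : (0 : ℝ) < L.choose m := by exact_mod_cast Nat.choose_pos hmL
  calc (M.choose (L - m) : ℝ) * (j * M).choose m * (t / (n * M) * (L + 1 : ℕ)) ^ L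
      ≤ (M : ℝ) ^ (L - m) / ((L - m).factorial : ℝ) * (((n : ℝ) * M) ^ m / (m.factorial : ℝ)) *
          (t / (n * M) * (L + 1 : ℕ)) ^ L := by gcongr
    -- All powers of the number M of steps cancel. Writing 1/(m!(L-m)!) as binom(L,m)/L! leaves 2^L
    -- and (L+1)^L/L! ≤ e^(L+1).
    _ = (L.choose m : ℝ) * (((L + 1 : ℕ) : ℝ) ^ L / (L.factorial : ℝ)) *
          (t ^ m * (t / n) ^ (L - m)) := by
        rw [← h5]
        obtain ⟨i, rfl⟩ := Nat.exists_eq_add_of_le hmL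
        rw [Nat.add_sub_cancel_left]
        simp only [div_pow, mul_pow, pow_add]
        field_simp
    _ ≤ 2 ^ L * Real.exp 1 ^ (L + 1) * (t ^ m * (t / n) ^ (L - m)) := by gcongr
    _ = _ := by rw [mul_pow]; ring

/-- The event that the backward cluster grows from `m + 1` to `L + 1` particles during the
`j`-th of `n` successive time intervals of equal length. -/
def growthEvent (N : ℕ) (ε t : ℝ) (p : Fin N) (n j m L : ℕ) : Set (Config N) :=
  {Z | ∃ γ, IsTrajectory ε t Z γ ∧ ∃ k c τ, IsBackwardCluster ε t γ p k c τ ∧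
    (clusterAt c τ (t - j * (t / n))).card = m + 1 ∧
    (clusterAt c τ (t - (j + 1) * (t / n))).card = L + 1}

lemma eventually_mem_pastEvent {ε t : ℝ} (hε : 0 < ε) (hε1 : ε ≤ 1) (ht : 0 < t) {p : Fin N}
    {n j m L : ℕ} (hj : j < n) {Z : Config N} (hZ : Z ∈ growthEvent N ε t p n j m L) :
    ∀ᶠ M : ℕ in Filter.atTop, Z ∈ pastEvent ε (t / (n * M)) ((n - (j + 1)) * M) (L + 1)
      (clusterFamily ε (t / (n * M)) p (j * M) M m) := by
  obtain ⟨γ, hγ, k, c, τ, hc, hm, hL⟩ := hZ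
  have hn : (0 : ℝ) < n := by exact_mod_cast (Nat.zero_le j).trans_lt hj
  have hlim : Filter.Tendsto (fun M : ℕ => t / ((n : ℝ) * M)) Filter.atTop
      (nhdsWithin 0 (Set.Ioi 0)) := by
    refine tendsto_nhdsWithin_iff.2 ⟨?_, ?_⟩
    · exact (tendsto_natCast_atTop_atTop.const_mul_atTop hn).const_div_atTop t
    · filter_upwards [Filter.eventually_gt_atTop 0] with M hM
      have : (0 : ℝ) < M := by exact_mod_cast hM
      exact div_pos ht (by positivity)
  filter_upwards [hlim.eventually (hγ.eventually_fineStep hε), Filter.eventually_gt_atTop 0]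
    with M hδ hM
  have hM' : (0 : ℝ) < M := by exact_mod_cast hM
  refine hc.mem_pastEvent hγ hε hε1 hδ ?_ ?_ ?_
  · have : ((n - (j + 1) : ℕ) : ℝ) = n - (j + 1) := by
      rw [Nat.cast_sub hj]; push_cast; ring
    push_cast
    rw [this]
    field_simp
    ring
  · rw [← hm]
    congr 3
    push_cast
    field_simp
  · rw [← hL]
    congr 3
    push_cast
    field_simp

/-- E lies in the lower limit of the W M, an increasing union whose terms are each contained in some
W M of measure at most B. E itself need not be measurable. -/
lemma measure_le_of_eventually {α : Type*} [MeasurableSpace α] {μ : Measure α} {E : Set α}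
    {W : ℕ → Set α} {B : ℝ≥0∞} (hE : ∀ z ∈ E, ∀ᶠ M in Filter.atTop, z ∈ W M)
    (hW : ∀ᶠ M in Filter.atTop, μ (W M) ≤ B) : μ E ≤ B := by
  have hsub : E ⊆ ⋃ M₀ : ℕ, ⋂ M, ⋂ _ : M₀ ≤ M, W M := fun z hz => by
    obtain ⟨M₀, h⟩ := Filter.eventually_atTop.1 (hE z hz)
    exact Set.mem_iUnion.2 ⟨M₀, Set.mem_iInter₂.2 h⟩
  have hmono : Monotone fun M₀ : ℕ => ⋂ M, ⋂ _ : M₀ ≤ M, W M := fun a b hab =>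
    Set.iInter_mono fun M => Set.iInter_mono' fun h => ⟨hab.trans h, le_rfl⟩
  refine (measure_mono hsub).trans ?_
  rw [hmono.measure_iUnion]
  refine iSup_le fun M₀ => ?_
  obtain ⟨M, h1, h2⟩ := (hW.and (Filter.eventually_ge_atTop M₀)).exists
  exact (measure_mono (Set.iInter₂_subset M h2)).trans h1

/-- The bounds for δ = t/(nM) are uniform in M, and each configuration of the event lies in the
discretized one for M large. -/
lemma exists_gibbs_growthEvent_le {β : ℝ} (hβ : 0 < β) : ∃ C : ℝ, 1 ≤ C ∧
    ∀ (N : ℕ) (ε : ℝ), 0 < ε → ε ≤ 1 → ε ^ 2 * (N : ℝ) = 1 → ∀ (p : Fin N) (t : ℝ), 0 < t →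
      ∀ n j m L : ℕ, j < n → m ≤ L → gibbs N ε β (growthEvent N ε t p n j m L) ≤
        ENNReal.ofReal (C ^ (L + 1) * (t ^ m * (t / n) ^ (L - m))) := by
  have hg : (gaussInt (β / 2))⁻¹ ≠ ∞ := ENNReal.inv_ne_top.2 (gaussInt_pos _).ne'
  obtain ⟨K, hK1, hKg, hKG, hKR⟩ : ∃ K : ℝ, 1 ≤ K ∧ (gaussInt (β / 2))⁻¹ ≤ ENNReal.ofReal K ∧
      growthConst β ≤ ENNReal.ofReal K ∧ rootConst β ≤ ENNReal.ofReal K := by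
    refine ⟨1 + (gaussInt (β / 2))⁻¹.toReal + (growthConst β).toReal + (rootConst β).toReal,
      ?_, ?_, ?_, ?_⟩
    · linarith [(gaussInt (β / 2))⁻¹.toReal_nonneg, (growthConst β).toReal_nonneg,
        (rootConst β).toReal_nonneg]
    all_goals
      refine ENNReal.le_ofReal_iff_toReal_le ?_ ?_ |>.2 ?_
    any_goals exact hg
    any_goals exact (growthConst_lt_top hβ).ne
    any_goals exact (rootConst_lt_top hβ).ne
    all_goals linarith [(gaussInt (β / 2))⁻¹.toReal_nonneg, (growthConst β).toReal_nonneg,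
        (rootConst β).toReal_nonneg]
  have hK0 : 0 < K := by linarith
  -- K^(L+1) from the marginals, K^L from the creations and K from the root make (K²)^(L+1); the
  -- remaining 2e per particle comes from the combinatorial factors.
  have he : (1 : ℝ) ≤ Real.exp 1 := Real.one_le_exp zero_le_one
  refine ⟨2 * Real.exp 1 * K ^ 2, by nlinarith [one_le_pow₀ hK1 (n := 2)], ?_⟩
  intro N ε hε hε1 hN p t ht n j m L hj hmL
  refine measure_le_of_eventually (fun z hz => eventually_mem_pastEvent hε hε1 ht hj hz) ?_
  filter_upwards [Filter.eventually_gt_atTop 0] with M hM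
  have hn : (0 : ℝ) < n := by exact_mod_cast (Nat.zero_le j).trans_lt hj
  have hM' : (0 : ℝ) < M := by exact_mod_cast hM
  have hδ : 0 < t / (n * M) := by positivity
  refine (gibbs_pastEvent_le hε hε1 hN hβ _ _ (isCylinder_clusterFamily _ _ _ _ _ _)).trans ?_
  calc (gaussInt (β / 2))⁻¹ ^ (L + 1) *
        total (β / 2) (L + 1) (clusterFamily ε (t / (n * M)) p (j * M) M m)
      ≤ ENNReal.ofReal K ^ (L + 1) * (M.choose (L - m) * (j * M).choose m *
          (ENNReal.ofReal K * ENNReal.ofReal (t / (n * M) * (L + 1 : ℕ))) ^ L *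
            ENNReal.ofReal K) := by
        refine mul_le_mul' (pow_le_pow_left' hKg _)
          ((total_clusterFamily_le hε hε1 hN hδ hβ p _ _ hmL).trans ?_)
        gcongr
    _ = ENNReal.ofReal (K ^ (L + 1) * (M.choose (L - m) * (j * M).choose m *
          (K * (t / (n * M) * (L + 1 : ℕ))) ^ L * K)) := by
        have hx : 0 ≤ t / (n * M) * (L + 1 : ℕ) := by positivity
        generalize t / (n * M) * (L + 1 : ℕ) = x at hx
        rw [ENNReal.ofReal_mul (by positivity), ENNReal.ofReal_mul (by positivity),
          ENNReal.ofReal_mul (by positivity), ENNReal.ofReal_mul (by positivity),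
          ENNReal.ofReal_pow hK0.le, ENNReal.ofReal_pow (by positivity),
          ENNReal.ofReal_mul hK0.le, ENNReal.ofReal_natCast, ENNReal.ofReal_natCast]
    _ ≤ _ := by
        refine ENNReal.ofReal_le_ofReal ?_
        have h := choose_mul_choose_mul_pow_le ht.le ((Nat.zero_le j).trans_lt hj) hM hj.le hmL
        calc K ^ (L + 1) * (M.choose (L - m) * (j * M).choose m *
              (K * (t / (n * M) * (L + 1 : ℕ))) ^ L * K)
            = (K ^ 2) ^ (L + 1) * (M.choose (L - m) * (j * M).choose m *
              (t / (n * M) * (L + 1 : ℕ)) ^ L) := by ring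
          _ ≤ (K ^ 2) ^ (L + 1) * (Real.exp 1 * (2 * Real.exp 1) ^ L *
              (t ^ m * (t / n) ^ (L - m))) := by gcongr
          _ ≤ (K ^ 2) ^ (L + 1) * ((2 * Real.exp 1) * (2 * Real.exp 1) ^ L *
              (t ^ m * (t / n) ^ (L - m))) := by gcongr; linarith
          _ = _ := by ring

end PhaseBounds

/-! ### Pigeonhole over windows and the tail of the cluster size -/

section ClusterSize

/-- One of `n` successive growth factors is at least the geometric mean. -/
lemma exists_mul_le_of_pow_le {n : ℕ} (hn : 0 < n) {ρ : ℝ} (hρ : 0 < ρ) {a : ℕ → ℝ} (h0 : a 0 = 1)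
    (ha : ρ ^ n ≤ a n) : ∃ j < n, ρ * a j ≤ a (j + 1) := by
  by_contra! h
  have h1 : ∀ j, j < n → a (j + 1) < ρ ^ (j + 1) := by
    intro j
    induction j with
    | zero => intro hj; simpa [h0] using h 0 hj
    | succ j ih =>
      intro hj
      calc a (j + 1 + 1) < ρ * a (j + 1) := h _ hj
        _ < ρ * ρ ^ (j + 1) := by
          exact mul_lt_mul_of_pos_left (ih (by omega)) hρ
        _ = ρ ^ (j + 1 + 1) := by ring
  obtain ⟨j, rfl⟩ := Nat.exists_eq_succ_of_ne_zero hn.ne'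
  exact absurd ha (not_le.2 (h1 j (by omega)))

variable {N : ℕ}

/-- The cluster sizes at the n+1 endpoints go from 1 to k+1 ≥ ρⁿ, so some window has growth factor
at least ρ. The sum ranges over the sizes at its two ends. -/
lemma clusterEvent_subset [NeZero N] {ε t ρ : ℝ} {n k : ℕ} (hn : 0 < n) (hρ : 0 < ρ)
    (hk : ρ ^ n ≤ k + 1) : clusterEvent N ε t k ⊆
      ⋃ j ∈ Finset.range n, ⋃ L ∈ Finset.range N, ⋃ m ∈ Finset.range N,
        {Z | Z ∈ growthEvent N ε t 0 n j m L ∧ ρ * (m + 1) ≤ L + 1} := by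
  rintro Z ⟨γ, hγ, c, τ, hc⟩
  have hn' : (n : ℝ) ≠ 0 := by exact_mod_cast hn.ne'
  obtain ⟨j, hj, hle⟩ := exists_mul_le_of_pow_le hn hρ
    (a := fun j : ℕ => ((clusterAt c τ (t - j * (t / n))).card : ℝ))
    (by simp [hc.clusterAt_start]) (by
      have : t - n * (t / n) = 0 := by field_simp; ring
      simp only [this, hc.card_clusterAt_zero]
      exact_mod_cast hk)
  have hpos : ∀ s, ∃ m, m < N ∧ (clusterAt c τ s).card = m + 1 := by
    intro s
    have h1 : 0 < (clusterAt c τ s).card :=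
      Finset.card_pos.2 ⟨c 0, mem_clusterAt.2 ⟨0, Or.inl rfl, rfl⟩⟩
    have h2 : (clusterAt c τ s).card ≤ N := by simpa using Finset.card_le_univ (clusterAt c τ s)
    exact ⟨(clusterAt c τ s).card - 1, by omega, by omega⟩
  obtain ⟨m, hmN, hm⟩ := hpos (t - j * (t / n))
  obtain ⟨L, hLN, hL⟩ := hpos (t - (j + 1) * (t / n))
  refine Set.mem_iUnion₂.2 ⟨j, Finset.mem_range.2 hj, Set.mem_iUnion₂.2 ⟨L, Finset.mem_range.2 hLN,
    Set.mem_iUnion₂.2 ⟨m, Finset.mem_range.2 hmN, ⟨γ, hγ, k, c, τ, hc, hm, hL⟩, ?_⟩⟩⟩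
  push_cast at hle
  rw [hm, hL] at hle
  exact_mod_cast hle

/-- The bound is C(Ct/n)^L n^m. The choice of n gives (Ct/n)^L ≤ e^(-3L), and ρ(m+1) ≤ L+1 gives n^m
≤ e^(ρm) ≤ e^(L+1). The surviving e^(-2L) is shared between ρ, m and L, since ρ ≤ L+1 and m ≤ L. -/
lemma growth_bound {C T t ρ : ℝ} {n m L : ℕ} (hC : 1 ≤ C) (ht : 0 < t) (htT : t ≤ T) (hn : 0 < n)
    (hnC : C * max T 1 * Real.exp 3 ≤ n) (hnρ : n ≤ ρ) (hmL : ρ * (m + 1) ≤ L + 1) :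
    C ^ (L + 1) * (t ^ m * (t / n) ^ (L - m)) ≤
      C * Real.exp 2 * Real.exp (-(ρ / 2)) * Real.exp (-(1 / 2)) ^ m * Real.exp (-(1 / 2)) ^ L := by
  have hn0 : (0 : ℝ) < n := by exact_mod_cast hn
  have hn1 : (1 : ℝ) ≤ n := by exact_mod_cast hn
  have hm0 : (0 : ℝ) ≤ m := m.cast_nonneg
  have hmL' : m ≤ L := by
    have : (m : ℝ) ≤ L := by nlinarith
    exact_mod_cast this
  have hC0 : 0 < C := by linarith
  set D := C * max T 1 with hD
  have hD1 : 1 ≤ D := by nlinarith [le_max_right T 1]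
  have hCt : C * t ≤ D := mul_le_mul_of_nonneg_left (htT.trans (le_max_left _ _)) hC0.le
  have hq : D / n ≤ Real.exp (-3) := by
    rw [Real.exp_neg, div_le_iff₀ hn0, ← div_eq_inv_mul, le_div_iff₀ (Real.exp_pos _)]
    exact hnC
  have h1 : C ^ (L + 1) * (t ^ m * (t / n) ^ (L - m)) = C * ((C * t / n) ^ L * n ^ m) := by
    obtain ⟨i, rfl⟩ := Nat.exists_eq_add_of_le hmL'
    rw [Nat.add_sub_cancel_left]
    simp only [div_pow, mul_pow, pow_add]
    field_simp
  have h2 : (C * t / n) ^ L ≤ Real.exp (-3 * L) := by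
    rw [mul_comm (-3 : ℝ) (L : ℝ), Real.exp_nat_mul]
    exact pow_le_pow_left₀ (by positivity) ((by gcongr : C * t / n ≤ D / n).trans hq) L
  have h3 : (n : ℝ) ^ m ≤ Real.exp (L + 1) := by
    have hlog : Real.log n ≤ n := (Real.log_le_sub_one_of_pos hn0).trans (by linarith)
    rw [← Real.exp_log hn0, ← Real.exp_nat_mul]
    refine Real.exp_le_exp.2 ?_
    have : Real.log n * m ≤ ρ * m := by gcongr; linarith
    nlinarith
  have h4 : (ρ : ℝ) ≤ L + 1 := by nlinarith
  have h5 : (m : ℝ) ≤ L := by exact_mod_cast hmL'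
  calc C ^ (L + 1) * (t ^ m * (t / n) ^ (L - m))
      = C * ((C * t / n) ^ L * n ^ m) := h1
    _ ≤ C * (Real.exp (-3 * L) * Real.exp (L + 1)) := by gcongr
    _ = C * Real.exp (1 - 2 * L) := by rw [← Real.exp_add]; ring_nf
    _ ≤ C * Real.exp (2 + -(ρ / 2) + m * -(1 / 2) + L * -(1 / 2)) := by
        refine mul_le_mul_of_nonneg_left (Real.exp_le_exp.2 ?_) hC0.le
        linarith
    _ = _ := by
        rw [Real.exp_add, Real.exp_add, Real.exp_add, Real.exp_nat_mul, Real.exp_nat_mul]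
        ring

lemma exp_neg_half_lt_one : Real.exp (-(1 / 2)) < 1 :=
  Real.exp_zero ▸ Real.exp_lt_exp.2 (by norm_num)

lemma sum_exp_neg_half_pow_le (N : ℕ) :
    ∑ m ∈ Finset.range N, Real.exp (-(1 / 2)) ^ m ≤ 1 / (1 - Real.exp (-(1 / 2))) := by
  have h0 := exp_neg_half_lt_one
  rw [one_div (1 - _), ← tsum_geometric_of_lt_one (Real.exp_pos _).le h0]
  exact (summable_geometric_of_lt_one (Real.exp_pos _).le h0).sum_le_tsum _
    fun _ _ => pow_nonneg (Real.exp_pos _).le _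

/-- The bound of the tail of the cluster size distribution, uniform on bounded time intervals. -/
lemma exists_gibbs_clusterEvent_le {β T : ℝ} (hβ : 0 < β) :
    ∃ (n : ℕ) (C : ℝ), 0 < n ∧ 0 < C ∧ ∀ (N : ℕ) [NeZero N] (ε : ℝ), 0 < ε →
      ε ^ 2 * (N : ℝ) = 1 → ∀ t, 0 < t → t ≤ T → ∀ k : ℕ, n ^ n < k →
        gibbs N ε β (clusterEvent N ε t k) ≤
          ENNReal.ofReal (C * Real.exp (-(1 / 4) * (k : ℝ) ^ (1 / (n : ℝ)))) := by
  obtain ⟨C, hC, hbound⟩ := exists_gibbs_growthEvent_le hβ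
  obtain ⟨n, hnC⟩ := exists_nat_ge (C * max T 1 * Real.exp 3)
  have hC0 : 0 < C := by linarith
  have hn0 : (0 : ℝ) < n := lt_of_lt_of_le (by positivity) hnC
  have hn : 0 < n := by exact_mod_cast hn0
  have hr : 0 < 1 - Real.exp (-(1 / 2)) := sub_pos.2 exp_neg_half_lt_one
  set R := 1 / (1 - Real.exp (-(1 / 2))) with hR
  have hR0 : 0 < R := by positivity
  refine ⟨n, n * (C * Real.exp 2 * R * R), hn, by positivity, ?_⟩
  intro N _ ε hε hN t ht htT k hk
  have hε1 : ε ≤ 1 := by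
    have : (1 : ℝ) ≤ N := by exact_mod_cast NeZero.one_le
    nlinarith
  set ρ := (k : ℝ) ^ (1 / (n : ℝ)) with hρ
  have hρn : ρ ^ n = k := by
    rw [hρ, one_div, Real.rpow_inv_natCast_pow k.cast_nonneg hn.ne']
  -- This is where the threshold nⁿ < k is used: it makes the growth factor exceed the number of
  -- windows.
  have hnρ : (n : ℝ) ≤ ρ := by
    refine le_of_pow_le_pow_left₀ hn.ne' (by positivity) ?_
    rw [hρn]
    exact_mod_cast hk.le
  have hρ0 : 0 < ρ := hn0.trans_le hnρ
  set x := Real.exp (-(1 / 2)) with hx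
  have hx0 : 0 < x := Real.exp_pos _
  have hterm : ∀ j < n, ∀ L m : ℕ,
      gibbs N ε β {Z | Z ∈ growthEvent N ε t 0 n j m L ∧ ρ * (m + 1) ≤ L + 1} ≤
        ENNReal.ofReal (C * Real.exp 2 * Real.exp (-(ρ / 2)) * x ^ m * x ^ L) := by
    intro j hj L m
    by_cases h : ρ * (m + 1) ≤ L + 1
    · have hmL : m ≤ L := by
        have h1 : (1 : ℝ) ≤ n := by exact_mod_cast hn
        have h2 : (0 : ℝ) ≤ m := m.cast_nonneg
        have : (m : ℝ) ≤ L := by nlinarith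
        exact_mod_cast this
      refine (measure_mono fun Z hZ => hZ.1).trans ((hbound N ε hε hε1 hN 0 t ht n j m L hj
        hmL).trans (ENNReal.ofReal_le_ofReal ?_))
      exact growth_bound hC ht htT hn hnC hnρ h
    · refine (measure_mono_null (fun Z hZ => absurd hZ.2 h) measure_empty).le.trans zero_le
  calc gibbs N ε β (clusterEvent N ε t k)
      ≤ ∑ j ∈ Finset.range n, ∑ L ∈ Finset.range N, ∑ m ∈ Finset.range N,
          gibbs N ε β {Z | Z ∈ growthEvent N ε t 0 n j m L ∧ ρ * (m + 1) ≤ L + 1} :=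
        (measure_mono (clusterEvent_subset hn hρ0 (by rw [hρn]; linarith))).trans
          ((measure_biUnion_finset_le _ _).trans (Finset.sum_le_sum fun _ _ =>
            (measure_biUnion_finset_le _ _).trans (Finset.sum_le_sum fun _ _ =>
              measure_biUnion_finset_le _ _)))
    _ ≤ ∑ j ∈ Finset.range n, ∑ L ∈ Finset.range N, ∑ m ∈ Finset.range N,
          ENNReal.ofReal (C * Real.exp 2 * Real.exp (-(ρ / 2)) * x ^ m * x ^ L) :=
        Finset.sum_le_sum fun j hj => Finset.sum_le_sum fun L _ => Finset.sum_le_sum fun m _ =>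
          hterm j (Finset.mem_range.1 hj) L m
    _ = ENNReal.ofReal (∑ j ∈ Finset.range n, ∑ L ∈ Finset.range N, ∑ m ∈ Finset.range N,
          C * Real.exp 2 * Real.exp (-(ρ / 2)) * x ^ m * x ^ L) := by
        rw [ENNReal.ofReal_sum_of_nonneg fun _ _ => by positivity]
        refine Finset.sum_congr rfl fun j _ => ?_
        rw [ENNReal.ofReal_sum_of_nonneg fun _ _ => by positivity]
        refine Finset.sum_congr rfl fun L _ => ?_
        rw [ENNReal.ofReal_sum_of_nonneg fun _ _ => by positivity]
    _ ≤ _ := by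
        refine ENNReal.ofReal_le_ofReal ?_
        have hs := sum_exp_neg_half_pow_le N
        rw [← hx, ← hR] at hs
        simp_rw [← Finset.sum_mul, ← Finset.mul_sum]
        rw [Finset.sum_const, Finset.card_range, nsmul_eq_mul]
        have he : Real.exp (-(ρ / 2)) ≤ Real.exp (-(1 / 4) * ρ) :=
          Real.exp_le_exp.2 (by linarith)
        have hs0 : 0 ≤ ∑ m ∈ Finset.range N, x ^ m := Finset.sum_nonneg fun _ _ => by positivity
        calc C * Real.exp 2 * Real.exp (-(ρ / 2)) * (∑ m ∈ Finset.range N, x ^ m) *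
              (n * ∑ m ∈ Finset.range N, x ^ m)
            ≤ C * Real.exp 2 * Real.exp (-(1 / 4) * ρ) * R * (n * R) := by gcongr
          _ = _ := by ring

/-- A creation time would have to be both positive and at most 0. -/
lemma clusterEvent_zero_eq_empty [NeZero N] (ε : ℝ) {k : ℕ} (hk : 0 < k) :
    clusterEvent N ε 0 k = ∅ := by
  obtain ⟨k, rfl⟩ := Nat.exists_eq_succ_of_ne_zero hk.ne'
  refine Set.eq_empty_of_forall_notMem ?_
  rintro Z ⟨γ, -, c, τ, hc⟩
  exact absurd (hc.pos 0) (not_lt.2 (hc.tau_le _))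

lemma gibbs_le_one (N : ℕ) (ε β : ℝ) (S : Set (Config N)) : gibbs N ε β S ≤ 1 := by
  rw [gibbs, Measure.smul_apply, smul_eq_mul]
  exact (mul_le_mul_right (measure_mono (Set.subset_univ S)) _).trans (ENNReal.inv_mul_le_one _)

lemma summable_mul_exp_neg_rpow {n : ℕ} (hn : 0 < n) (C : ℝ) :
    Summable fun k : ℕ => (k : ℝ) * (C * Real.exp (-(1 / 4) * (k : ℝ) ^ (1 / (n : ℝ)))) := by
  have h1 : Summable fun k : ℕ => (k : ℝ) * Real.exp (-(1 / 4) * (k : ℝ) ^ (1 / (n : ℝ))) := by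
    refine Summable.of_nonneg_of_le (fun k => by positivity) (fun k => ?_)
      ((Real.summable_one_div_nat_pow.2 one_lt_two).mul_left
        (((3 * n).factorial : ℝ) * 4 ^ (3 * n)))
    rcases Nat.eq_zero_or_pos k with rfl | hk
    · simp
    have hk0 : (0 : ℝ) < k := by exact_mod_cast hk
    set x := (k : ℝ) ^ (1 / (n : ℝ)) with hx
    have hx0 : 0 < x := by positivity
    have hxn : x ^ n = k := by
      rw [hx, one_div, Real.rpow_inv_natCast_pow k.cast_nonneg hn.ne']
    -- The exponent 3n makes the exponential at least a multiple of k³, so that the term is O(1/k²).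
    have h2 := Real.pow_div_factorial_le_exp (x / 4) (by positivity) (3 * n)
    have h3 : (x / 4) ^ (3 * n) = k ^ 3 / 4 ^ (3 * n) := by
      rw [div_pow, mul_comm 3 n, pow_mul x, hxn]
    have hf : (0 : ℝ) < (3 * n).factorial := by exact_mod_cast Nat.factorial_pos _
    rw [h3, div_div, div_le_iff₀ (by positivity)] at h2
    rw [show -(1 / 4) * x = -(x / 4) by ring, Real.exp_neg, ← div_eq_mul_inv,
      div_le_iff₀ (Real.exp_pos _), mul_one_div, div_mul_eq_mul_div, le_div_iff₀ (by positivity)]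
    nlinarith
  simpa only [mul_left_comm] using h1.mul_left C

end ClusterSize

end HardSpheres

end

/-! ### The tail estimate and the mean -/

theorem theorem1 (β : ℝ) (hβ : 0 < β) :
    (∀ t : ℝ, 0 < t → ∃ (k₀ : ℕ) (C : ℝ), 0 < C ∧
      ∀ (N : ℕ) [NeZero N] (ε : ℝ), 0 < ε → ε ^ 2 * (N : ℝ) = 1 →
        ∀ k : ℕ, k₀ < k →
          HardSpheres.gibbs N ε β (HardSpheres.clusterEvent N ε t k) ≤
            ENNReal.ofReal (C * t * Real.exp (-(1 / 4) * (k : ℝ) ^ (1 / (C * t))))) ∧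
    (∀ T : ℝ, 0 < T → ∃ M : ℝ,
      ∀ (N : ℕ) [NeZero N] (ε : ℝ), 0 < ε → ε ^ 2 * (N : ℝ) = 1 →
        ∀ t ∈ Set.Icc 0 T,
          HardSpheres.averageClusterSize N ε β t ≤ ENNReal.ofReal M) := by
  refine ⟨fun t ht => ?_, fun T _ => ?_⟩
  · obtain ⟨n, C, hn, hC, h⟩ := HardSpheres.exists_gibbs_clusterEvent_le (T := t) hβ
    have hn0 : (0 : ℝ) < n := by exact_mod_cast hn
    -- With this constant, the product with t is max(n, C): it dominates the prefactor, and its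
    -- inverse is an exponent at most 1/n, which only weakens the bound as k ≥ 1.
    refine ⟨n ^ n, max (n : ℝ) C / t, div_pos (lt_max_of_lt_right hC) ht, ?_⟩
    intro N _ ε hε hN k hk
    refine (h N ε hε hN t ht le_rfl k hk).trans (ENNReal.ofReal_le_ofReal ?_)
    rw [div_mul_cancel₀ _ ht.ne']
    have hk1 : (1 : ℝ) ≤ k := by exact_mod_cast (Nat.zero_le _).trans_lt hk
    have hpow : (k : ℝ) ^ (1 / max (n : ℝ) C) ≤ (k : ℝ) ^ (1 / (n : ℝ)) :=
      Real.rpow_le_rpow_of_exponent_le hk1 (one_div_le_one_div_of_le hn0 (le_max_left _ _))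
    exact mul_le_mul (le_max_right _ _) (Real.exp_le_exp.2 (by linarith)) (Real.exp_pos _).le
      (hC.le.trans (le_max_right _ _))
  · obtain ⟨n, C, hn, hC, h⟩ := HardSpheres.exists_gibbs_clusterEvent_le (T := T) hβ
    have hsum := HardSpheres.summable_mul_exp_neg_rpow hn C
    set f : ℕ → ℝ := fun k => (k : ℝ) * (C * Real.exp (-(1 / 4) * (k : ℝ) ^ (1 / (n : ℝ)))) with hf
    have hf0 : ∀ k, 0 ≤ f k := fun k => by positivity
    -- Below the threshold nⁿ, which depends on T only, the probability is bounded by 1; g collects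
    -- these finitely many terms, and f the tail.
    set g : ℕ → ℝ := fun k => if k ≤ n ^ n then (k : ℝ) else 0 with hg
    have hg0 : ∀ k, 0 ≤ g k := fun k => by simp only [hg]; split_ifs <;> positivity
    have hgsum : Summable g := summable_of_ne_finset_zero (s := Finset.range (n ^ n + 1))
      fun k hk => if_neg fun hle => hk (Finset.mem_range.2 (by omega))
    refine ⟨∑' k, (g k + f k), ?_⟩
    intro N _ ε hε hN t ht
    calc HardSpheres.averageClusterSize N ε β t
        ≤ ∑ k ∈ Finset.range N, ENNReal.ofReal (g k + f k) := by
          refine Finset.sum_le_sum fun k _ => ?_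
          rcases Nat.eq_zero_or_pos k with rfl | hk
          · simp
          rcases ht.1.eq_or_lt with rfl | ht0
          · rw [HardSpheres.clusterEvent_zero_eq_empty ε hk]
            simp
          by_cases hkn : k ≤ n ^ n
          · calc (k : ENNReal) * HardSpheres.gibbs N ε β (HardSpheres.clusterEvent N ε t k)
                ≤ k * 1 := by gcongr; exact HardSpheres.gibbs_le_one _ _ _ _
              _ = ENNReal.ofReal (g k) := by simp [hg, hkn]
              _ ≤ _ := ENNReal.ofReal_le_ofReal (by linarith [hf0 k])
          · calc (k : ENNReal) * HardSpheres.gibbs N ε β (HardSpheres.clusterEvent N ε t k)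
                ≤ k * ENNReal.ofReal (C * Real.exp (-(1 / 4) * (k : ℝ) ^ (1 / (n : ℝ)))) := by
                  gcongr
                  exact h N ε hε hN t ht0 ht.2 k (not_le.1 hkn)
              _ = ENNReal.ofReal (f k) := by
                  rw [hf, ENNReal.ofReal_mul k.cast_nonneg, ENNReal.ofReal_natCast]
              _ ≤ _ := ENNReal.ofReal_le_ofReal (by linarith [hg0 k])
      _ = ENNReal.ofReal (∑ k ∈ Finset.range N, (g k + f k)) :=
          (ENNReal.ofReal_sum_of_nonneg fun k _ => add_nonneg (hg0 k) (hf0 k)).symm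
      _ ≤ _ := ENNReal.ofReal_le_ofReal ((hgsum.add hsum).sum_le_tsum _
          fun k _ => add_nonneg (hg0 k) (hf0 k))
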